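/- Consider an $M/G/(M/M)$ queueing system: jobs arrive according to a Poisson process of rate $\lambda_c>0$ and carry i.i.d. nonnegative workloads (service times when served by a single server) with an arbitrary distribution of finite mean $1/\mu_c>0$; servers arrive according to a Poisson process of rate $\lambda_s>0$ and stay for i.i.d. exponential lifetimes of mean $1/\mu_s>0$, and a server present at time $0$ has an exponential remaining lifetime with the same mean; all these random variables are independent. Let $n_s(t)$ be the number of servers present at time $t$, and let $X(t)$ be the total remaining workload at time $t$: it increases by the workload of each arriving job and, while positive, is depleted at rate $n_s(t)$. Put $\rho_c=\lambda_c/\mu_c$ and $\rho_s=\lambda_s/\mu_s$. If $\rho_c<\rho_s$, then the system is stable, i.e. the job-server process $(X(t),n_s(t))_{t\ge 0}$ on $[0,\infty)\times\{0,1,2,\dots\}$ is positive recurrent, in the following sense: 1. it is Harris recurrent: there is a nonzero $\sigma$-finite measure $\varphi$ on the state space such that, for every measurable set $A$ with $\varphi(A)>0$ and every initial state, the process almost surely spends an infinite total amount of time in $A$; 2. it has a stationary probability distribution; 3. for every $j\ge 0$, the mean time to hit the state $(0,j)$ from any other initial state, and the mean time to return to $(0,j)$ after leaving it when the process starts there,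 are finite. -/

import Mathlib

open MeasureTheory ProbabilityTheory
open scoped NNReal ENNReal

noncomputable section

/-! ### Positive recurrence of a continuous-time process

`Z z t ω` is the state at time `t ≥ 0` of the process that starts in the state `z`, in the
outcome `ω` of the probability space `(Ω, P)`. -/

section Recurrence

variable {Ω E : Type*} [MeasurableSpace Ω] [MeasurableSpace E]

/-- The total time that the path `f` spends in `A`. -/
def occupationTime (f : ℝ → E) (A : Set E) : ℝ≥0∞ :=
  volume {t : ℝ | 0 ≤ t ∧ f t ∈ A}

/-- The first time at which the path `f` is in the state `a` after having been outside `a`: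
the hitting time of `a` if `f` starts elsewhere, the return time to `a` if `f` starts in `a`;
it is `∞` if there is no such time. -/
def returnTime (f : ℝ → E) (a : E) : ℝ≥0∞ :=
  ⨅ (t : ℝ) (_ : f t = a ∧ ∃ s, 0 ≤ s ∧ s < t ∧ f s ≠ a), ENNReal.ofReal t

/-- Harris recurrence: there is a nontrivial σ-finite measure such that every set that it charges
is almost surely occupied for an infinite amount of time, whatever the initial state. -/
def IsHarrisRecurrent (P : Measure Ω) (Z : E → ℝ → Ω → E) : Prop :=
  ∃ φ : Measure E, SigmaFinite φ ∧ φ ≠ 0 ∧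
    ∀ A : Set E, MeasurableSet A → 0 < φ A →
      ∀ z : E, ∀ᵐ ω ∂P, occupationTime (fun t => Z z t ω) A = ∞

/-- `π` is a stationary distribution: if the initial state is distributed according to `π`
(independently of `ω`), then so is the state at every time `t ≥ 0`. -/
def IsStationaryDistribution (P : Measure Ω) (Z : E → ℝ → Ω → E) (π : Measure E) : Prop :=
  IsProbabilityMeasure π ∧
    ∀ t : ℝ, 0 ≤ t → ∀ A : Set E, MeasurableSet A → ∫⁻ z, P {ω | Z z t ω ∈ A} ∂π = π A

/-- Positive Harris recurrence: Harris recurrence and existence of a stationary distribution. -/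
def IsPositiveHarrisRecurrent (P : Measure Ω) (Z : E → ℝ → Ω → E) : Prop :=
  IsHarrisRecurrent P Z ∧ ∃ π : Measure E, IsStationaryDistribution P Z π

/-- The state `a` is positive recurrent and reached from everywhere: its mean hitting time from
every state, and its mean return time, are finite. -/
def HasFiniteMeanReturn (P : Measure Ω) (Z : E → ℝ → Ω → E) (a : E) : Prop :=
  ∀ z : E, ∫⁻ ω, returnTime (fun t => Z z t ω) a ∂P < ∞

end Recurrence

/-! ### The queueing system -/

/-- The data of an `M/G/(M/M)` system. -/
structure MGMM where
  /-- rate of the Poisson process of job arrivals -/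
  lamC : ℝ
  /-- reciprocal of the mean workload of a job -/
  muC : ℝ
  /-- rate of the Poisson process of server arrivals -/
  lamS : ℝ
  /-- rate of the exponential lifetime of a server -/
  muS : ℝ
  lamC_pos : 0 < lamC
  muC_pos : 0 < muC
  lamS_pos : 0 < lamS
  muS_pos : 0 < muS
  /-- distribution of the workload of a job (its service time by a single server) -/
  workload : Measure ℝ
  workload_prob : IsProbabilityMeasure workload
  workload_nonneg : ∀ᵐ l ∂workload, 0 ≤ l
  workload_integrable : Integrable (fun l : ℝ => l) workload
  workload_mean : ∫ l, l ∂workload = 1 / muC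

namespace MGMM

/-- The job load demand. -/
def rhoC (q : MGMM) : ℝ := q.lamC / q.muC

/-- The service capacity. -/
def rhoS (q : MGMM) : ℝ := q.lamS / q.muS

/-- An outcome: for every arriving job its interarrival time and workload, for every arriving
server its interarrival time and lifetime, and the (residual) lifetimes of the servers that are
present at time `0`. -/
abbrev Outcome : Type := (ℕ → ℝ × ℝ) × (ℕ → ℝ × ℝ) × (ℕ → ℝ)

/-- The law of the outcome: all the random variables are independent; interarrival times and
lifetimes are exponential and workloads have the given distribution. -/
def law (q : MGMM) : Measure Outcome :=
  (Measure.infinitePi fun _ : ℕ => (expMeasure q.lamC).prod q.workload).prod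
    ((Measure.infinitePi fun _ : ℕ => (expMeasure q.lamS).prod (expMeasure q.muS)).prod
      (Measure.infinitePi fun _ : ℕ => expMeasure q.muS))

instance (q : MGMM) : IsProbabilityMeasure q.law := by
  have := q.workload_prob
  have := isProbabilityMeasure_expMeasure q.lamC_pos
  have := isProbabilityMeasure_expMeasure q.lamS_pos
  have := isProbabilityMeasure_expMeasure q.muS_pos
  unfold law
  infer_instance

/-- Arrival time of the `i`-th job. -/
def jobArrival (ω : Outcome) (i : ℕ) : ℝ := ∑ k ∈ Finset.range (i + 1), (ω.1 k).1

/-- Arrival time of the `j`-th server. -/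
def serverArrival (ω : Outcome) (j : ℕ) : ℝ := ∑ k ∈ Finset.range (j + 1), (ω.2.1 k).1

/-- The number of servers at time `t`, with `n` servers at time `0`: the initial servers whose
lifetime has not expired, and the servers that have arrived and not yet departed. -/
def numServers (n : ℕ) (t : ℝ) (ω : Outcome) : ℕ :=
  {i : ℕ | i < n ∧ t < ω.2.2 i}.ncard +
    {j : ℕ | serverArrival ω j ≤ t ∧ t < serverArrival ω j + (ω.2.1 j).2}.ncard

/-- The total workload that arrives during `[0, t]`. -/
def arrivedWork (t : ℝ) (ω : Outcome) : ℝ :=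
  ∑' i : ℕ, if jobArrival ω i ≤ t then (ω.1 i).2 else 0

/-- The free workload: initial plus arrived workload, minus the work that the servers could have
done during `[0, t]` had they never been idle. -/
def netInput (x : ℝ≥0) (n : ℕ) (t : ℝ) (ω : Outcome) : ℝ :=
  x + arrivedWork t ω - ∫ s in (0 : ℝ)..t, (numServers n s ω : ℝ)

/-- The total service time `X(t)` of the jobs present at time `t`: every server works at unit rate
as long as there is work. It is the free workload reflected at `0`, that is, the solution of
`dX = d(arrived work) - n_s(t) 1_{X > 0} dt`. -/
def work (x : ℝ≥0) (n : ℕ) (t : ℝ) (ω : Outcome) : ℝ≥0 :=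
  Real.toNNReal (netInput x n t ω +
    sSup ((fun s => max 0 (-netInput x n s ω)) '' Set.Icc 0 t))

/-- The job-server process `(X(t), n_s(t))` with initial state `z = (X(0), n_s(0))`. -/
def jobServer (z : ℝ≥0 × ℕ) (t : ℝ) (ω : Outcome) : ℝ≥0 × ℕ :=
  (work z.1 z.2 t ω, numServers z.2 t ω)

/-- Stability: the job-server process is positive recurrent. Since the workload takes values in a
continuum, this is positive Harris recurrence together with finiteness of the mean hitting and
return times of all the states `(0, j)` without work. -/
def IsStable (q : MGMM) : Prop :=
  IsPositiveHarrisRecurrent q.law jobServer ∧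
    ∀ j : ℕ, HasFiniteMeanReturn q.law jobServer ((0, j) : ℝ≥0 × ℕ)

end MGMM

end

/-! The process is observed along a grid of step `T`, and the states `(0, j)` serve as atoms of the
resulting chain.

Drift. In time `t` the mean arriving work is at most `ρ_c t`. The servers that arrive after time
`0`, whatever the initial state, offer mean capacity at least `ρ_s t - ρ_s / μ_s`. Since `ρ_c <
ρ_s`, a large `t` leaves a surplus exceeding `1`, and by monotone convergence this persists when the
capacity is truncated at a large initial workload `x` (`exists_mean_capacity_gt`). So a large
workload decreases by at least `1` on average, while the number of servers contracts to `e^{-μ_s t}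
n` plus at most `ρ_s`. For `V = x + c n` with `c = 1 / (2 ρ_s)` this is a Foster–Lyapunov inequality
outside a box `x ≤ K`, `n ≤ N` (`exists_drift`).

Accessibility. From every state of the box, `(0, j)` is reached at time `T` with probability at
least some `p > 0`: no job arrives, enough short-lived servers clear the work, and exactly `j`
servers remain (`exists_transition_singleton_ge`). Adding a constant to `2 V` absorbs the excess in
the box into the chance of hitting the atom, so that `1 + E[W(Z_T); Z_T ≠ (0, j)] ≤ W` everywhere
(`exists_lyapunov`).

Consequences. This inequality bounds the mean number of grid steps needed to hit the atom; escape
from the atom takes a geometric number of steps, so mean return times are finite. The occupation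
measure of one excursion from the atom is a finite invariant measure of the grid chain, and
averaging it over a period makes it stationary in continuous time. Finally, for every phase `u` the
shifted grid `u + ℕ T` almost surely meets the atom infinitely often; Fubini over `u` gives infinite
occupation time, with the Dirac mass at the atom as Harris measure.

Markov property. The process is an explicit function of the outcome, so the property is proved by
coupling. A past and an independent future are glued at time `t` by a map that preserves `law`
(`measurePreserving_spliceOutcome`); the same pair is mapped to the past and an independent
restarted outcome (`measurePreserving_restartOutcome`). The flow property of Skorokhod reflection
identifies the two evolutions (`jobServer_splice_add`). -/

/-! ### Infinite product measures -/

section InfinitePi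

variable {X Y W ι κ : Type*}

/-- Prepend a term to a sequence. -/
def seqCons (h : X) (y : ℕ → X) : ℕ → X
  | 0 => h
  | k + 1 => y k

@[simp] theorem seqCons_zero (h : X) (y : ℕ → X) : seqCons h y 0 = h := rfl

@[simp] theorem seqCons_succ (h : X) (y : ℕ → X) (k : ℕ) : seqCons h y (k + 1) = y k := rfl

variable [MeasurableSpace X] [MeasurableSpace Y] [MeasurableSpace W]

theorem measurable_seqCons : Measurable fun p : X × (ℕ → X) => seqCons p.1 p.2 := by
  refine measurable_pi_lambda _ fun k => ?_
  cases k with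
  | zero => exact measurable_fst
  | succ k => exact (measurable_pi_apply k).comp measurable_snd

@[fun_prop]
theorem Measurable.seqCons {α : Type*} [MeasurableSpace α] {f : α → X} {g : α → ℕ → X}
    (hf : Measurable f) (hg : Measurable g) : Measurable fun a => seqCons (f a) (g a) :=
  measurable_seqCons.comp (hf.prodMk hg)

theorem measurePreserving_seqCons (μ : Measure X) [IsProbabilityMeasure μ] :
    MeasurePreserving (fun p : X × (ℕ → X) => seqCons p.1 p.2)
      (μ.prod (Measure.infinitePi fun _ : ℕ => μ)) (Measure.infinitePi fun _ : ℕ => μ) := by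
  refine ⟨measurable_seqCons, Measure.eq_infinitePi _ fun s t ht => ?_⟩
  rw [Measure.map_apply measurable_seqCons (.pi s.countable_toSet fun _ _ => ht _)]
  have hinj : Set.InjOn Nat.succ (Nat.succ ⁻¹' (s : Set ℕ)) := Nat.succ_injective.injOn
  have h1 : (fun p : X × (ℕ → X) => seqCons p.1 p.2) ⁻¹' ((s : Set ℕ).pi t) =
      (if 0 ∈ s then t 0 else Set.univ) ×ˢ
        (((s.preimage Nat.succ hinj : Finset ℕ) : Set ℕ).pi fun k => t (k + 1)) := by
    ext ⟨h, y⟩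
    simp only [Set.mem_preimage, Set.mem_pi, Finset.mem_coe, Set.mem_prod, Finset.mem_preimage]
    constructor
    · intro H
      refine ⟨?_, fun k hk => H _ hk⟩
      split_ifs with h0
      · exact H 0 h0
      · trivial
    · rintro ⟨H0, H1⟩ k hk
      cases k with
      | zero => rw [if_pos hk] at H0; exact H0
      | succ k => exact H1 k hk
  rw [h1, Measure.prod_prod, Measure.infinitePi_pi _ fun i _ => ht _]
  have h2 : ∏ i ∈ s.preimage Nat.succ hinj, μ (t (i + 1)) =
      ∏ i ∈ s.erase 0, μ (t i) := by
    refine Finset.prod_nbij' Nat.succ Nat.pred ?_ ?_ ?_ ?_ ?_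
    · intro i hi; simpa using hi
    · intro i hi
      obtain ⟨h0, hi⟩ := Finset.mem_erase.1 hi
      rw [Finset.mem_preimage, Nat.succ_pred_eq_of_ne_zero h0]; exact hi
    · intro i _; rfl
    · intro i hi; exact Nat.succ_pred_eq_of_ne_zero (Finset.mem_erase.1 hi).1
    · intro i _; rfl
  rw [h2]
  split_ifs with h0
  · exact Finset.mul_prod_erase s (fun i => μ (t i)) h0
  · rw [measure_univ, one_mul, Finset.erase_eq_of_notMem h0]

/-- Conditioning on the first term of an i.i.d. sequence; it drives the inductions on the number of
arrivals. -/
theorem lintegral_infinitePi_nat (μ : Measure X) [IsProbabilityMeasure μ] {F : (ℕ → X) → ℝ≥0∞}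
    (hF : Measurable F) :
    ∫⁻ y, F y ∂(Measure.infinitePi fun _ : ℕ => μ) =
      ∫⁻ h, ∫⁻ y, F (seqCons h y) ∂(Measure.infinitePi fun _ : ℕ => μ) ∂μ := by
  rw [← (measurePreserving_seqCons μ).lintegral_comp hF, lintegral_prod]
  exact (hF.comp measurable_seqCons).aemeasurable

/-- Serves to merge the pools of residual lifetimes of initial and later servers into a single
i.i.d. family. -/
theorem measurePreserving_sumElim (μ : Measure X) [IsProbabilityMeasure μ] :
    MeasurePreserving (fun p : (ι → X) × (κ → X) => (Sum.elim p.1 p.2 : ι ⊕ κ → X))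
      ((Measure.infinitePi fun _ : ι => μ).prod (Measure.infinitePi fun _ : κ => μ))
      (Measure.infinitePi fun _ : ι ⊕ κ => μ) := by
  classical
  have hm : Measurable fun p : (ι → X) × (κ → X) => (Sum.elim p.1 p.2 : ι ⊕ κ → X) := by
    refine measurable_pi_lambda _ fun k => ?_
    cases k with
    | inl i => exact (measurable_pi_apply i).comp measurable_fst
    | inr i => exact (measurable_pi_apply i).comp measurable_snd
  refine ⟨hm, Measure.eq_infinitePi _ fun s t ht => ?_⟩
  rw [Measure.map_apply hm (.pi s.countable_toSet fun _ _ => ht _)]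
  have h1 : (fun p : (ι → X) × (κ → X) => (Sum.elim p.1 p.2 : ι ⊕ κ → X)) ⁻¹'
      ((s : Set (ι ⊕ κ)).pi t) =
      ((s.toLeft : Set ι).pi fun i => t (Sum.inl i)) ×ˢ
        ((s.toRight : Set κ).pi fun i => t (Sum.inr i)) := by
    ext ⟨p, q⟩
    simp [Set.mem_pi]
  rw [h1, Measure.prod_prod, Measure.infinitePi_pi _ fun i _ => ht _,
    Measure.infinitePi_pi _ fun i _ => ht _]
  conv_rhs => rw [← Finset.toLeft_disjSum_toRight (u := s), Finset.prod_disjSum]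

theorem measurePreserving_infinitePi_map₂ (μ : Measure X) [IsProbabilityMeasure μ]
    (ν : Measure Y) [IsProbabilityMeasure ν] {θ : Measure W} {g : X × Y → W}
    (hg : MeasurePreserving g (μ.prod ν) θ) :
    MeasurePreserving (fun (p : (ι → X) × (ι → Y)) i => g (p.1 i, p.2 i))
      ((Measure.infinitePi fun _ : ι => μ).prod (Measure.infinitePi fun _ : ι => ν))
      (Measure.infinitePi fun _ : ι => θ) := by
  have : IsProbabilityMeasure θ := hg.map_eq ▸ Measure.isProbabilityMeasure_map hg.1.aemeasurable
  have hg1 := hg.measurable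
  have hm : Measurable fun (p : (ι → X) × (ι → Y)) i => g (p.1 i, p.2 i) := by fun_prop
  refine ⟨hm, Measure.eq_infinitePi _ fun s t ht => ?_⟩
  have hbox : MeasurableSet ((s : Set ι).pi t) := .pi s.countable_toSet fun _ _ => ht _
  rw [Measure.map_apply hm hbox, Measure.prod_apply (hm hbox)]
  have h1 : ∀ x : ι → X, (Measure.infinitePi fun _ : ι => ν)
      (Prod.mk x ⁻¹' ((fun (p : (ι → X) × (ι → Y)) i => g (p.1 i, p.2 i)) ⁻¹' (s : Set ι).pi t)) =
      ∏ i ∈ s, ν (Prod.mk (x i) ⁻¹' (g ⁻¹' t i)) := by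
    intro x
    have : (Prod.mk x ⁻¹' ((fun (p : (ι → X) × (ι → Y)) i => g (p.1 i, p.2 i)) ⁻¹'
        (s : Set ι).pi t)) = (s : Set ι).pi fun i => (Prod.mk (x i) ⁻¹' (g ⁻¹' t i)) := by
      ext; simp [Set.mem_pi]
    rw [this, Measure.infinitePi_pi]
    intro i _
    exact measurable_prodMk_left (hg1 (ht i))
  simp_rw [h1]
  have h2 : ∀ i, Measurable fun x : X => ν (Prod.mk x ⁻¹' (g ⁻¹' t i)) := fun i =>
    measurable_measure_prodMk_left (hg1 (ht i))
  -- After integrating out the second sequence, the factors depend on distinct coordinates of the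
  -- first one, hence are independent.
  have h3 := lintegral_prod_eq_prod_lintegral_of_indepFun (μ := Measure.infinitePi fun _ : ι => μ) s
    (fun i (x : ι → X) => ν (Prod.mk (x i) ⁻¹' (g ⁻¹' t i)))
    (iIndepFun_infinitePi h2) (fun i => (h2 i).comp (measurable_pi_apply i))
  rw [h3]
  refine Finset.prod_congr rfl fun i _ => ?_
  rw [(measurePreserving_eval_infinitePi (fun _ : ι => μ) i).lintegral_comp (h2 i),
    ← Measure.prod_apply (hg1 (ht i)), hg.measure_preimage (ht i).nullMeasurableSet]

theorem measurePreserving_prodProdProdComm {X' Y' : Type*} [MeasurableSpace X'] [MeasurableSpace Y']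
    (a : Measure X) (b : Measure Y) (c : Measure X') (d : Measure Y')
    [SigmaFinite a] [SigmaFinite b] [SigmaFinite c] [SigmaFinite d] :
    MeasurePreserving (fun p : (X × Y) × (X' × Y') => ((p.1.1, p.2.1), (p.1.2, p.2.2)))
      ((a.prod b).prod (c.prod d)) ((a.prod c).prod (b.prod d)) := by
  have hm : Measurable fun p : (X × Y) × (X' × Y') => ((p.1.1, p.2.1), (p.1.2, p.2.2)) := by
    fun_prop
  have h1 := measurePreserving_prodAssoc a b (c.prod d)
  have h2 := (MeasurePreserving.id a).prod ((measurePreserving_prodAssoc b c d).symm)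
  have h3 := (MeasurePreserving.id a).prod
    ((Measure.measurePreserving_swap (μ := b) (ν := c)).prod (MeasurePreserving.id d))
  have h4 := (MeasurePreserving.id a).prod (measurePreserving_prodAssoc c b d)
  have h5 := (measurePreserving_prodAssoc a c (b.prod d)).symm
  exact ((((h5.comp h4).comp h3).comp h2).comp h1)

end InfinitePi

/-! ### Exponential distributions -/

section Exponential

variable {r : ℝ}

theorem lintegral_expMeasure (r : ℝ) {F : ℝ → ℝ≥0∞} (hF : Measurable F) :
    ∫⁻ x, F x ∂expMeasure r =
      ∫⁻ x in Set.Ici 0, ENNReal.ofReal (r * Real.exp (-(r * x))) * F x := by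
  have h0 : expMeasure r = volume.withDensity (exponentialPDF r) := rfl
  have h1 : Measurable (exponentialPDF r) := (measurable_exponentialPDFReal r).ennreal_ofReal
  rw [h0, lintegral_withDensity_eq_lintegral_mul _ h1 hF, ← lintegral_indicator measurableSet_Ici]
  refine lintegral_congr fun x => ?_
  by_cases hx : 0 ≤ x
  · rw [Set.indicator_of_mem (by exact hx), Pi.mul_apply, exponentialPDF_of_nonneg hx]
  · rw [Set.indicator_of_notMem (by exact hx), Pi.mul_apply,
      exponentialPDF_of_neg (lt_of_not_ge hx), zero_mul]

theorem expMeasure_Iic (hr : 0 < r) {x : ℝ} (hx : 0 ≤ x) :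
    expMeasure r (Set.Iic x) = ENNReal.ofReal (1 - Real.exp (-(r * x))) := by
  have := isProbabilityMeasure_expMeasure hr
  rw [← ofReal_cdf, cdf_expMeasure_eq hr, if_pos hx]

theorem expMeasure_Ioi (hr : 0 < r) {x : ℝ} (hx : 0 ≤ x) :
    expMeasure r (Set.Ioi x) = ENNReal.ofReal (Real.exp (-(r * x))) := by
  have := isProbabilityMeasure_expMeasure hr
  rw [← Set.compl_Iic, prob_compl_eq_one_sub measurableSet_Iic, expMeasure_Iic hr hx,
    ← ENNReal.ofReal_one, ← ENNReal.ofReal_sub _ (by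
      rw [sub_nonneg, Real.exp_le_one_iff]; nlinarith)]
  simp

theorem ae_pos_expMeasure (hr : 0 < r) : ∀ᵐ x ∂expMeasure r, 0 < x := by
  have := isProbabilityMeasure_expMeasure hr
  rw [ae_iff]
  have : {a : ℝ | ¬ 0 < a} = Set.Iic 0 := by ext; simp
  rw [this, expMeasure_Iic hr le_rfl]
  simp

theorem expMeasure_Ioo_pos (hr : 0 < r) {a b : ℝ} (ha : 0 ≤ a) (hab : a < b) :
    0 < expMeasure r (Set.Ioo a b) := by
  rw [pos_iff_ne_zero]
  intro h0
  have h1 : expMeasure r = volume.withDensity (exponentialPDF r) := rfl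
  have h2 : Measurable (exponentialPDF r) := (measurable_exponentialPDFReal r).ennreal_ofReal
  rw [h1, withDensity_apply_eq_zero h2] at h0
  have h3 : {x | exponentialPDF r x ≠ 0} ∩ Set.Ioo a b = Set.Ioo a b := by
    refine Set.inter_eq_right.2 fun x hx => ?_
    have hx0 : 0 < x := ha.trans_lt hx.1
    simp only [Set.mem_ofPred_eq]
    rw [exponentialPDF_of_nonneg hx0.le, Ne, ENNReal.ofReal_eq_zero, not_le]
    positivity
  rw [h3, Real.volume_Ioo, ENNReal.ofReal_eq_zero] at h0
  linarith

/-- The exponential distribution is memoryless. -/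
theorem lintegral_expMeasure_indicator_Ioi (hr : 0 < r) {t : ℝ} (ht : 0 ≤ t) {F : ℝ → ℝ≥0∞}
    (hF : Measurable F) :
    ∫⁻ x, (Set.Ioi t).indicator F x ∂expMeasure r =
      expMeasure r (Set.Ioi t) * ∫⁻ x, F (t + x) ∂expMeasure r := by
  rw [lintegral_expMeasure r (hF.indicator measurableSet_Ioi),
    lintegral_expMeasure r (by fun_prop), expMeasure_Ioi hr ht,
    ← lintegral_const_mul _ (by fun_prop), ← lintegral_indicator measurableSet_Ici,
    ← lintegral_indicator measurableSet_Ici,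
    ← lintegral_add_left_eq_self (fun x => (Set.Ici (0 : ℝ)).indicator _ x) t]
  -- The open and closed half-lines differ at `0`, a null point.
  have h0 : ∀ᵐ x : ℝ, x ≠ 0 := by simp [ae_iff]
  refine lintegral_congr_ae ?_
  filter_upwards [h0] with x hx
  rcases lt_or_gt_of_ne hx with hx | hx
  · rw [Set.indicator_of_notMem (s := Set.Ici (0 : ℝ)) (a := x) (by simpa using hx)]
    by_cases h : t + x ∈ Set.Ici (0 : ℝ)
    · rw [Set.indicator_of_mem h, Set.indicator_of_notMem (by simpa using hx.le), mul_zero]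
    · rw [Set.indicator_of_notMem h]
  · rw [Set.indicator_of_mem (s := Set.Ici (0 : ℝ)) (a := x) (by simpa using hx.le),
      Set.indicator_of_mem (s := Set.Ici (0 : ℝ)) (by simp; linarith),
      Set.indicator_of_mem (by simpa using hx), ← mul_assoc,
      ← ENNReal.ofReal_mul (Real.exp_pos _).le]
    congr 2
    rw [mul_add, neg_add, Real.exp_add]
    ring

/-- The lifetime `p.1` up to age `c`, followed by the residual lifetime `p.2`. -/
noncomputable def renewAt (c : ℝ) (p : ℝ × ℝ) : ℝ := if p.1 ≤ c then p.1 else c + p.2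

theorem measurable_renewAt : Measurable fun q : ℝ × (ℝ × ℝ) => renewAt q.1 q.2 :=
  Measurable.ite (measurableSet_le (by fun_prop) (by fun_prop)) (by fun_prop) (by fun_prop)

/-- By memorylessness, replacing the residual life at age `c` by an independent copy does not change
the exponential law. This is why servers present at time `t` can be treated as fresh initial
servers. -/
theorem measurePreserving_renewAt (hr : 0 < r) {c : ℝ} (hc : 0 ≤ c) :
    MeasurePreserving (renewAt c) ((expMeasure r).prod (expMeasure r)) (expMeasure r) := by
  have := isProbabilityMeasure_expMeasure hr
  have hm : Measurable (renewAt c) := measurable_renewAt.comp measurable_prodMk_left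
  refine ⟨hm, Measure.ext_of_lintegral _ fun F hF => ?_⟩
  rw [lintegral_map hF hm, lintegral_prod _ (by fun_prop),
    ← lintegral_add_compl (μ := expMeasure r) F (measurableSet_Ioi (a := c)),
    ← lintegral_indicator measurableSet_Ioi, lintegral_expMeasure_indicator_Ioi hr hc hF,
    ← lintegral_add_compl (μ := expMeasure r) _ (measurableSet_Ioi (a := c))]
  congr 1
  · rw [setLIntegral_congr_fun measurableSet_Ioi
      (g := fun _ => ∫⁻ x, F (c + x) ∂expMeasure r), setLIntegral_const, mul_comm]
    intro x hx
    simp only [renewAt, if_neg (not_le.2 (Set.mem_Ioi.1 hx))]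
  · refine setLIntegral_congr_fun measurableSet_Ioi.compl fun x hx => ?_
    have hx' : x ≤ c := not_lt.1 hx
    simp only [renewAt, if_pos hx', lintegral_const, measure_univ, mul_one]

end Exponential

/-! ### Marked Poisson processes -/

section Renewal

variable {M M' : Type*}

/-- The `k`-th arrival time of a marked renewal sequence. -/
def arrivalTime (e : ℕ → ℝ × M) (k : ℕ) : ℝ := ∑ i ∈ Finset.range (k + 1), (e i).1

@[simp] theorem arrivalTime_zero (e : ℕ → ℝ × M) : arrivalTime e 0 = (e 0).1 := by
  simp [arrivalTime]

theorem arrivalTime_succ (e : ℕ → ℝ × M) (k : ℕ) :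
    arrivalTime e (k + 1) = arrivalTime e k + (e (k + 1)).1 := by
  simp only [arrivalTime]; rw [Finset.sum_range_succ _ (k + 1)]

theorem arrivalTime_succ' (e : ℕ → ℝ × M) (k : ℕ) :
    arrivalTime e (k + 1) = (e 0).1 + arrivalTime (fun i => e (i + 1)) k := by
  simp only [arrivalTime]; rw [Finset.sum_range_succ' _ (k + 1), add_comm]

@[simp] theorem arrivalTime_seqCons_succ (h : ℝ × M) (y : ℕ → ℝ × M) (k : ℕ) :
    arrivalTime (seqCons h y) (k + 1) = h.1 + arrivalTime y k :=
  arrivalTime_succ' _ _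

/-- Exactly the arrivals `0, …, n - 1` happen in `[0, t]`. -/
def ArrivedBy (n : ℕ) (t : ℝ) (e : ℕ → ℝ × M) : Prop :=
  (∀ k < n, arrivalTime e k ≤ t) ∧ t < arrivalTime e n

theorem arrivedBy_zero_seqCons (t : ℝ) (h : ℝ × M) (y : ℕ → ℝ × M) :
    ArrivedBy 0 t (seqCons h y) ↔ t < h.1 := by
  simp [ArrivedBy]

theorem arrivedBy_succ_seqCons (n : ℕ) (t : ℝ) (h : ℝ × M) (y : ℕ → ℝ × M) :
    ArrivedBy (n + 1) t (seqCons h y) ↔ h.1 ≤ t ∧ ArrivedBy n (t - h.1) y := by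
  simp only [ArrivedBy, arrivalTime_seqCons_succ]
  constructor
  · rintro ⟨h1, h2⟩
    refine ⟨by simpa using h1 0 (Nat.succ_pos n), fun k hk => ?_, by linarith⟩
    have := h1 (k + 1) (by omega)
    rw [arrivalTime_seqCons_succ] at this
    linarith
  · rintro ⟨h0, h1, h2⟩
    refine ⟨fun k hk => ?_, by linarith⟩
    cases k with
    | zero => simpa using h0
    | succ k =>
      rw [arrivalTime_seqCons_succ]
      linarith [h1 k (by omega)]

theorem ArrivedBy.unique {n m : ℕ} {t : ℝ} {e : ℕ → ℝ × M} (h : ArrivedBy n t e)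
    (h' : ArrivedBy m t e) : n = m := by
  by_contra hne
  rcases lt_or_gt_of_ne hne with hlt | hlt
  · exact absurd (h'.1 n hlt) (not_le.2 h.2)
  · exact absurd (h.1 m hlt) (not_le.2 h'.2)

open Classical in
/-- The number of arrivals in `[0, t]`. -/
noncomputable def numArrivals (t : ℝ) (e : ℕ → ℝ × M) : ℕ :=
  -- The default `0` concerns only sequences whose arrival times never exceed `t`, a null event for
  -- the Poisson law.
  if h : ∃ k, t < arrivalTime e k then Nat.find h else 0

theorem arrivedBy_numArrivals {t : ℝ} {e : ℕ → ℝ × M} (h : ∃ k, t < arrivalTime e k) :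
    ArrivedBy (numArrivals t e) t e := by
  classical
  rw [numArrivals, dif_pos h]
  exact ⟨fun k hk => not_lt.1 (Nat.find_min h hk), Nat.find_spec h⟩

theorem ArrivedBy.numArrivals_eq {n : ℕ} {t : ℝ} {e : ℕ → ℝ × M} (h : ArrivedBy n t e) :
    numArrivals t e = n :=
  (arrivedBy_numArrivals ⟨n, h.2⟩).unique h

/-- The arrivals of `e` that happen in `[0, t]` if there are `n` of them, with marks modified by
`m`, followed by the arrivals of `e'` delayed by `t`. -/
def spliceAt (m : ℝ → M' → M) : ℕ → ℝ → (ℕ → ℝ × M') → (ℕ → ℝ × M) → ℕ → ℝ × M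
  -- In the recursion `t` is the time left since the last kept arrival, so the gap across the
  -- splicing time is this remainder plus the first gap of `e'`. For the same reason `m` receives,
  -- in the other case, the age of the arrival at the splicing time.
  | 0, t, _, e' => seqCons (t + (e' 0).1, (e' 0).2) fun k => e' (k + 1)
  | n + 1, t, e, e' => seqCons ((e 0).1, m (t - (e 0).1) (e 0).2)
      (spliceAt m n (t - (e 0).1) (fun k => e (k + 1)) e')

theorem spliceAt_of_lt (m : ℝ → M' → M) (n : ℕ) (t : ℝ) (e : ℕ → ℝ × M') (e' : ℕ → ℝ × M)
    {k : ℕ} (hk : k < n) :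
    spliceAt m n t e e' k = ((e k).1, m (t - arrivalTime e k) (e k).2) := by
  induction n generalizing t e k with
  | zero => omega
  | succ n ih =>
    cases k with
    | zero => simp [spliceAt]
    | succ k =>
      rw [spliceAt, seqCons_succ, ih _ _ (by omega), arrivalTime_succ', sub_sub]

theorem spliceAt_add_snd (m : ℝ → M' → M) (n : ℕ) (t : ℝ) (e : ℕ → ℝ × M') (e' : ℕ → ℝ × M)
    (k : ℕ) : (spliceAt m n t e e' (k + n)).2 = (e' k).2 := by
  induction n generalizing t e with
  | zero => cases k <;> rfl
  | succ n ih => exact ih _ _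

theorem arrivalTime_spliceAt_of_lt (m : ℝ → M' → M) (n : ℕ) (t : ℝ) (e : ℕ → ℝ × M')
    (e' : ℕ → ℝ × M) {k : ℕ} (hk : k < n) :
    arrivalTime (spliceAt m n t e e') k = arrivalTime e k := by
  refine Finset.sum_congr rfl fun i hi => ?_
  rw [spliceAt_of_lt _ _ _ _ _ (by simp at hi; omega)]

theorem arrivalTime_spliceAt_add (m : ℝ → M' → M) (n : ℕ) (t : ℝ) (e : ℕ → ℝ × M')
    (e' : ℕ → ℝ × M) (k : ℕ) :
    arrivalTime (spliceAt m n t e e') (k + n) = t + arrivalTime e' k := by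
  induction n generalizing t e with
  | zero =>
    cases k with
    | zero => simp [spliceAt]
    | succ k => rw [add_zero, spliceAt, arrivalTime_seqCons_succ, arrivalTime_succ' e']; ring
  | succ n ih =>
    rw [← add_assoc, spliceAt, arrivalTime_seqCons_succ, ih]; ring

/-- The arrivals of `e` that happen in `[0, t]`, with marks modified by `m`, followed by the
arrivals of `e'` delayed by `t`. -/
noncomputable def splice (m : ℝ → M' → M) (t : ℝ) (e : ℕ → ℝ × M') (e' : ℕ → ℝ × M) : ℕ → ℝ × M :=
  spliceAt m (numArrivals t e) t e e'

variable [MeasurableSpace M] [MeasurableSpace M']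

@[fun_prop]
theorem measurable_arrivalTime (k : ℕ) : Measurable fun e : ℕ → ℝ × M => arrivalTime e k := by
  unfold arrivalTime; fun_prop

theorem measurableSet_arrivedBy (n : ℕ) :
    MeasurableSet {p : ℝ × (ℕ → ℝ × M) | ArrivedBy n p.1 p.2} := by
  have : {p : ℝ × (ℕ → ℝ × M) | ArrivedBy n p.1 p.2} =
      (⋂ k ∈ Set.Iio n, {p | arrivalTime p.2 k ≤ p.1}) ∩ {p | p.1 < arrivalTime p.2 n} := by
    ext; simp [ArrivedBy]
  rw [this]
  refine MeasurableSet.inter (MeasurableSet.biInter (Set.to_countable _) fun k _ => ?_) ?_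
  · exact measurableSet_le (by fun_prop) (by fun_prop)
  · exact measurableSet_lt (by fun_prop) (by fun_prop)

theorem measurableSet_arrivedBy' (n : ℕ) (t : ℝ) :
    MeasurableSet {e : ℕ → ℝ × M | ArrivedBy n t e} :=
  measurable_prodMk_left (measurableSet_arrivedBy n)

theorem measurable_numArrivals (t : ℝ) :
    Measurable fun e : ℕ → ℝ × M => numArrivals t e := by
  refine measurable_to_countable' fun n => ?_
  have : (fun e : ℕ → ℝ × M => numArrivals t e) ⁻¹' {n} =
      {e | ArrivedBy n t e} ∪ (if n = 0 then {e | ∀ k, arrivalTime e k ≤ t} else ∅) := by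
    ext e
    simp only [Set.mem_preimage, Set.mem_singleton_iff, Set.mem_union, Set.mem_ofPred_eq]
    by_cases h : ∃ k, t < arrivalTime e k
    · have h1 := arrivedBy_numArrivals h
      constructor
      · rintro rfl; exact Or.inl h1
      · rintro (h2 | h2)
        · exact h1.unique h2
        · split_ifs at h2
          · obtain ⟨k, hk⟩ := h
            exact absurd (h2 k) (not_le.2 hk)
          · exact h2.elim
    · have h0 : numArrivals t e = 0 := by rw [numArrivals, dif_neg h]
      have h1 : ¬ ArrivedBy n t e := fun h' => h ⟨n, h'.2⟩
      push Not at h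
      rw [h0]
      split_ifs with hn
      · simp [hn, h]
      · simp [h1, Ne.symm hn]
  rw [this]
  refine (measurableSet_arrivedBy' n t).union ?_
  split_ifs
  · have : {e : ℕ → ℝ × M | ∀ k, arrivalTime e k ≤ t} = ⋂ k, {e | arrivalTime e k ≤ t} := by
      ext; simp
    rw [this]
    exact MeasurableSet.iInter fun k => measurableSet_le (by fun_prop) (by fun_prop)
  · exact MeasurableSet.empty

theorem measurable_spliceAt {m : ℝ → M' → M} (hm : Measurable fun q : ℝ × M' => m q.1 q.2)
    (n : ℕ) : Measurable fun q : ℝ × (ℕ → ℝ × M') × (ℕ → ℝ × M) =>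
      spliceAt m n q.1 q.2.1 q.2.2 := by
  induction n with
  | zero => simp only [spliceAt]; fun_prop
  | succ n ih =>
    simp only [spliceAt]
    refine Measurable.seqCons (Measurable.prodMk (by fun_prop) ?_) ?_
    · exact hm.comp (g := fun q : ℝ × M' => m q.1 q.2)
        (f := fun q : ℝ × (ℕ → ℝ × M') × (ℕ → ℝ × M) => (q.1 - (q.2.1 0).1, (q.2.1 0).2))
        (by fun_prop)
    · exact ih.comp (f := fun q : ℝ × (ℕ → ℝ × M') × (ℕ → ℝ × M) =>
        (q.1 - (q.2.1 0).1, (fun k => q.2.1 (k + 1)), q.2.2)) (by fun_prop)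

theorem measurable_splice {m : ℝ → M' → M} (hm : Measurable fun q : ℝ × M' => m q.1 q.2)
    (t : ℝ) : Measurable fun p : (ℕ → ℝ × M') × (ℕ → ℝ × M) => splice m t p.1 p.2 := by
  have h : Measurable fun q : ((ℕ → ℝ × M') × (ℕ → ℝ × M)) × ℕ =>
      spliceAt m q.2 t q.1.1 q.1.2 :=
    measurable_from_prod_countable_left fun n =>
      (measurable_spliceAt hm n).comp (measurable_prodMk_left (x := t))
  exact h.comp (measurable_id.prodMk ((measurable_numArrivals t).comp measurable_fst))

variable {r : ℝ} {κ : Measure M} {κ₀ : Measure M'} [IsProbabilityMeasure κ]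
  [IsProbabilityMeasure κ₀]

/-- The law of a Poisson process of rate `r` with independent marks of law `κ`, as a sequence of
interarrival times and marks. -/
noncomputable abbrev markedPoisson (r : ℝ) (κ : Measure M) : Measure (ℕ → ℝ × M) :=
  Measure.infinitePi fun _ : ℕ => (expMeasure r).prod κ

/-- Induction on the number of arrivals, conditioning on the first. With no arrival the claim is
memorylessness of the gap that covers `t`. In the inductive step the horizon shrinks to `t - h.1`,
and the first mark is transported by a map that carries `κ₀` to `κ`. -/
theorem setLIntegral_arrivedBy_spliceAt (hr : 0 < r) {m : ℝ → M' → M}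
    (hm : Measurable fun q : ℝ × M' => m q.1 q.2)
    (hpres : ∀ c, 0 ≤ c → MeasurePreserving (m c) κ₀ κ) (n : ℕ) {t : ℝ} (ht : 0 ≤ t)
    {F : (ℕ → ℝ × M) → ℝ≥0∞} (hF : Measurable F) :
    ∫⁻ e in {e | ArrivedBy n t e}, ∫⁻ e', F (spliceAt m n t e e') ∂markedPoisson r κ
        ∂markedPoisson r κ₀ =
      ∫⁻ e in {e | ArrivedBy n t e}, F e ∂markedPoisson r κ := by
  have := isProbabilityMeasure_expMeasure hr
  induction n generalizing t F with
  | zero =>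
    have hcons : Measurable fun h : ℝ × M =>
        ∫⁻ y, F (seqCons h y) ∂markedPoisson r κ :=
      (hF.comp measurable_seqCons).lintegral_prod_right'
    have hI : ∫⁻ e', F (seqCons (t + (e' 0).1, (e' 0).2) fun k => e' (k + 1)) ∂markedPoisson r κ =
        ∫⁻ x, ∫⁻ w, ∫⁻ y, F (seqCons (t + x, w) y) ∂markedPoisson r κ ∂κ ∂expMeasure r := by
      rw [lintegral_infinitePi_nat _ (by fun_prop)]
      simp only [seqCons_zero, seqCons_succ]
      rw [lintegral_prod]
      exact (hcons.comp (f := fun h : ℝ × M => (t + h.1, h.2)) (by fun_prop)).aemeasurable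
    simp only [spliceAt]
    rw [setLIntegral_const, hI, mul_comm]
    have hP : markedPoisson r κ₀ {e | ArrivedBy 0 t e} = expMeasure r (Set.Ioi t) := by
      have h1 : {e : ℕ → ℝ × M' | ArrivedBy 0 t e} =
          (Function.eval 0 : (ℕ → ℝ × M') → ℝ × M') ⁻¹' (Prod.fst ⁻¹' Set.Ioi t) := by
        ext; simp [ArrivedBy]
      rw [h1, (measurePreserving_eval_infinitePi _ 0).measure_preimage
        (measurable_fst measurableSet_Ioi).nullMeasurableSet,
        measurePreserving_fst.measure_preimage measurableSet_Ioi.nullMeasurableSet]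
    have h2 : Measurable fun x : ℝ => ∫⁻ w, ∫⁻ y, F (seqCons (x, w) y) ∂markedPoisson r κ ∂κ :=
      hcons.lintegral_prod_right'
    rw [hP, ← lintegral_expMeasure_indicator_Ioi hr ht h2,
      ← lintegral_indicator (measurableSet_arrivedBy' 0 t), lintegral_infinitePi_nat _
        (hF.indicator (measurableSet_arrivedBy' 0 t))]
    have h3 : ∀ h : ℝ × M, ∫⁻ y, {e | ArrivedBy 0 t e}.indicator F (seqCons h y)
        ∂markedPoisson r κ = (Prod.fst ⁻¹' Set.Ioi t).indicator
          (fun h => ∫⁻ y, F (seqCons h y) ∂markedPoisson r κ) h := by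
      intro h
      by_cases hh : t < h.1
      · rw [Set.indicator_of_mem (by exact hh)]
        refine lintegral_congr fun y => ?_
        rw [Set.indicator_of_mem (by exact (arrivedBy_zero_seqCons t h y).2 hh)]
      · rw [Set.indicator_of_notMem (by exact hh), ← lintegral_zero (μ := markedPoisson r κ)]
        refine lintegral_congr fun y => ?_
        rw [Set.indicator_of_notMem (by exact fun h' => hh ((arrivedBy_zero_seqCons t h y).1 h'))]
    simp_rw [h3]
    rw [lintegral_prod _ (hcons.indicator (measurable_fst measurableSet_Ioi)).aemeasurable]
    refine lintegral_congr fun x => ?_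
    by_cases hx : t < x
    · rw [Set.indicator_of_mem (by exact hx)]
      refine lintegral_congr fun w => ?_
      rw [Set.indicator_of_mem (by exact hx)]
    · rw [Set.indicator_of_notMem (by exact hx), ← lintegral_zero (μ := κ)]
      refine lintegral_congr fun w => ?_
      rw [Set.indicator_of_notMem (by exact hx)]
  | succ n ih =>
    have hsp : Measurable fun q : (ℕ → ℝ × M') × (ℕ → ℝ × M) =>
        F (spliceAt m (n + 1) t q.1 q.2) :=
      hF.comp ((measurable_spliceAt hm (n + 1)).comp (measurable_prodMk_left (x := t)))
    have hG : Measurable fun e : ℕ → ℝ × M' =>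
        ∫⁻ e', F (spliceAt m (n + 1) t e e') ∂markedPoisson r κ :=
      hsp.lintegral_prod_right'
    rw [← lintegral_indicator (measurableSet_arrivedBy' (n + 1) t),
      ← lintegral_indicator (measurableSet_arrivedBy' (n + 1) t),
      lintegral_infinitePi_nat _ (hG.indicator (measurableSet_arrivedBy' (n + 1) t)),
      lintegral_infinitePi_nat _ (hF.indicator (measurableSet_arrivedBy' (n + 1) t))]
    -- `Ψ h` is the contribution of the later arrivals given the first gap and mark; both sides are
    -- integrals of `Ψ`, up to applying `m` to the mark.
    set Ψ : ℝ × M → ℝ≥0∞ := fun h =>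
      ∫⁻ y in {y | ArrivedBy n (t - h.1) y}, F (seqCons h y) ∂markedPoisson r κ with hΨ
    have hΨm : Measurable Ψ := by
      have h1 : Measurable fun q : (ℝ × M) × (ℕ → ℝ × M) =>
          {q : (ℝ × M) × (ℕ → ℝ × M) | ArrivedBy n (t - q.1.1) q.2}.indicator
            (fun q => F (seqCons q.1 q.2)) q := by
        refine (hF.comp measurable_seqCons).indicator ?_
        exact (measurable_const.sub (measurable_fst.comp measurable_fst)).prodMk measurable_snd
          (measurableSet_arrivedBy n)
      convert! h1.lintegral_prod_right' (ν := markedPoisson r κ) using 2 with h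
      simp only [hΨ]
      rw [← lintegral_indicator (measurableSet_arrivedBy' n _)]
      rfl
    have hL : ∀ h : ℝ × M', ∫⁻ y, {e | ArrivedBy (n + 1) t e}.indicator
        (fun e => ∫⁻ e', F (spliceAt m (n + 1) t e e') ∂markedPoisson r κ) (seqCons h y)
          ∂markedPoisson r κ₀ =
        (Prod.fst ⁻¹' Set.Iic t).indicator (fun h => Ψ (h.1, m (t - h.1) h.2)) h := by
      intro h
      by_cases hh : h.1 ≤ t
      · rw [Set.indicator_of_mem (by exact hh)]
        simp only [hΨ]
        rw [← ih (sub_nonneg.2 hh)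
          (F := fun y => F (seqCons (h.1, m (t - h.1) h.2) y)) (by fun_prop),
          ← lintegral_indicator (measurableSet_arrivedBy' n _)]
        refine lintegral_congr fun y => ?_
        by_cases hy : ArrivedBy n (t - h.1) y
        · rw [Set.indicator_of_mem (by exact (arrivedBy_succ_seqCons n t h y).2 ⟨hh, hy⟩),
            Set.indicator_of_mem (by exact hy)]
          rfl
        · rw [Set.indicator_of_notMem
            (by exact fun h' => hy ((arrivedBy_succ_seqCons n t h y).1 h').2),
            Set.indicator_of_notMem (by exact hy)]
      · rw [Set.indicator_of_notMem (by exact hh), ← lintegral_zero (μ := markedPoisson r κ₀)]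
        refine lintegral_congr fun y => ?_
        rw [Set.indicator_of_notMem
          (by exact fun h' => hh ((arrivedBy_succ_seqCons n t h y).1 h').1)]
    have hR : ∀ h : ℝ × M, ∫⁻ y, {e | ArrivedBy (n + 1) t e}.indicator F (seqCons h y)
          ∂markedPoisson r κ = (Prod.fst ⁻¹' Set.Iic t).indicator Ψ h := by
      intro h
      by_cases hh : h.1 ≤ t
      · rw [Set.indicator_of_mem (by exact hh)]
        simp only [hΨ]
        rw [← lintegral_indicator (measurableSet_arrivedBy' n _)]
        refine lintegral_congr fun y => ?_
        by_cases hy : ArrivedBy n (t - h.1) y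
        · rw [Set.indicator_of_mem (by exact (arrivedBy_succ_seqCons n t h y).2 ⟨hh, hy⟩),
            Set.indicator_of_mem (by exact hy)]
        · rw [Set.indicator_of_notMem
            (by exact fun h' => hy ((arrivedBy_succ_seqCons n t h y).1 h').2),
            Set.indicator_of_notMem (by exact hy)]
      · rw [Set.indicator_of_notMem (by exact hh), ← lintegral_zero (μ := markedPoisson r κ)]
        refine lintegral_congr fun y => ?_
        rw [Set.indicator_of_notMem
          (by exact fun h' => hh ((arrivedBy_succ_seqCons n t h y).1 h').1)]
    simp_rw [hL, hR]
    have hΨ' : Measurable fun h : ℝ × M' => Ψ (h.1, m (t - h.1) h.2) :=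
      hΨm.comp (measurable_fst.prodMk (hm.comp (f := fun h : ℝ × M' => (t - h.1, h.2))
        (by fun_prop)))
    rw [lintegral_prod _ (hΨ'.indicator (measurable_fst measurableSet_Iic)).aemeasurable,
      lintegral_prod _ (hΨm.indicator (measurable_fst measurableSet_Iic)).aemeasurable]
    refine lintegral_congr fun x => ?_
    by_cases hx : x ≤ t
    · have h1 : ∀ w : M', (Prod.fst ⁻¹' Set.Iic t).indicator
          (fun h : ℝ × M' => Ψ (h.1, m (t - h.1) h.2)) (x, w) = Ψ (x, m (t - x) w) :=
        fun w => Set.indicator_of_mem (by exact hx) _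
      have h2 : ∀ w : M, (Prod.fst ⁻¹' Set.Iic t).indicator Ψ (x, w) = Ψ (x, w) :=
        fun w => Set.indicator_of_mem (by exact hx) _
      simp_rw [h1, h2]
      exact (hpres _ (sub_nonneg.2 hx)).lintegral_comp (hΨm.comp measurable_prodMk_left)
    · have h1 : ∀ w : M', (Prod.fst ⁻¹' Set.Iic t).indicator
          (fun h : ℝ × M' => Ψ (h.1, m (t - h.1) h.2)) (x, w) = 0 :=
        fun w => Set.indicator_of_notMem (by exact hx) _
      have h2 : ∀ w : M, (Prod.fst ⁻¹' Set.Iic t).indicator Ψ (x, w) = 0 :=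
        fun w => Set.indicator_of_notMem (by exact hx) _
      simp_rw [h1, h2, lintegral_zero]

/-! ### Campbell's formula and non-explosion. -/

/-- For `v ≥ 0` the density `r e^{-rv}` of the gap plus `r` times the probability that the gap is at
most `v` equals `r`. -/
theorem lintegral_Ici_eq_lintegral_expMeasure (hr : 0 < r) {φ : ℝ → ℝ≥0∞} (hφ : Measurable φ) :
    ENNReal.ofReal r * ∫⁻ v in Set.Ici 0, φ v =
      ∫⁻ x, φ x ∂expMeasure r + ∫⁻ x, (ENNReal.ofReal r * ∫⁻ v in Set.Ici x, φ v) ∂expMeasure r := by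
  have := isProbabilityMeasure_expMeasure hr
  have hset : MeasurableSet {q : ℝ × ℝ | q.1 ≤ q.2} :=
    measurableSet_le measurable_fst measurable_snd
  have hind : Measurable fun q : ℝ × ℝ =>
      {q : ℝ × ℝ | q.1 ≤ q.2}.indicator (fun q => φ q.2) q :=
    (hφ.comp measurable_snd).indicator hset
  have h1 : ∀ x : ℝ, ∫⁻ v in Set.Ici x, φ v =
      ∫⁻ v, {q : ℝ × ℝ | q.1 ≤ q.2}.indicator (fun q => φ q.2) (x, v) := by
    intro x
    rw [← lintegral_indicator measurableSet_Ici]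
    rfl
  have h2 : ∀ v : ℝ, ∫⁻ x, {q : ℝ × ℝ | q.1 ≤ q.2}.indicator (fun q => φ q.2) (x, v)
      ∂expMeasure r = (Set.Ici 0).indicator
        (fun v => ENNReal.ofReal (1 - Real.exp (-(r * v))) * φ v) v := by
    intro v
    have h3 : ∀ x : ℝ, {q : ℝ × ℝ | q.1 ≤ q.2}.indicator (fun q => φ q.2) (x, v) =
        (Set.Iic v).indicator (fun _ => φ v) x := fun x => rfl
    simp_rw [h3]
    rw [lintegral_indicator measurableSet_Iic, setLIntegral_const]
    by_cases hv : 0 ≤ v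
    · rw [Set.indicator_of_mem (by exact hv), expMeasure_Iic hr hv, mul_comm]
    · rw [Set.indicator_of_notMem (by exact hv)]
      have : expMeasure r (Set.Iic v) = 0 := by
        refine measure_mono_null (t := Set.Iic 0) ?_ (by rw [expMeasure_Iic hr le_rfl]; simp)
        exact Set.Iic_subset_Iic.2 (not_le.1 hv).le
      rw [this, mul_zero]
  simp_rw [h1]
  rw [lintegral_const_mul _ hind.lintegral_prod_right', lintegral_lintegral_swap hind.aemeasurable]
  simp_rw [h2]
  rw [lintegral_indicator measurableSet_Ici, lintegral_expMeasure r hφ, ← h1,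
    ← lintegral_const_mul _ hφ, ← lintegral_const_mul _ (by fun_prop),
    ← lintegral_add_left (by fun_prop)]
  refine setLIntegral_congr_fun measurableSet_Ici fun v hv => ?_
  have hv0 : 0 ≤ v := hv
  have hle : Real.exp (-(r * v)) ≤ 1 := by rw [Real.exp_le_one_iff]; nlinarith
  rw [← mul_assoc, ← add_mul, ← ENNReal.ofReal_mul hr.le, ← ENNReal.ofReal_add (by positivity)
    (mul_nonneg hr.le (sub_nonneg.2 hle))]
  congr 2
  ring

/-- A stopped compensator identity: the mean over the first `n` arrivals, plus the mean intensity
integral left after them, does not depend on `n`. The induction uses the one-gap identity above; the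
offset `s` is general because the remaining arrivals are shifted by the first gap. -/
theorem lintegral_sum_marks_add (hr : 0 < r) {g : ℝ × M → ℝ≥0∞} (hg : Measurable g) (n : ℕ)
    (s : ℝ) :
    ∫⁻ e, ∑ k ∈ Finset.range n, g (s + arrivalTime e k, (e k).2) ∂markedPoisson r κ +
      ∫⁻ e, (ENNReal.ofReal r * ∫⁻ v in Set.Ici (∑ k ∈ Finset.range n, (e k).1),
        ∫⁻ w, g (s + v, w) ∂κ) ∂markedPoisson r κ =
    ENNReal.ofReal r * ∫⁻ v in Set.Ici 0, ∫⁻ w, g (s + v, w) ∂κ := by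
  have := isProbabilityMeasure_expMeasure hr
  have hgm : Measurable fun v => ∫⁻ w, g (v, w) ∂κ := hg.lintegral_prod_right'
  have htail : ∀ s : ℝ, Measurable fun x : ℝ => ∫⁻ v in Set.Ici x, ∫⁻ w, g (s + v, w) ∂κ := by
    intro s
    have : Antitone fun x : ℝ => ∫⁻ v in Set.Ici x, ∫⁻ w, g (s + v, w) ∂κ := fun x y hxy =>
      lintegral_mono_set (Set.Ici_subset_Ici.2 hxy)
    exact this.measurable
  have hshift : ∀ s x y : ℝ, ∫⁻ v in Set.Ici (x + y), ∫⁻ w, g (s + v, w) ∂κ =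
      ∫⁻ v in Set.Ici y, ∫⁻ w, g (s + x + v, w) ∂κ := by
    intro s x y
    rw [← lintegral_indicator measurableSet_Ici, ← lintegral_indicator measurableSet_Ici,
      ← lintegral_add_left_eq_self _ x]
    refine lintegral_congr fun v => ?_
    by_cases hv : y ≤ v
    · rw [Set.indicator_of_mem (by simpa using hv), Set.indicator_of_mem (by exact hv), add_assoc]
    · rw [Set.indicator_of_notMem (by simpa using hv), Set.indicator_of_notMem (by exact hv)]
  induction n generalizing s with
  | zero => simp
  | succ n ih =>
    have h0 : Measurable fun e : ℕ → ℝ × M => ENNReal.ofReal r * ∫⁻ v in Set.Ici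
        (∑ k ∈ Finset.range (n + 1), (e k).1), ∫⁻ w, g (s + v, w) ∂κ :=
      ((htail s).comp (by fun_prop : Measurable fun e : ℕ → ℝ × M =>
        ∑ k ∈ Finset.range (n + 1), (e k).1)).const_mul _
    rw [lintegral_infinitePi_nat _ (by fun_prop), lintegral_infinitePi_nat _ h0]
    have h1 : ∀ h : ℝ × M, ∫⁻ y, ∑ k ∈ Finset.range (n + 1),
        g (s + arrivalTime (seqCons h y) k, (seqCons h y k).2) ∂markedPoisson r κ =
        ∫⁻ y, ∑ k ∈ Finset.range n, g (s + h.1 + arrivalTime y k, (y k).2) ∂markedPoisson r κ +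
        g (s + h.1, h.2) := by
      intro h
      simp_rw [Finset.sum_range_succ' _ n]
      rw [lintegral_add_right _ (by simp)]
      simp [add_assoc]
    have h2 : ∀ h : ℝ × M, ∫⁻ y, (ENNReal.ofReal r * ∫⁻ v in Set.Ici
        (∑ k ∈ Finset.range (n + 1), (seqCons h y k).1), ∫⁻ w, g (s + v, w) ∂κ)
          ∂markedPoisson r κ =
        ∫⁻ y, (ENNReal.ofReal r * ∫⁻ v in Set.Ici (∑ k ∈ Finset.range n, (y k).1),
          ∫⁻ w, g (s + h.1 + v, w) ∂κ) ∂markedPoisson r κ := by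
      intro h
      refine lintegral_congr fun y => ?_
      rw [Finset.sum_range_succ' _ n, add_comm, seqCons_zero, hshift]
      rfl
    simp_rw [h1, h2]
    have hm1 : Measurable fun h : ℝ × M => g (s + h.1, h.2) := by fun_prop
    rw [lintegral_add_right _ hm1, add_right_comm, ← lintegral_add_left]
    swap
    · exact Measurable.lintegral_prod_right' (f := fun q : (ℝ × M) × (ℕ → ℝ × M) =>
        ∑ k ∈ Finset.range n, g (s + q.1.1 + arrivalTime q.2 k, (q.2 k).2)) (by fun_prop)
    simp_rw [ih]
    rw [lintegral_Ici_eq_lintegral_expMeasure hr (by fun_prop :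
        Measurable fun v => ∫⁻ w, g (s + v, w) ∂κ), lintegral_prod _ hm1.aemeasurable, add_comm,
      lintegral_prod]
    · congr 1
      refine lintegral_congr fun x => ?_
      have := hshift s x 0
      rw [add_zero] at this
      rw [this]
      simp only [lintegral_const, measure_univ, mul_one]
    · have : ∀ h : ℝ × M, ∫⁻ v in Set.Ici 0, ∫⁻ w, g (s + h.1 + v, w) ∂κ =
        ∫⁻ v in Set.Ici h.1, ∫⁻ w, g (s + v, w) ∂κ := fun h => by
        rw [← hshift s h.1 0, add_zero]
      simp_rw [this]
      exact (((htail s).comp measurable_fst).const_mul _).aemeasurable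

theorem lintegral_tsum_marks_le (hr : 0 < r) {g : ℝ × M → ℝ≥0∞} (hg : Measurable g) :
    ∫⁻ e, ∑' k, g (arrivalTime e k, (e k).2) ∂markedPoisson r κ ≤
      ENNReal.ofReal r * ∫⁻ v in Set.Ici 0, ∫⁻ w, g (v, w) ∂κ := by
  rw [lintegral_tsum fun k => by fun_prop]
  refine ENNReal.tsum_le_of_sum_range_le fun n => ?_
  rw [← lintegral_finsetSum _ fun k _ => by fun_prop]
  have := lintegral_sum_marks_add (κ := κ) hr hg n 0
  simp only [zero_add] at this
  rw [← this]
  exact le_self_add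

/-- The mean number of arrivals in `[0, c]` is finite, so almost surely they cannot all lie there.
-/
theorem ae_forall_exists_lt_arrivalTime (hr : 0 < r) :
    ∀ᵐ e ∂markedPoisson r κ, ∀ t, ∃ k, t < arrivalTime e k := by
  have h1 : ∀ c : ℕ, ∀ᵐ e ∂markedPoisson r κ, ∃ k, (c : ℝ) < arrivalTime e k := by
    intro c
    have hg : Measurable fun p : ℝ × M => (Prod.fst ⁻¹' Set.Iic (c : ℝ)).indicator
        (1 : ℝ × M → ℝ≥0∞) p := measurable_one.indicator (measurable_fst measurableSet_Iic)
    have h2 := lintegral_tsum_marks_le (κ := κ) hr hg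
    have h3 : ENNReal.ofReal r * ∫⁻ v in Set.Ici 0, ∫⁻ w,
        (Prod.fst ⁻¹' Set.Iic (c : ℝ)).indicator (1 : ℝ × M → ℝ≥0∞) (v, w) ∂κ < ∞ := by
      refine ENNReal.mul_lt_top ENNReal.ofReal_lt_top ?_
      have h4 : ∀ v : ℝ, ∫⁻ w, (Prod.fst ⁻¹' Set.Iic (c : ℝ)).indicator
          (1 : ℝ × M → ℝ≥0∞) (v, w) ∂κ = (Set.Iic (c : ℝ)).indicator 1 v := by
        intro v
        have : ∀ w : M, (Prod.fst ⁻¹' Set.Iic (c : ℝ)).indicator (1 : ℝ × M → ℝ≥0∞) (v, w) =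
          (Set.Iic (c : ℝ)).indicator 1 v := fun w => rfl
        simp_rw [this]
        rw [lintegral_const, measure_univ, mul_one]
      simp_rw [h4]
      rw [lintegral_indicator_one measurableSet_Iic, Measure.restrict_apply measurableSet_Iic,
        Set.Iic_inter_Ici, Real.volume_Icc]
      exact ENNReal.ofReal_lt_top
    have h5 := ae_lt_top (Measurable.tsum fun k => by fun_prop) (h2.trans_lt h3).ne
    filter_upwards [h5] with e he
    by_contra! hcon
    have : ∀ k, (Prod.fst ⁻¹' Set.Iic (c : ℝ)).indicator (1 : ℝ × M → ℝ≥0∞)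
        (arrivalTime e k, (e k).2) = 1 := fun k => Set.indicator_of_mem (by exact hcon k) _
    simp_rw [this] at he
    simp at he
  rw [← ae_all_iff] at h1
  filter_upwards [h1] with e he t
  obtain ⟨c, hc⟩ := exists_nat_gt t
  obtain ⟨k, hk⟩ := he c
  exact ⟨k, hc.trans hk⟩

theorem ae_forall_interarrival_pos (hr : 0 < r) :
    ∀ᵐ e ∂markedPoisson r κ, ∀ k, 0 < (e k).1 := by
  have := isProbabilityMeasure_expMeasure hr
  rw [ae_all_iff]
  intro k
  have h1 : ∀ᵐ p ∂((expMeasure r).prod κ), 0 < p.1 :=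
    measurePreserving_fst.quasiMeasurePreserving.ae (ae_pos_expMeasure hr)
  exact (measurePreserving_eval_infinitePi (fun _ : ℕ => (expMeasure r).prod κ)
    k).quasiMeasurePreserving.ae h1

theorem strictMono_arrivalTime {M : Type*} {e : ℕ → ℝ × M} (h : ∀ k, 0 < (e k).1) :
    StrictMono (arrivalTime e) :=
  strictMono_nat_of_lt_succ fun k => by rw [arrivalTime_succ]; linarith [h (k + 1)]

theorem arrivalTime_pos {M : Type*} {e : ℕ → ℝ × M} (h : ∀ k, 0 < (e k).1) (k : ℕ) :
    0 < arrivalTime e k :=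
  Finset.sum_pos (fun i _ => h i) (by simp)

/-- Campbell's formula for a marked Poisson process on a bounded time interval. -/
theorem lintegral_tsum_marks (hr : 0 < r) {g : ℝ × M → ℝ≥0∞} (hg : Measurable g) {c : ℝ}
    (hc : ∀ v w, c < v → g (v, w) = 0)
    (hfin : ∫⁻ v in Set.Ici 0, ∫⁻ w, g (v, w) ∂κ ≠ ∞) :
    ∫⁻ e, ∑' k, g (arrivalTime e k, (e k).2) ∂markedPoisson r κ =
      ENNReal.ofReal r * ∫⁻ v in Set.Ici 0, ∫⁻ w, g (v, w) ∂κ := by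
  have hanti : Antitone fun x : ℝ => ∫⁻ v in Set.Ici x, ∫⁻ w, g (v, w) ∂κ := fun x y hxy =>
    lintegral_mono_set (Set.Ici_subset_Ici.2 hxy)
  have h1 : Filter.Tendsto (fun n => ∫⁻ e, ∑ k ∈ Finset.range n, g (arrivalTime e k, (e k).2)
      ∂markedPoisson r κ) Filter.atTop
      (nhds (∫⁻ e, ∑' k, g (arrivalTime e k, (e k).2) ∂markedPoisson r κ)) := by
    rw [lintegral_tsum fun k => by fun_prop]
    simp_rw [lintegral_finsetSum (Finset.range _) fun k _ =>
      (by fun_prop : Measurable fun e : ℕ → ℝ × M => g (arrivalTime e k, (e k).2))]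
    exact ENNReal.tendsto_nat_tsum _
  -- The remainder vanishes as soon as the sum of the first `n` gaps exceeds `c`; `hfin` makes the
  -- full intensity integral a dominating constant.
  have h2 : Filter.Tendsto (fun n => ∫⁻ e, (ENNReal.ofReal r * ∫⁻ v in Set.Ici
      (∑ k ∈ Finset.range n, (e k).1), ∫⁻ w, g (v, w) ∂κ) ∂markedPoisson r κ) Filter.atTop
      (nhds (∫⁻ _, 0 ∂markedPoisson r κ)) := by
    refine tendsto_lintegral_of_dominated_convergence
      (fun _ => ENNReal.ofReal r * ∫⁻ v in Set.Ici 0, ∫⁻ w, g (v, w) ∂κ) ?_ ?_ ?_ ?_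
    · intro n
      exact (hanti.measurable.comp (by fun_prop : Measurable fun e : ℕ → ℝ × M =>
        ∑ k ∈ Finset.range n, (e k).1)).const_mul _
    · intro n
      filter_upwards [ae_forall_interarrival_pos hr] with e he
      gcongr
      exact Finset.sum_nonneg fun k _ => (he k).le
    · rw [lintegral_const]
      have := isProbabilityMeasure_expMeasure hr
      rw [measure_univ, mul_one]
      exact ENNReal.mul_ne_top ENNReal.ofReal_ne_top hfin
    · filter_upwards [ae_forall_interarrival_pos hr, ae_forall_exists_lt_arrivalTime hr]
        with e he hT
      obtain ⟨k, hk⟩ := hT c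
      refine tendsto_const_nhds.congr' ?_
      filter_upwards [Filter.eventually_ge_atTop (k + 1)] with n hn
      obtain ⟨m, rfl⟩ : ∃ m, n = m + 1 := ⟨n - 1, by omega⟩
      have h3 : c < ∑ k ∈ Finset.range (m + 1), (e k).1 :=
        hk.trans_le ((strictMono_arrivalTime he).monotone (by omega : k ≤ m))
      rw [setLIntegral_congr_fun measurableSet_Ici (g := fun _ => 0)]
      · simp
      · intro v hv
        simp only [hc v _ (h3.trans_le hv), lintegral_zero]
  have h3 := h1.add h2
  have h4 := fun n => lintegral_sum_marks_add (κ := κ) hr hg n 0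
  simp only [zero_add] at h4
  simp_rw [h4] at h3
  rw [lintegral_zero, add_zero] at h3
  exact tendsto_nhds_unique h3 tendsto_const_nhds |>.symm ▸ rfl

theorem lintegral_eq_tsum_arrivedBy (hr : 0 < r) (t : ℝ) (F : (ℕ → ℝ × M) → ℝ≥0∞) :
    ∫⁻ e, F e ∂markedPoisson r κ =
      ∑' n, ∫⁻ e in {e | ArrivedBy n t e}, F e ∂markedPoisson r κ := by
  rw [← lintegral_iUnion (fun n => measurableSet_arrivedBy' n t)
    (fun i j hij => Set.disjoint_left.2 fun e h h' => hij (ArrivedBy.unique h h')),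
    setLIntegral_congr (t := Set.univ), Measure.restrict_univ]
  rw [Filter.eventuallyEq_univ]
  filter_upwards [ae_forall_exists_lt_arrivalTime hr] with e he
  exact Set.mem_iUnion.2 ⟨_, arrivedBy_numArrivals (he t)⟩

/-- The Markov property of a marked Poisson process in coupling form. It follows by summing
`setLIntegral_arrivedBy_spliceAt` over the number of arrivals up to `t`. -/
theorem measurePreserving_splice (hr : 0 < r) {m : ℝ → M' → M}
    (hm : Measurable fun q : ℝ × M' => m q.1 q.2)
    (hpres : ∀ c, 0 ≤ c → MeasurePreserving (m c) κ₀ κ) {t : ℝ} (ht : 0 ≤ t) :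
    MeasurePreserving (fun p : (ℕ → ℝ × M') × (ℕ → ℝ × M) => splice m t p.1 p.2)
      ((markedPoisson r κ₀).prod (markedPoisson r κ)) (markedPoisson r κ) := by
  have := isProbabilityMeasure_expMeasure hr
  have hs := measurable_splice hm t
  refine ⟨hs, Measure.ext_of_lintegral _ fun F hF => ?_⟩
  have hFs : Measurable fun p : (ℕ → ℝ × M') × (ℕ → ℝ × M) => F (splice m t p.1 p.2) := hF.comp hs
  rw [lintegral_map hF hs, lintegral_prod _ hFs.aemeasurable,
    lintegral_eq_tsum_arrivedBy hr t, lintegral_eq_tsum_arrivedBy hr t]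
  refine tsum_congr fun n => ?_
  rw [← setLIntegral_arrivedBy_spliceAt hr hm hpres n ht hF]
  refine setLIntegral_congr_fun (measurableSet_arrivedBy' n t) fun e he => ?_
  simp only [splice, ArrivedBy.numArrivals_eq he]

end Renewal

/-! ### Counting and reflection -/

theorem measurable_ncard_mem {α : Type*} [MeasurableSpace α] {A : ℕ → Set α}
    (hA : ∀ j, MeasurableSet (A j)) : Measurable fun a => {j | a ∈ A j}.ncard :=
  measurable_ncard.comp (measurable_set_iff.2 fun j => measurableSet_setOfPred.1 (hA j))

/-- Skorokhod's reflection has the flow property. -/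
theorem sSup_reflection_add {N : ℝ → ℝ} {t s b : ℝ} (ht : 0 ≤ t) (hs : 0 ≤ s)
    (hb : ∀ u ∈ Set.Icc 0 (t + s), -N u ≤ b) :
    sSup ((fun u => max 0 (-N u)) '' Set.Icc 0 (t + s)) =
      sSup ((fun u => max 0 (-N u)) '' Set.Icc 0 t) +
        sSup ((fun u => max 0 (-(sSup ((fun u => max 0 (-N u)) '' Set.Icc 0 t) + N (t + u)))) ''
          Set.Icc 0 s) := by
  set R := sSup ((fun u => max 0 (-N u)) '' Set.Icc 0 t) with hR
  have hbt : BddAbove ((fun u => max 0 (-N u)) '' Set.Icc 0 t) := by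
    refine ⟨max 0 b, ?_⟩
    rintro _ ⟨u, hu, rfl⟩
    exact max_le_max le_rfl (hb u ⟨hu.1, by linarith [hu.2]⟩)
  have hbts : BddAbove ((fun u => max 0 (-N u)) '' Set.Icc 0 (t + s)) := by
    refine ⟨max 0 b, ?_⟩
    rintro _ ⟨u, hu, rfl⟩
    exact max_le_max le_rfl (hb u hu)
  have hR0 : 0 ≤ R := (le_max_left 0 (-N 0)).trans (le_csSup hbt ⟨0, ⟨le_rfl, ht⟩, rfl⟩)
  have hbs : BddAbove ((fun u => max 0 (-(R + N (t + u)))) '' Set.Icc 0 s) := by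
    refine ⟨max 0 b, ?_⟩
    rintro _ ⟨u, hu, rfl⟩
    refine max_le_max le_rfl ?_
    have := hb (t + u) ⟨by linarith [hu.1], by linarith [hu.2]⟩
    linarith
  have hS0 : 0 ≤ sSup ((fun u => max 0 (-(R + N (t + u)))) '' Set.Icc 0 s) :=
    (le_max_left 0 _).trans (le_csSup hbs ⟨0, ⟨le_rfl, hs⟩, rfl⟩)
  apply le_antisymm
  · refine csSup_le ⟨_, ⟨0, ⟨le_rfl, by linarith⟩, rfl⟩⟩ ?_
    rintro _ ⟨v, hv, rfl⟩
    -- Before `t` the supremum is already counted in `R`; after `t` one writes `-N v = R + (-(R + N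
    -- v))`.
    rcases le_total v t with hvt | hvt
    · have : max 0 (-N v) ≤ R := le_csSup hbt ⟨v, ⟨hv.1, hvt⟩, rfl⟩
      simp only
      linarith
    · have h1 : max 0 (-(R + N (t + (v - t)))) ≤ _ :=
        le_csSup hbs ⟨v - t, ⟨by linarith, by linarith [hv.2]⟩, rfl⟩
      have h2 : t + (v - t) = v := by ring
      rw [h2] at h1
      have h3 := le_max_right 0 (-(R + N v))
      refine max_le (by linarith) (by linarith)
  · rw [← le_sub_iff_add_le']
    refine csSup_le ⟨_, ⟨0, ⟨le_rfl, hs⟩, rfl⟩⟩ ?_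
    rintro _ ⟨u, hu, rfl⟩
    have h1 : R ≤ sSup ((fun u => max 0 (-N u)) '' Set.Icc 0 (t + s)) :=
      csSup_le_csSup hbts ⟨_, ⟨0, ⟨le_rfl, ht⟩, rfl⟩⟩
        (Set.image_mono (Set.Icc_subset_Icc le_rfl (by linarith)))
    have h2 : max 0 (-N (t + u)) ≤ sSup ((fun u => max 0 (-N u)) '' Set.Icc 0 (t + s)) :=
      le_csSup hbts ⟨t + u, ⟨by linarith [hu.1], by linarith [hu.2]⟩, rfl⟩
    have h3 := (le_max_right 0 (-N (t + u))).trans h2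
    exact max_le (by linarith) (by linarith)

namespace MGMM

/-- The outcomes for which interarrival times and lifetimes are positive, workloads are
nonnegative, and finitely many arrivals happen in bounded time. -/
structure Good (ω : Outcome) : Prop where
  job_pos : ∀ k, 0 < (ω.1 k).1
  work_nonneg : ∀ k, 0 ≤ (ω.1 k).2
  job_unbounded : ∀ t, ∃ k, t < arrivalTime ω.1 k
  server_pos : ∀ k, 0 < (ω.2.1 k).1
  server_unbounded : ∀ t, ∃ k, t < arrivalTime ω.2.1 k
  life_pos : ∀ k, 0 < (ω.2.1 k).2
  init_pos : ∀ k, 0 < ω.2.2 k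

theorem ae_good (q : MGMM) : ∀ᵐ ω ∂q.law, Good ω := by
  have := q.workload_prob
  have hC := isProbabilityMeasure_expMeasure q.lamC_pos
  have hS := isProbabilityMeasure_expMeasure q.lamS_pos
  have hM := isProbabilityMeasure_expMeasure q.muS_pos
  have h1 : ∀ᵐ e ∂markedPoisson q.lamC q.workload, (∀ k, 0 < (e k).1) ∧ (∀ k, 0 ≤ (e k).2) ∧
      ∀ t, ∃ k, t < arrivalTime e k := by
    refine (ae_forall_interarrival_pos q.lamC_pos).and (.and ?_
      (ae_forall_exists_lt_arrivalTime q.lamC_pos))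
    refine ae_all_iff.2 fun k => ?_
    have : ∀ᵐ p ∂((expMeasure q.lamC).prod q.workload), 0 ≤ p.2 :=
      measurePreserving_snd.quasiMeasurePreserving.ae q.workload_nonneg
    exact (measurePreserving_eval_infinitePi (fun _ : ℕ => (expMeasure q.lamC).prod q.workload)
      k).quasiMeasurePreserving.ae this
  have h2 : ∀ᵐ e ∂markedPoisson q.lamS (expMeasure q.muS), (∀ k, 0 < (e k).1) ∧
      (∀ k, 0 < (e k).2) ∧ ∀ t, ∃ k, t < arrivalTime e k := by
    refine (ae_forall_interarrival_pos q.lamS_pos).and (.and ?_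
      (ae_forall_exists_lt_arrivalTime q.lamS_pos))
    refine ae_all_iff.2 fun k => ?_
    have : ∀ᵐ p ∂((expMeasure q.lamS).prod (expMeasure q.muS)), 0 < p.2 :=
      measurePreserving_snd.quasiMeasurePreserving.ae (ae_pos_expMeasure q.muS_pos)
    exact (measurePreserving_eval_infinitePi
      (fun _ : ℕ => (expMeasure q.lamS).prod (expMeasure q.muS)) k).quasiMeasurePreserving.ae this
  have h3 : ∀ᵐ e ∂(Measure.infinitePi fun _ : ℕ => expMeasure q.muS), ∀ k, 0 < e k :=
    ae_all_iff.2 fun k => (measurePreserving_eval_infinitePi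
      (fun _ : ℕ => expMeasure q.muS) k).quasiMeasurePreserving.ae (ae_pos_expMeasure q.muS_pos)
  have h1' : ∀ᵐ ω ∂q.law, _ := measurePreserving_fst.quasiMeasurePreserving.ae h1
  have h2' : ∀ᵐ ω ∂q.law, _ := measurePreserving_snd.quasiMeasurePreserving.ae
    (measurePreserving_fst.quasiMeasurePreserving.ae h2)
  have h3' : ∀ᵐ ω ∂q.law, _ := measurePreserving_snd.quasiMeasurePreserving.ae
    (measurePreserving_snd.quasiMeasurePreserving.ae h3)
  filter_upwards [h1', h2', h3'] with ω a b c
  exact ⟨a.1, a.2.1, a.2.2, b.1, b.2.2, b.2.1, c⟩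

/-- The number of servers present at time `t` that were not present at time `0`. -/
noncomputable def newServers (t : ℝ) (e : ℕ → ℝ × ℝ) : ℕ :=
  {j : ℕ | arrivalTime e j ≤ t ∧ t < arrivalTime e j + (e j).2}.ncard

/-- The number of the first `n` initial servers that are present at time `t`. -/
noncomputable def oldServers (n : ℕ) (t : ℝ) (r : ℕ → ℝ) : ℕ := {i : ℕ | i < n ∧ t < r i}.ncard

theorem numServers_eq (n : ℕ) (t : ℝ) (ω : Outcome) :
    numServers n t ω = oldServers n t ω.2.2 + newServers t ω.2.1 := rfl

theorem oldServers_eq (n : ℕ) (t : ℝ) (r : ℕ → ℝ) :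
    oldServers n t r = ((Finset.range n).filter fun i => t < r i).card := by
  rw [oldServers, ← Set.ncard_coe_finset]
  congr 1
  ext; simp

/-- Since arrival times increase, only the arrivals up to `u ≥ t` can count. This replaces `ncard`
of a set of naturals by the cardinality of an explicit finite set. -/
theorem newServers_eq {t u : ℝ} {e : ℕ → ℝ × ℝ} (he : ∀ k, 0 < (e k).1) {m : ℕ}
    (hm : ArrivedBy m u e) (htu : t ≤ u) :
    newServers t e = ((Finset.range m).filter fun j =>
      arrivalTime e j ≤ t ∧ t < arrivalTime e j + (e j).2).card := by
  rw [newServers, ← Set.ncard_coe_finset]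
  congr 1
  ext j
  simp only [Set.mem_ofPred_eq, Finset.coe_filter, Finset.mem_range]
  refine ⟨fun h => ⟨?_, h⟩, fun h => h.2⟩
  by_contra hj
  have := (strictMono_arrivalTime he).monotone (not_lt.1 hj)
  linarith [hm.2, h.1]

theorem measurable_newServers : Measurable fun p : ℝ × (ℕ → ℝ × ℝ) => newServers p.1 p.2 := by
  refine measurable_ncard_mem (A := fun j => {p : ℝ × (ℕ → ℝ × ℝ) | arrivalTime p.2 j ≤ p.1 ∧
    p.1 < arrivalTime p.2 j + (p.2 j).2}) fun j => ?_
  have h1 : MeasurableSet {p : ℝ × (ℕ → ℝ × ℝ) | arrivalTime p.2 j ≤ p.1} :=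
    measurableSet_le (by fun_prop) (by fun_prop)
  have h2 : MeasurableSet {p : ℝ × (ℕ → ℝ × ℝ) | p.1 < arrivalTime p.2 j + (p.2 j).2} :=
    measurableSet_lt (by fun_prop) (by fun_prop)
  exact h1.inter h2

theorem measurable_oldServers (n : ℕ) :
    Measurable fun p : ℝ × (ℕ → ℝ) => oldServers n p.1 p.2 := by
  refine measurable_ncard_mem (A := fun j => {p : ℝ × (ℕ → ℝ) | j < n ∧ p.1 < p.2 j}) fun j => ?_
  by_cases hj : j < n
  · simp only [hj, true_and]
    exact measurableSet_lt (by fun_prop) (by fun_prop)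
  · simp [hj]

theorem measurable_numServers :
    Measurable fun p : (ℝ × Outcome) × ℕ => numServers p.2 p.1.1 p.1.2 := by
  refine measurable_from_prod_countable_left fun n => ?_
  exact ((measurable_oldServers n).comp (f := fun p : ℝ × Outcome => (p.1, p.2.2.2))
    (by fun_prop)).add (measurable_newServers.comp (f := fun p : ℝ × Outcome => (p.1, p.2.2.1))
    (by fun_prop))

theorem newServers_le {t u : ℝ} {e : ℕ → ℝ × ℝ} (he : ∀ k, 0 < (e k).1) {m : ℕ}
    (hm : ArrivedBy m u e) (htu : t ≤ u) : newServers t e ≤ m := by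
  rw [newServers_eq he hm htu]
  exact (Finset.card_filter_le _ _).trans (by simp)

theorem oldServers_le (n : ℕ) (t : ℝ) (r : ℕ → ℝ) : oldServers n t r ≤ n := by
  rw [oldServers_eq]
  exact (Finset.card_filter_le _ _).trans (by simp)

theorem intervalIntegrable_of_nat_le {f : ℝ → ℕ} (hf : Measurable f) {b : ℝ}
    (h : ∃ m : ℕ, ∀ t ≤ b, f t ≤ m) {a : ℝ} (hab : a ≤ b) :
    IntervalIntegrable (fun t => (f t : ℝ)) volume a b := by
  obtain ⟨m, hm⟩ := h
  refine (intervalIntegrable_iff_integrableOn_Ioc_of_le hab).2 ?_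
  refine Measure.integrableOn_of_bounded (M := m) (by simp) ?_ ?_
  · exact (measurable_from_top.comp hf).aestronglyMeasurable
  · filter_upwards [ae_restrict_mem measurableSet_Ioc] with t ht
    simpa using hm t ht.2

variable {ω : Outcome}

theorem Good.exists_newServers_le (hω : Good ω) (b : ℝ) :
    ∃ m : ℕ, ∀ t ≤ b, newServers t ω.2.1 ≤ m :=
  ⟨_, fun _ ht => newServers_le hω.server_pos (arrivedBy_numArrivals (hω.server_unbounded b)) ht⟩

theorem Good.intervalIntegrable_newServers (hω : Good ω) {a b : ℝ} (hab : a ≤ b) :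
    IntervalIntegrable (fun t => (newServers t ω.2.1 : ℝ)) volume a b :=
  intervalIntegrable_of_nat_le (measurable_newServers.comp measurable_prodMk_right)
    (hω.exists_newServers_le b) hab

theorem Good.intervalIntegrable_numServers (hω : Good ω) (n : ℕ) {a b : ℝ} (hab : a ≤ b) :
    IntervalIntegrable (fun t => (numServers n t ω : ℝ)) volume a b := by
  obtain ⟨m, hm⟩ := hω.exists_newServers_le b
  refine intervalIntegrable_of_nat_le (measurable_numServers.comp
    (f := fun t => ((t, ω), n)) (by fun_prop)) ⟨n + m, fun t ht => ?_⟩ hab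
  exact add_le_add (oldServers_le n t _) (hm t ht)

theorem Good.integral_numServers_mono (hω : Good ω) (n : ℕ) {s t : ℝ} (hs : 0 ≤ s) (hst : s ≤ t) :
    ∫ u in (0 : ℝ)..s, (numServers n u ω : ℝ) ≤ ∫ u in (0 : ℝ)..t, (numServers n u ω : ℝ) := by
  refine intervalIntegral.integral_mono_interval le_rfl hs hst ?_
    (hω.intervalIntegrable_numServers n (hs.trans hst))
  exact Filter.Eventually.of_forall fun u => Nat.cast_nonneg _

theorem arrivedWork_eq {N : ℕ} {t : ℝ} (hω : ∀ k, 0 < (ω.1 k).1) (hN : ArrivedBy N t ω.1) :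
    arrivedWork t ω = ∑ i ∈ Finset.range N, (ω.1 i).2 := by
  unfold arrivedWork
  rw [tsum_eq_sum (s := Finset.range N)]
  · refine Finset.sum_congr rfl fun i hi => if_pos (hN.1 i (Finset.mem_range.1 hi))
  · intro i hi
    refine if_neg (not_le.2 (hN.2.trans_le ?_))
    exact (strictMono_arrivalTime hω).monotone (by simpa using hi)

theorem arrivedWork_nonneg (hω : Good ω) (t : ℝ) : 0 ≤ arrivedWork t ω :=
  tsum_nonneg fun i => by
    split_ifs
    exacts [hω.work_nonneg i, le_rfl]

theorem Good.neg_netInput_le (hω : Good ω) (x : ℝ≥0) (n : ℕ) {s t : ℝ} (hs : 0 ≤ s)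
    (hst : s ≤ t) : -netInput x n s ω ≤ (∫ u in (0 : ℝ)..t, (numServers n u ω : ℝ)) - x := by
  have h1 := hω.integral_numServers_mono n hs hst
  have h2 := arrivedWork_nonneg hω s
  unfold netInput
  linarith

theorem Good.bddAbove_neg_netInput (hω : Good ω) (x : ℝ≥0) (n : ℕ) (t : ℝ) :
    BddAbove ((fun s => max 0 (-netInput x n s ω)) '' Set.Icc 0 t) := by
  refine ⟨max 0 ((∫ u in (0 : ℝ)..t, (numServers n u ω : ℝ)) - x), ?_⟩
  rintro _ ⟨s, hs, rfl⟩
  exact max_le_max le_rfl (hω.neg_netInput_le x n hs.1 hs.2)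

theorem Good.coe_work (hω : Good ω) (x : ℝ≥0) (n : ℕ) {t : ℝ} (ht : 0 ≤ t) :
    (work x n t ω : ℝ) = netInput x n t ω +
      sSup ((fun s => max 0 (-netInput x n s ω)) '' Set.Icc 0 t) := by
  refine Real.coe_toNNReal _ ?_
  have : max 0 (-netInput x n t ω) ≤ _ :=
    le_csSup (hω.bddAbove_neg_netInput x n t) ⟨t, ⟨ht, le_rfl⟩, rfl⟩
  linarith [le_max_right 0 (-netInput x n t ω)]

/-- The workload is at most the arrived work plus the part of the initial work that the servers
arrived after time `0` cannot clear. -/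
theorem Good.work_le (hω : Good ω) (x : ℝ≥0) (n : ℕ) {t : ℝ} (ht : 0 ≤ t) :
    (work x n t ω : ℝ) ≤
      arrivedWork t ω + max 0 (x - ∫ u in (0 : ℝ)..t, (newServers u ω.2.1 : ℝ)) := by
  rw [hω.coe_work x n ht]
  set S := ∫ u in (0 : ℝ)..t, (numServers n u ω : ℝ) with hS
  -- Ignoring arrivals can only increase the idle capacity, which is therefore at most `(S - x)⁺`;
  -- subtracting `S` and adding `x` leaves `(x - S)⁺`.
  have h1 : sSup ((fun s => max 0 (-netInput x n s ω)) '' Set.Icc 0 t) ≤ max 0 (S - x) := by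
    refine csSup_le ⟨_, ⟨0, ⟨le_rfl, ht⟩, rfl⟩⟩ ?_
    rintro _ ⟨s, hs, rfl⟩
    exact max_le_max le_rfl (hω.neg_netInput_le x n hs.1 hs.2)
  have h2 : ∫ u in (0 : ℝ)..t, (newServers u ω.2.1 : ℝ) ≤ S := by
    refine intervalIntegral.integral_mono_on ht (hω.intervalIntegrable_newServers ht)
      (hω.intervalIntegrable_numServers n ht) fun u _ => ?_
    rw [numServers_eq]
    exact_mod_cast Nat.le_add_left _ _
  have h3 : netInput x n t ω = x + arrivedWork t ω - S := rfl
  rw [h3]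
  rcases le_total 0 (S - x) with h | h
  · rw [max_eq_right h] at h1
    linarith [le_max_left 0 (x - ∫ u in (0 : ℝ)..t, (newServers u ω.2.1 : ℝ))]
  · rw [max_eq_left h] at h1
    linarith [le_max_right 0 (x - ∫ u in (0 : ℝ)..t, (newServers u ω.2.1 : ℝ))]

theorem jobServer_zero (hω : Good ω) (z : ℝ≥0 × ℕ) : jobServer z 0 ω = z := by
  have hN : ArrivedBy 0 0 ω.1 := ⟨by simp, arrivalTime_pos hω.job_pos 0⟩
  have hM : ArrivedBy 0 0 ω.2.1 := ⟨by simp, arrivalTime_pos hω.server_pos 0⟩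
  refine Prod.ext (NNReal.coe_injective ?_) ?_
  · have h1 : netInput z.1 z.2 0 ω = z.1 := by
      simp [netInput, arrivedWork_eq hω.job_pos hN]
    change (work z.1 z.2 0 ω : ℝ) = z.1
    rw [hω.coe_work z.1 z.2 le_rfl]
    simp [h1]
  · change numServers z.2 0 ω = z.2
    rw [numServers_eq, newServers_eq hω.server_pos hM le_rfl, oldServers_eq]
    simp [hω.init_pos]

/-- The arrived work as an extended nonnegative number. -/
noncomputable def arrivedWorkE (t : ℝ) (e : ℕ → ℝ × ℝ) : ℝ≥0∞ :=
  ∑' i, if arrivalTime e i ≤ t then ENNReal.ofReal (e i).2 else 0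

theorem measurable_arrivedWorkE : Measurable fun p : ℝ × (ℕ → ℝ × ℝ) => arrivedWorkE p.1 p.2 := by
  refine Measurable.tsum fun i => Measurable.ite ?_ (by fun_prop) (by fun_prop)
  exact measurableSet_le (by fun_prop) (by fun_prop)

theorem Good.arrivedWork_eq_toReal (hω : Good ω) (t : ℝ) :
    arrivedWork t ω = (arrivedWorkE t ω.1).toReal := by
  unfold arrivedWorkE arrivedWork
  rw [ENNReal.tsum_toReal_eq]
  · refine tsum_congr fun i => ?_
    change (if arrivalTime ω.1 i ≤ t then _ else _) = _
    split_ifs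
    · rw [ENNReal.toReal_ofReal (hω.work_nonneg i)]
    · simp
  · intro i
    split_ifs <;> simp

/-- A version of `netInput` that is measurable also outside the good outcomes. -/
noncomputable def netInputM (z : ℝ≥0 × ℕ) (t : ℝ) (ω : Outcome) : ℝ :=
  z.1 + (arrivedWorkE t ω.1).toReal -
    ∫ u, (Set.Ioc 0 t).indicator (fun u => (numServers z.2 u ω : ℝ)) u

theorem Good.netInput_eq (hω : Good ω) (z : ℝ≥0 × ℕ) {t : ℝ} (ht : 0 ≤ t) :
    netInput z.1 z.2 t ω = netInputM z t ω := by
  rw [netInput, netInputM, hω.arrivedWork_eq_toReal, integral_indicator measurableSet_Ioc,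
    intervalIntegral.integral_of_le ht]

theorem measurable_netInputM :
    Measurable fun p : (ℝ × Outcome) × (ℝ≥0 × ℕ) => netInputM p.2 p.1.1 p.1.2 := by
  have h1 : Measurable fun p : (ℝ × Outcome) × (ℝ≥0 × ℕ) =>
      (arrivedWorkE p.1.1 p.1.2.1).toReal :=
    (measurable_arrivedWorkE.comp (f := fun p : (ℝ × Outcome) × (ℝ≥0 × ℕ) => (p.1.1, p.1.2.1))
      (by fun_prop)).ennreal_toReal
  have h2 : StronglyMeasurable fun p : ((ℝ × Outcome) × (ℝ≥0 × ℕ)) × ℝ =>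
      (Set.Ioc 0 p.1.1.1).indicator (fun u => (numServers p.1.2.2 u p.1.1.2 : ℝ)) p.2 := by
    refine Measurable.stronglyMeasurable ?_
    have h3 : Measurable fun p : ((ℝ × Outcome) × (ℝ≥0 × ℕ)) × ℝ =>
        (numServers p.1.2.2 p.2 p.1.1.2 : ℝ) :=
      measurable_from_top.comp (measurable_numServers.comp
        (f := fun p : ((ℝ × Outcome) × (ℝ≥0 × ℕ)) × ℝ => ((p.2, p.1.1.2), p.1.2.2)) (by fun_prop))
    refine h3.indicator (s := {p : ((ℝ × Outcome) × (ℝ≥0 × ℕ)) × ℝ | p.2 ∈ Set.Ioc 0 p.1.1.1}) ?_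
    have h4 : MeasurableSet {p : ((ℝ × Outcome) × (ℝ≥0 × ℕ)) × ℝ | 0 < p.2} :=
      measurableSet_lt (by fun_prop) (by fun_prop)
    have h5 : MeasurableSet {p : ((ℝ × Outcome) × (ℝ≥0 × ℕ)) × ℝ | p.2 ≤ p.1.1.1} :=
      measurableSet_le (by fun_prop) (by fun_prop)
    exact h4.inter h5
  have h3 := (h2.integral_prod_right' (ν := volume)).measurable
  exact ((by fun_prop : Measurable fun p : (ℝ × Outcome) × (ℝ≥0 × ℕ) => (p.2.1 : ℝ)).add h1).sub h3

/-- A version of `jobServer` that is measurable also outside the good outcomes. -/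
noncomputable def jobServerM (z : ℝ≥0 × ℕ) (t : ℝ) (ω : Outcome) : ℝ≥0 × ℕ :=
  (Real.toNNReal (netInputM z t ω +
    -- The times `min |v| t` are countably many points of `[0, t]` that include `t` itself, and
    -- `ENNReal.ofReal` performs the truncation at `0`.
    (⨆ v : ℚ, ENNReal.ofReal (-netInputM z (min |(v : ℝ)| t) ω)).toReal), numServers z.2 t ω)

theorem measurable_jobServerM :
    Measurable fun p : (ℝ × Outcome) × (ℝ≥0 × ℕ) => jobServerM p.2 p.1.1 p.1.2 := by
  refine Measurable.prodMk ?_ (measurable_numServers.comp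
    (f := fun p : (ℝ × Outcome) × (ℝ≥0 × ℕ) => (p.1, p.2.2)) (by fun_prop))
  refine (measurable_netInputM.add (Measurable.ennreal_toReal (Measurable.iSup fun v => ?_)))
    |>.real_toNNReal
  exact (measurable_netInputM.comp (f := fun p : (ℝ × Outcome) × (ℝ≥0 × ℕ) =>
    ((min |(v : ℝ)| p.1.1, p.1.2), p.2)) (by fun_prop)).neg.ennreal_ofReal

/-- The supremum over `[0, t]` may be taken over countably many times because `-netInput` is
nondecreasing between job arrivals. -/
theorem Good.jobServer_eq (hω : Good ω) (z : ℝ≥0 × ℕ) {t : ℝ} (ht : 0 ≤ t) :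
    jobServer z t ω = jobServerM z t ω := by
  refine Prod.ext ?_ rfl
  change Real.toNNReal _ = Real.toNNReal _
  congr 1
  rw [hω.netInput_eq z ht]
  congr 1
  have hmem : ∀ v : ℚ, min |(v : ℝ)| t ∈ Set.Icc 0 t := fun v =>
    ⟨le_min (abs_nonneg _) ht, min_le_right _ _⟩
  set R := sSup ((fun s => max 0 (-netInput z.1 z.2 s ω)) '' Set.Icc 0 t)
  set B := ⨆ v : ℚ, ENNReal.ofReal (-netInputM z (min |(v : ℝ)| t) ω)
  have hbdd := hω.bddAbove_neg_netInput z.1 z.2 t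
  have hBR : B ≤ ENNReal.ofReal R := by
    refine iSup_le fun v => ENNReal.ofReal_le_ofReal ?_
    rw [← hω.netInput_eq z (hmem v).1]
    exact (le_max_right 0 _).trans (le_csSup hbdd ⟨_, hmem v, rfl⟩)
  have hBtop : B ≠ ∞ := ne_top_of_le_ne_top ENNReal.ofReal_ne_top hBR
  have hR0 : 0 ≤ R := (le_max_left 0 _).trans (le_csSup hbdd ⟨0, ⟨le_rfl, ht⟩, rfl⟩)
  apply le_antisymm
  · refine csSup_le ⟨_, ⟨0, ⟨le_rfl, ht⟩, rfl⟩⟩ ?_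
    rintro _ ⟨s, hs, rfl⟩
    refine max_le ENNReal.toReal_nonneg ?_
    -- For `s < t` take a rational after `s` but before `t` and the next job arrival: the arrived
    -- work is unchanged and the cumulative service has not decreased. For `s = t` any rational
    -- beyond `t` is cut back to `t`.
    have key : ∃ v : ℚ, -netInput z.1 z.2 s ω ≤ -netInput z.1 z.2 (min |(v : ℝ)| t) ω := by
      rcases hs.2.eq_or_lt with rfl | hst
      · obtain ⟨v, hv⟩ := exists_rat_gt s
        refine ⟨v, ?_⟩
        rw [min_eq_right (hv.le.trans (le_abs_self _))]
      · have hN := arrivedBy_numArrivals (hω.job_unbounded s)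
        set N := numArrivals s ω.1
        obtain ⟨v, hv1, hv2⟩ := exists_rat_btwn (lt_min hN.2 hst)
        refine ⟨v, ?_⟩
        have hv0 : 0 ≤ (v : ℝ) := hs.1.trans hv1.le
        rw [abs_of_nonneg hv0, min_eq_left (hv2.le.trans (min_le_right _ _))]
        have hN' : ArrivedBy N v ω.1 :=
          ⟨fun k hk => (hN.1 k hk).trans hv1.le, hv2.trans_le (min_le_left _ _)⟩
        have := hω.integral_numServers_mono z.2 hs.1 hv1.le
        rw [netInput, netInput, arrivedWork_eq hω.job_pos hN, arrivedWork_eq hω.job_pos hN']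
        linarith
    obtain ⟨v, hv⟩ := key
    refine hv.trans ?_
    rw [hω.netInput_eq z (hmem v).1]
    have h1 : ENNReal.ofReal (-netInputM z (min |(v : ℝ)| t) ω) ≤ B :=
      le_iSup (fun v : ℚ => ENNReal.ofReal (-netInputM z (min |(v : ℝ)| t) ω)) v
    rw [← ENNReal.ofReal_toReal hBtop] at h1
    exact (ENNReal.ofReal_le_ofReal_iff ENNReal.toReal_nonneg).1 h1
  · rw [← ENNReal.toReal_ofReal hR0]
    exact ENNReal.toReal_mono ENNReal.ofReal_ne_top hBR

end MGMM

/-! ### The Markov property -/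

/-- Lets the surviving servers be renumbered as the initial servers of the restarted process.
Injectivity of the whole sequence ensures that an i.i.d. family read along it is again i.i.d. -/
theorem exists_injective_image_range_eq (S : Finset (ℕ ⊕ ℕ)) :
    ∃ σ : ℕ → ℕ ⊕ ℕ, Function.Injective σ ∧ (Finset.range S.card).image σ = S := by
  classical
  have hinf : Infinite {x // x ∉ S} := S.finite_toSet.infinite_compl.to_subtype
  let g := Infinite.natEmbedding {x // x ∉ S}
  let σ : ℕ → ℕ ⊕ ℕ := fun k => if h : k < S.card then (S.equivFin.symm ⟨k, h⟩ : ℕ ⊕ ℕ) else g k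
  have h1 : ∀ k (h : k < S.card), σ k = S.equivFin.symm ⟨k, h⟩ := fun k h => dif_pos h
  have h2 : ∀ k, ¬ k < S.card → σ k = g k := fun k h => dif_neg h
  refine ⟨σ, fun a b hab => ?_, ?_⟩
  · by_cases ha : a < S.card <;> by_cases hb : b < S.card
    · rw [h1 a ha, h1 b hb] at hab
      simpa using S.equivFin.symm.injective (Subtype.ext hab)
    · rw [h1 a ha, h2 b hb] at hab
      exact absurd (hab ▸ (S.equivFin.symm ⟨a, ha⟩).2) (g b).2
    · rw [h2 a ha, h1 b hb] at hab
      exact absurd (hab ▸ (S.equivFin.symm ⟨b, hb⟩).2) (g a).2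
    · rw [h2 a ha, h2 b hb] at hab
      exact g.injective (Subtype.ext hab)
  · ext x
    simp only [Finset.mem_image, Finset.mem_range]
    constructor
    · rintro ⟨k, hk, rfl⟩
      rw [h1 k hk]
      exact (S.equivFin.symm ⟨k, hk⟩).2
    · intro hx
      refine ⟨S.equivFin ⟨x, hx⟩, (S.equivFin ⟨x, hx⟩).2, ?_⟩
      rw [h1 _ (S.equivFin ⟨x, hx⟩).2]
      simp

/-- An injective sequence that starts with the elements of `S`. -/
noncomputable def enumFirst (S : Finset (ℕ ⊕ ℕ)) : ℕ → ℕ ⊕ ℕ :=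
  (exists_injective_image_range_eq S).choose

theorem enumFirst_injective (S : Finset (ℕ ⊕ ℕ)) : Function.Injective (enumFirst S) :=
  (exists_injective_image_range_eq S).choose_spec.1

theorem sum_range_enumFirst (S : Finset (ℕ ⊕ ℕ)) (f : ℕ ⊕ ℕ → ℕ) :
    ∑ k ∈ Finset.range S.card, f (enumFirst S k) = ∑ x ∈ S, f x := by
  classical
  have h : (Finset.range S.card).image (enumFirst S) = S := by
    convert (exists_injective_image_range_eq S).choose_spec.2
    rfl
  conv_rhs => rw [← h]
  rw [Finset.sum_image fun a _ b _ hab => enumFirst_injective S hab]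

namespace MGMM

/-- The data of what happens after time `t`: job and server arrivals, and pools of residual
lifetimes for the servers that arrive in `[0, t]` and for those present at time `0`. -/
abbrev Future : Type := (ℕ → ℝ × ℝ) × ((ℕ → ℝ × ℝ) × (ℕ → ℝ)) × (ℕ → ℝ)

/-- The law of the future. -/
noncomputable def futureLaw (q : MGMM) : Measure Future :=
  (markedPoisson q.lamC q.workload).prod
    (((markedPoisson q.lamS (expMeasure q.muS)).prod
      (Measure.infinitePi fun _ : ℕ => expMeasure q.muS)).prod
        (Measure.infinitePi fun _ : ℕ => expMeasure q.muS))

instance (q : MGMM) : IsProbabilityMeasure q.futureLaw := by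
  have := q.workload_prob
  have := isProbabilityMeasure_expMeasure q.lamC_pos
  have := isProbabilityMeasure_expMeasure q.lamS_pos
  have := isProbabilityMeasure_expMeasure q.muS_pos
  unfold futureLaw
  infer_instance

/-- The outcome that follows `ω` up to time `t` and `η` afterwards. -/
noncomputable def spliceOutcome (t : ℝ) (p : Outcome × Future) : Outcome :=
  (splice (fun _ w => w) t p.1.1 p.2.1,
    splice renewAt t (fun j => ((p.1.2.1 j).1, ((p.1.2.1 j).2, p.2.2.1.2 j))) p.2.2.1.1,
    fun i => renewAt t (p.1.2.2 i, p.2.2.2 i))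

/-- The three components are handled separately: job marks are kept, lifetimes of arrived servers
are renewed at their age at time `t`, and initial lifetimes are renewed at age `t`. The rest
rearranges the factors so that each past component meets its future. -/
theorem measurePreserving_spliceOutcome (q : MGMM) {t : ℝ} (ht : 0 ≤ t) :
    MeasurePreserving (spliceOutcome t) (q.law.prod q.futureLaw) q.law := by
  have := q.workload_prob
  have := isProbabilityMeasure_expMeasure q.lamC_pos
  have := isProbabilityMeasure_expMeasure q.lamS_pos
  have := isProbabilityMeasure_expMeasure q.muS_pos
  have hj : MeasurePreserving (fun p : (ℕ → ℝ × ℝ) × (ℕ → ℝ × ℝ) =>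
      splice (fun _ w => w) t p.1 p.2) _ _ :=
    measurePreserving_splice (κ := q.workload) (κ₀ := q.workload) q.lamC_pos
      (m := fun _ w => w) measurable_snd (fun c _ => MeasurePreserving.id _) ht
  have hs : MeasurePreserving (fun p : (ℕ → ℝ × (ℝ × ℝ)) × (ℕ → ℝ × ℝ) =>
      splice renewAt t p.1 p.2) _ _ :=
    measurePreserving_splice (κ := expMeasure q.muS) (κ₀ := (expMeasure q.muS).prod
      (expMeasure q.muS)) q.lamS_pos measurable_renewAt
      (fun c hc => measurePreserving_renewAt q.muS_pos hc) ht
  have hi : MeasurePreserving (fun (p : (ℕ → ℝ) × (ℕ → ℝ)) i => renewAt t (p.1 i, p.2 i)) _ _ :=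
    measurePreserving_infinitePi_map₂ (ι := ℕ) (expMeasure q.muS) (expMeasure q.muS)
      (measurePreserving_renewAt q.muS_pos ht)
  -- Each arrived server receives its own residual lifetime from the pool, so that the mark to be
  -- modified by `renewAt` is a pair.
  have hz : MeasurePreserving (fun (p : (ℕ → ℝ × ℝ) × (ℕ → ℝ)) j =>
      (((p.1 j).1, ((p.1 j).2, p.2 j)) : ℝ × (ℝ × ℝ))) _ _ :=
    measurePreserving_infinitePi_map₂ (ι := ℕ) ((expMeasure q.lamS).prod (expMeasure q.muS))
      (expMeasure q.muS) (measurePreserving_prodAssoc (expMeasure q.lamS) (expMeasure q.muS)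
        (expMeasure q.muS))
  set Ls := markedPoisson q.lamS (expMeasure q.muS)
  set Lr := Measure.infinitePi fun _ : ℕ => expMeasure q.muS
  have hr : MeasurePreserving (fun p : (ℕ → ℝ × ℝ) × ((ℕ → ℝ × ℝ) × (ℕ → ℝ)) =>
      ((p.1, p.2.2), p.2.1)) (Ls.prod (Ls.prod Lr)) ((Ls.prod Lr).prod Ls) :=
    (measurePreserving_prodAssoc Ls Lr Ls).symm.comp
      ((MeasurePreserving.id Ls).prod (Measure.measurePreserving_swap (μ := Ls) (ν := Lr)))
  have hs' := (hs.comp (hz.prod (MeasurePreserving.id Ls))).comp hr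
  have c1 := measurePreserving_prodProdProdComm (markedPoisson q.lamC q.workload) (Ls.prod Lr)
    (markedPoisson q.lamC q.workload) ((Ls.prod Lr).prod Lr)
  have c2 := measurePreserving_prodProdProdComm Ls Lr (Ls.prod Lr) Lr
  exact (hj.prod ((hs'.prod hi).comp c2)).comp c1

/-- The labels of the servers present at time `t`: `inl i` for the initial server `i` and `inr j`
for the arriving server `j`. -/
noncomputable def survivors (n : ℕ) (t : ℝ) (ω : Outcome) : Finset (ℕ ⊕ ℕ) :=
  ((Finset.range n).filter fun i => t < ω.2.2 i).disjSum
    ((Finset.range (numArrivals t ω.2.1)).filter fun j =>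
      t < arrivalTime ω.2.1 j + (ω.2.1 j).2)

/-- The past, together with the outcome that the process observes after time `t`. -/
noncomputable def restartOutcome (n : ℕ) (t : ℝ) (p : Outcome × Future) : Outcome × Outcome :=
  (p.1, (p.2.1, p.2.2.1.1,
    fun k => Sum.elim p.2.2.2 p.2.2.1.2 (enumFirst (survivors n t p.1) k)))

theorem measurable_filter_range {α : Type*} [MeasurableSpace α] {A : ℕ → Set α}
    [∀ a, DecidablePred fun i => a ∈ A i]
    (hA : ∀ i, MeasurableSet (A i)) (n : ℕ) :
    Measurable[_, ⊤] fun a => (Finset.range n).filter fun i => a ∈ A i := by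
  let _ : MeasurableSpace (Finset ℕ) := ⊤
  induction n with
  | zero => simp
  | succ n ih =>
    simp_rw [Finset.range_add_one, Finset.filter_insert]
    exact Measurable.ite (hA n) (Measurable.comp measurable_from_top ih) ih

theorem measurable_survivors (n : ℕ) (t : ℝ) : Measurable[_, ⊤] (survivors n t) := by
  let _ : MeasurableSpace (Finset ℕ) := ⊤
  let _ : MeasurableSpace (Finset (ℕ ⊕ ℕ)) := ⊤
  have h1 : Measurable fun ω : Outcome => (Finset.range n).filter fun i => t < ω.2.2 i :=
    measurable_filter_range (A := fun i => {ω : Outcome | t < ω.2.2 i})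
      (fun i => measurableSet_lt (by fun_prop) (by fun_prop)) n
  have h2 : Measurable fun p : Outcome × ℕ => (Finset.range p.2).filter fun j =>
      t < arrivalTime p.1.2.1 j + (p.1.2.1 j).2 :=
    measurable_from_prod_countable_left fun m =>
      measurable_filter_range (A := fun j => {ω : Outcome | t < arrivalTime ω.2.1 j + (ω.2.1 j).2})
        (fun i => measurableSet_lt (by fun_prop) (by fun_prop)) m
  have h3 : Measurable fun ω : Outcome => numArrivals t ω.2.1 :=
    (measurable_numArrivals t).comp (by fun_prop)
  have h4 : Measurable fun p : Finset ℕ × Finset ℕ => p.1.disjSum p.2 :=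
    measurable_from_prod_countable_left fun _ => measurable_from_top
  exact h4.comp (h1.prodMk (h2.comp (measurable_id.prodMk h3)))

/-- For a fixed set of survivors, an injective selection from the pools is i.i.d. with the right
law. The actual set is determined by the past, so a skew product yields a restarted outcome that is
independent of the past. -/
theorem measurePreserving_restartOutcome (q : MGMM) (n : ℕ) (t : ℝ) :
    MeasurePreserving (restartOutcome n t) (q.law.prod q.futureLaw) (q.law.prod q.law) := by
  have := q.workload_prob
  have := isProbabilityMeasure_expMeasure q.lamC_pos
  have := isProbabilityMeasure_expMeasure q.lamS_pos
  have := isProbabilityMeasure_expMeasure q.muS_pos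
  let _ : MeasurableSpace (Finset (ℕ ⊕ ℕ)) := ⊤
  set Ls := markedPoisson q.lamS (expMeasure q.muS)
  set Lr := Measure.infinitePi fun _ : ℕ => expMeasure q.muS
  have hpool : ∀ S : Finset (ℕ ⊕ ℕ), MeasurePreserving (fun (p : (ℕ → ℝ) × (ℕ → ℝ)) k =>
      (Sum.elim p.1 p.2 (enumFirst S k) : ℝ)) (Lr.prod Lr) Lr := by
    intro S
    have h1 : MeasurePreserving (fun (p : (ℕ ⊕ ℕ) → ℝ) k => p (enumFirst S k))
        (Measure.infinitePi fun _ => expMeasure q.muS) Lr :=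
      ⟨by fun_prop, Measure.map_infinitePi_infinitePi_of_inj (enumFirst_injective S)⟩
    exact h1.comp (measurePreserving_sumElim (ι := ℕ) (κ := ℕ) (expMeasure q.muS))
  have hg : ∀ S : Finset (ℕ ⊕ ℕ), MeasurePreserving (fun η : Future =>
      ((η.1, η.2.1.1, fun k => Sum.elim η.2.2 η.2.1.2 (enumFirst S k)) : Outcome))
      q.futureLaw q.law := by
    intro S
    have h1 : MeasurePreserving (fun p : ((ℕ → ℝ × ℝ) × (ℕ → ℝ)) × (ℕ → ℝ) =>
        (p.1.1, (p.2, p.1.2))) ((Ls.prod Lr).prod Lr) (Ls.prod (Lr.prod Lr)) :=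
      ((MeasurePreserving.id Ls).prod (Measure.measurePreserving_swap (μ := Lr) (ν := Lr))).comp
        (measurePreserving_prodAssoc Ls Lr Lr)
    exact (MeasurePreserving.id (markedPoisson q.lamC q.workload)).prod
      (((MeasurePreserving.id Ls).prod (hpool S)).comp h1)
  refine (MeasurePreserving.id q.law).skew_product (g := fun ω (η : Future) => ((η.1, η.2.1.1,
    fun k => Sum.elim η.2.2 η.2.1.2 (enumFirst (survivors n t ω) k)) : Outcome)) ?_
    (Filter.Eventually.of_forall fun ω => (hg _).map_eq)
  have h2 : Measurable fun p : Future × Finset (ℕ ⊕ ℕ) => ((p.1.1, p.1.2.1.1,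
      fun k => Sum.elim p.1.2.2 p.1.2.1.2 (enumFirst p.2 k)) : Outcome) :=
    measurable_from_prod_countable_left fun S => (hg S).measurable
  exact h2.comp (measurable_snd.prodMk ((measurable_survivors n t).comp measurable_fst))

theorem ae_pool_pos (q : MGMM) : ∀ᵐ η ∂q.futureLaw, (∀ j, 0 < η.2.1.2 j) ∧ ∀ i, 0 < η.2.2 i := by
  have := q.workload_prob
  have := isProbabilityMeasure_expMeasure q.lamC_pos
  have := isProbabilityMeasure_expMeasure q.lamS_pos
  have := isProbabilityMeasure_expMeasure q.muS_pos
  have h3 : ∀ᵐ e ∂(Measure.infinitePi fun _ : ℕ => expMeasure q.muS), ∀ k, 0 < e k :=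
    ae_all_iff.2 fun k => (measurePreserving_eval_infinitePi
      (fun _ : ℕ => expMeasure q.muS) k).quasiMeasurePreserving.ae (ae_pos_expMeasure q.muS_pos)
  have h4 : ∀ᵐ η ∂q.futureLaw, _ := measurePreserving_snd.quasiMeasurePreserving.ae
    (measurePreserving_snd.quasiMeasurePreserving.ae h3)
  have h5 : ∀ᵐ η ∂q.futureLaw, _ := measurePreserving_snd.quasiMeasurePreserving.ae
    (measurePreserving_fst.quasiMeasurePreserving.ae
      (measurePreserving_snd.quasiMeasurePreserving.ae h3))
  exact h5.and h4

/-! ### Pathwise flow property of the spliced process. -/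

section Flow

variable {ω : Outcome} {η : Future} {t : ℝ}

theorem arrivedBy_splice_of_le {M M' : Type*} {m : ℝ → M' → M} {e : ℕ → ℝ × M'} {e' : ℕ → ℝ × M}
    (he' : ∀ k, 0 < (e' k).1) {N : ℕ} (hN : ArrivedBy N t e) {u : ℝ} (hu : u ≤ t) {K : ℕ}
    (hK : ArrivedBy K u e) : K ≤ N ∧ ArrivedBy K u (splice m t e e') := by
  have hKN : K ≤ N := by
    by_contra h
    linarith [hK.1 N (not_le.1 h), hN.2]
  rw [splice, hN.numArrivals_eq]
  refine ⟨hKN, fun k hk => ?_, ?_⟩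
  · rw [arrivalTime_spliceAt_of_lt _ _ _ _ _ (hk.trans_le hKN)]
    exact hK.1 k hk
  · rcases hKN.eq_or_lt with rfl | h
    · have := arrivalTime_spliceAt_add m K t e e' 0
      rw [zero_add] at this
      rw [this]
      linarith [arrivalTime_pos he' 0]
    · rw [arrivalTime_spliceAt_of_lt _ _ _ _ _ h]
      exact hK.2

theorem arrivedBy_splice_add {M M' : Type*} {m : ℝ → M' → M} {e : ℕ → ℝ × M'} {e' : ℕ → ℝ × M}
    {N : ℕ} (hN : ArrivedBy N t e) {s : ℝ} (hs : 0 ≤ s) {K : ℕ} (hK : ArrivedBy K s e') :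
    ArrivedBy (N + K) (t + s) (splice m t e e') := by
  rw [splice, hN.numArrivals_eq]
  refine ⟨fun k hk => ?_, ?_⟩
  · by_cases h : k < N
    · rw [arrivalTime_spliceAt_of_lt _ _ _ _ _ h]
      linarith [hN.1 k h]
    · obtain ⟨i, rfl⟩ : ∃ i, k = i + N := ⟨k - N, by omega⟩
      rw [arrivalTime_spliceAt_add]
      linarith [hK.1 i (by omega)]
  · rw [add_comm N K, arrivalTime_spliceAt_add]
    linarith [hK.2]

theorem add_lt_renewAt_iff {c s : ℝ} (hs : 0 ≤ s) (p : ℝ × ℝ) :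
    c + s < renewAt c p ↔ c < p.1 ∧ s < p.2 := by
  unfold renewAt
  split_ifs with h
  · constructor
    · intro h'; linarith
    · rintro ⟨h', -⟩; linarith
  · constructor
    · intro h'; exact ⟨not_le.1 h, by linarith⟩
    · rintro ⟨-, h'⟩; linarith

theorem lt_renewAt_iff {c u : ℝ} (hu : u ≤ c) {p : ℝ × ℝ} (hp : 0 < p.2) :
    u < renewAt c p ↔ u < p.1 := by
  unfold renewAt
  split_ifs with h
  · rfl
  · constructor <;> intro <;> linarith [not_le.1 h]

theorem arrivedWork_splice_of_le (hω : Good ω) (hη : ∀ k, 0 < (η.1 k).1)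
    (hsp : Good (spliceOutcome t (ω, η))) {u : ℝ} (hu : u ≤ t) :
    arrivedWork u (spliceOutcome t (ω, η)) = arrivedWork u ω := by
  have hN := arrivedBy_numArrivals (hω.job_unbounded t)
  have hK := arrivedBy_numArrivals (hω.job_unbounded u)
  obtain ⟨h1, h2⟩ := arrivedBy_splice_of_le (m := fun _ w => w) hη hN hu hK
  rw [arrivedWork_eq hω.job_pos hK, arrivedWork_eq hsp.job_pos h2]
  refine Finset.sum_congr rfl fun i hi => ?_
  have hi' := (Finset.mem_range.1 hi).trans_le h1
  change (splice (fun _ w => w) t ω.1 η.1 i).2 = _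
  rw [splice, spliceAt_of_lt _ _ _ _ _ hi']

theorem arrivedWork_splice_add (hω : Good ω) {ω' : Outcome} (hω' : Good ω') (h1 : ω'.1 = η.1)
    (hsp : Good (spliceOutcome t (ω, η))) {s : ℝ} (hs : 0 ≤ s) :
    arrivedWork (t + s) (spliceOutcome t (ω, η)) = arrivedWork t ω + arrivedWork s ω' := by
  have hN := arrivedBy_numArrivals (hω.job_unbounded t)
  obtain ⟨K, hK⟩ : ∃ K, ArrivedBy K s ω'.1 := ⟨_, arrivedBy_numArrivals (hω'.job_unbounded s)⟩
  have h2 := arrivedBy_splice_add (m := fun _ w => w) hN hs (h1 ▸ hK)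
  rw [arrivedWork_eq hω.job_pos hN, arrivedWork_eq hsp.job_pos h2, arrivedWork_eq hω'.job_pos hK,
    Finset.sum_range_add]
  congr 1
  · refine Finset.sum_congr rfl fun i hi => ?_
    change (splice (fun _ w => w) t ω.1 η.1 i).2 = _
    rw [splice, spliceAt_of_lt _ _ _ _ _ (Finset.mem_range.1 hi)]
  · refine Finset.sum_congr rfl fun i _ => ?_
    change (splice (fun _ w => w) t ω.1 η.1 _).2 = _
    rw [splice, add_comm, spliceAt_add_snd, h1]

/-- Renewal at time `t` only alters lifetimes that extend beyond `t`. Positivity of the pools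
matters at `u = t`, where a renewed server must still be present. -/
theorem numServers_splice_of_le (hω : Good ω) (hη : ∀ k, 0 < (η.2.1.1 k).1)
    (hp : (∀ j, 0 < η.2.1.2 j) ∧ ∀ i, 0 < η.2.2 i)
    (hsp : Good (spliceOutcome t (ω, η))) (n : ℕ) {u : ℝ} (hu : u ≤ t) :
    numServers n u (spliceOutcome t (ω, η)) = numServers n u ω := by
  have hN := arrivedBy_numArrivals (hω.server_unbounded t)
  set N := numArrivals t ω.2.1
  have hN' : ArrivedBy N t (fun j => ((ω.2.1 j).1, ((ω.2.1 j).2, η.2.1.2 j))) := hN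
  have h2 := (arrivedBy_splice_of_le (m := renewAt) hη hN' le_rfl hN').2
  rw [numServers_eq, numServers_eq, oldServers_eq, oldServers_eq,
    newServers_eq hsp.server_pos h2 hu, newServers_eq hω.server_pos hN hu]
  congr 2
  · refine Finset.filter_congr fun i _ => ?_
    exact lt_renewAt_iff hu (hp.2 i)
  · refine Finset.filter_congr fun j hj => ?_
    have hj' := Finset.mem_range.1 hj
    change arrivalTime (splice renewAt t _ _) j ≤ u ∧ u < arrivalTime (splice renewAt t _ _) j +
      (splice renewAt t _ _ j).2 ↔ _
    rw [splice, hN'.numArrivals_eq, arrivalTime_spliceAt_of_lt _ _ _ _ _ hj',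
      spliceAt_of_lt _ _ _ _ _ hj']
    refine and_congr Iff.rfl ?_
    have h3 := lt_renewAt_iff (c := t - arrivalTime ω.2.1 j) (u := u - arrivalTime ω.2.1 j)
      (by linarith) (p := ((ω.2.1 j).2, η.2.1.2 j)) (hp.1 j)
    rw [sub_lt_iff_lt_add', sub_lt_iff_lt_add'] at h3
    exact h3

theorem card_survivors (hω : Good ω) (n : ℕ) (t : ℝ) :
    (survivors n t ω).card = numServers n t ω := by
  have hN := arrivedBy_numArrivals (hω.server_unbounded t)
  rw [numServers_eq, oldServers_eq, newServers_eq hω.server_pos hN le_rfl, survivors,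
    Finset.card_disjSum]
  congr 2
  refine Finset.filter_congr fun j hj => ?_
  simp [hN.1 j (Finset.mem_range.1 hj)]

/-- The servers at time `t + s` are survivors from time `t` whose pool lifetime exceeds `s`, or
arrivals of the future. The order in which survivors are enumerated does not affect the count. -/
theorem numServers_splice_add (hω : Good ω) (n : ℕ)
    (hω' : Good (restartOutcome n t (ω, η)).2)
    (hsp : Good (spliceOutcome t (ω, η))) {s : ℝ} (hs : 0 ≤ s) :
    numServers n (t + s) (spliceOutcome t (ω, η)) =
      numServers (numServers n t ω) s (restartOutcome n t (ω, η)).2 := by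
  have hN := arrivedBy_numArrivals (hω.server_unbounded t)
  set N := numArrivals t ω.2.1
  have hN' : ArrivedBy N t (fun j => ((ω.2.1 j).1, ((ω.2.1 j).2, η.2.1.2 j))) := hN
  have hK : ArrivedBy _ s η.2.1.1 := arrivedBy_numArrivals (hω'.server_unbounded s)
  set K := numArrivals s η.2.1.1
  have h2 := arrivedBy_splice_add (m := renewAt) hN' hs hK
  have hnew : newServers s (restartOutcome n t (ω, η)).2.2.1 = newServers s η.2.1.1 := rfl
  have hold : oldServers (numServers n t ω) s (restartOutcome n t (ω, η)).2.2.2 =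
      ((Finset.range n).filter fun i => t < ω.2.2 i ∧ s < η.2.2 i).card +
      ((Finset.range N).filter fun j => t < arrivalTime ω.2.1 j + (ω.2.1 j).2 ∧
        s < η.2.1.2 j).card := by
    rw [oldServers_eq, Finset.card_filter, ← card_survivors hω n t]
    change ∑ k ∈ Finset.range (survivors n t ω).card, (if s < Sum.elim η.2.2 η.2.1.2
      (enumFirst (survivors n t ω) k) then 1 else 0) = _
    rw [sum_range_enumFirst _ fun x => if s < Sum.elim η.2.2 η.2.1.2 x then 1 else 0, survivors,
      Finset.sum_disjSum, ← Finset.filter_filter, ← Finset.filter_filter, Finset.card_filter,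
      Finset.card_filter]
    rfl
  rw [numServers_eq, numServers_eq, hnew, hold, oldServers_eq,
    newServers_eq hsp.server_pos h2 le_rfl, newServers_eq (e := η.2.1.1) (fun k => hω'.server_pos k) hK le_rfl,
    add_assoc]
  congr 1
  · congr 1
    refine Finset.filter_congr fun i _ => ?_
    exact add_lt_renewAt_iff hs _
  · rw [Finset.card_filter, Finset.card_filter, Finset.card_filter, Finset.sum_range_add]
    congr 1
    · refine Finset.sum_congr rfl fun j hj => ?_
      have hj' := Finset.mem_range.1 hj
      change (if arrivalTime (splice renewAt t _ _) j ≤ t + s ∧ t + s <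
        arrivalTime (splice renewAt t _ _) j + (splice renewAt t _ _ j).2 then 1 else 0) = _
      rw [splice, hN'.numArrivals_eq, arrivalTime_spliceAt_of_lt _ _ _ _ _ hj',
        spliceAt_of_lt _ _ _ _ _ hj']
      refine if_congr ?_ rfl rfl
      have h3 := add_lt_renewAt_iff (c := t - arrivalTime ω.2.1 j) hs
        ((ω.2.1 j).2, η.2.1.2 j)
      rw [sub_lt_iff_lt_add', sub_add_eq_add_sub, sub_lt_iff_lt_add'] at h3
      refine (and_iff_right ?_).trans h3
      exact (hN.1 j hj').trans (by linarith)
    · refine Finset.sum_congr rfl fun j _ => ?_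
      change (if arrivalTime (splice renewAt t _ _) (N + j) ≤ t + s ∧ t + s <
        arrivalTime (splice renewAt t _ _) (N + j) + (splice renewAt t _ _ (N + j)).2
        then 1 else 0) = _
      rw [splice, hN'.numArrivals_eq, add_comm N j, arrivalTime_spliceAt_add, spliceAt_add_snd]
      refine if_congr ?_ rfl rfl
      rw [add_assoc, add_le_add_iff_left, add_lt_add_iff_left]

/-- The flow property: after time `t` the process evolves as if restarted at time `t`. -/
theorem jobServer_splice_add (hω : Good ω) (z : ℝ≥0 × ℕ)
    (hω' : Good (restartOutcome z.2 t (ω, η)).2)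
    (hp : (∀ j, 0 < η.2.1.2 j) ∧ ∀ i, 0 < η.2.2 i)
    (hsp : Good (spliceOutcome t (ω, η))) (ht : 0 ≤ t) {s : ℝ} (hs : 0 ≤ s) :
    jobServer z (t + s) (spliceOutcome t (ω, η)) =
      jobServer (jobServer z t ω) s (restartOutcome z.2 t (ω, η)).2 := by
  obtain ⟨x, n⟩ := z
  set ω' := (restartOutcome n t (ω, η)).2
  set ωs := spliceOutcome t (ω, η)
  refine Prod.ext (NNReal.coe_injective ?_) (numServers_splice_add hω n hω' hsp hs)
  change (work x n (t + s) ωs : ℝ) = work (work x n t ω) (numServers n t ω) s ω'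
  have hηj : ∀ k, 0 < (η.1 k).1 := hω'.job_pos
  have hηs : ∀ k, 0 < (η.2.1.1 k).1 := hω'.server_pos
  have hpast : ∀ u ∈ Set.Icc 0 t, netInput x n u ωs = netInput x n u ω := by
    intro u hu
    unfold netInput
    rw [arrivedWork_splice_of_le hω hηj hsp hu.2]
    congr 1
    refine intervalIntegral.integral_congr fun v hv => ?_
    rw [Set.uIcc_of_le hu.1] at hv
    rw [numServers_splice_of_le hω hηs hp hsp n (hv.2.trans hu.2)]
  have hwork : (work x n t ω : ℝ) = netInput x n t ωs +
      sSup ((fun s => max 0 (-netInput x n s ωs)) '' Set.Icc 0 t) := by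
    rw [hω.coe_work x n ht, hpast t ⟨ht, le_rfl⟩]
    congr 2
    exact Set.image_congr fun u hu => by rw [hpast u hu]
  set R := sSup ((fun s => max 0 (-netInput x n s ωs)) '' Set.Icc 0 t) with hR
  -- The workload at `t` is the free workload plus the reflection term `R`, so restarting from it
  -- amounts to adding `R` to the original free workload.
  have hfut : ∀ u, 0 ≤ u → netInput (work x n t ω) (numServers n t ω) u ω' =
      R + netInput x n (t + u) ωs := by
    intro u hu
    have h1 : ∫ v in (0 : ℝ)..u, (numServers (numServers n t ω) v ω' : ℝ) =
        ∫ v in t..(t + u), (numServers n v ωs : ℝ) := by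
      have h2 : ∫ v in t..(t + u), (numServers n v ωs : ℝ) =
          ∫ v in (0 : ℝ)..u, (numServers n (t + v) ωs : ℝ) := by
        rw [intervalIntegral.integral_comp_add_left (fun v => (numServers n v ωs : ℝ)) t, add_zero]
      rw [h2]
      refine intervalIntegral.integral_congr fun v hv => ?_
      rw [Set.uIcc_of_le hu] at hv
      rw [numServers_splice_add hω n hω' hsp hv.1]
    have h3 : ∫ v in (0 : ℝ)..(t + u), (numServers n v ωs : ℝ) =
        (∫ v in (0 : ℝ)..t, (numServers n v ωs : ℝ)) +
          ∫ v in t..(t + u), (numServers n v ωs : ℝ) :=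
      (intervalIntegral.integral_add_adjacent_intervals
        (hsp.intervalIntegrable_numServers n ht)
        (hsp.intervalIntegrable_numServers n (by linarith))).symm
    have h4 := arrivedWork_splice_add (ω' := ω') hω hω' rfl hsp hu
    have h5 := arrivedWork_splice_of_le hω hηj hsp (le_refl t)
    rw [netInput, hwork, h1, netInput, netInput, h3, h4, h5]
    ring
  rw [hsp.coe_work x n (by linarith), hω'.coe_work _ _ hs,
    sSup_reflection_add ht hs (fun u hu => hsp.neg_netInput_le x n hu.1 hu.2), ← hR, hfut s hs]
  have h6 : (fun u => max 0 (-netInput (work x n t ω) (numServers n t ω) u ω')) '' Set.Icc 0 s =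
      (fun u => max 0 (-(R + netInput x n (t + u) ωs))) '' Set.Icc 0 s :=
    Set.image_congr fun u hu => by rw [hfut u hu.1]
  rw [h6]
  ring

end Flow

/-! ### Transition kernels and the Markov property. -/

variable (q : MGMM)

theorem measurable_jobServerM_seq (τ : ℕ → ℝ) :
    Measurable fun p : (ℝ≥0 × ℕ) × Outcome => fun k => jobServerM p.1 (τ k) p.2 :=
  measurable_pi_lambda _ fun k => measurable_jobServerM.comp
    (f := fun p : (ℝ≥0 × ℕ) × Outcome => ((τ k, p.2), p.1)) (by fun_prop)

theorem measurable_jobServerM_outcome (z : ℝ≥0 × ℕ) (t : ℝ) : Measurable (jobServerM z t) :=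
  measurable_jobServerM.comp (f := fun ω : Outcome => ((t, ω), z)) (by fun_prop)

/-- The law of the state at time `t` of the process started in `z`. -/
noncomputable def transition (t : ℝ) : Kernel (ℝ≥0 × ℕ) (ℝ≥0 × ℕ) where
  toFun z := q.law.map (jobServerM z t)
  measurable' := by
    refine Measure.measurable_of_measurable_coe _ fun A hA => ?_
    simp_rw [fun z => Measure.map_apply (μ := q.law) (measurable_jobServerM_outcome z t) hA]
    have h : Measurable fun p : (ℝ≥0 × ℕ) × Outcome => jobServerM p.1 t p.2 :=
      measurable_jobServerM.comp
        (f := fun p : (ℝ≥0 × ℕ) × Outcome => ((t, p.2), p.1)) (by fun_prop)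
    exact measurable_measure_prodMk_left (h hA)

instance (t : ℝ) : IsMarkovKernel (q.transition t) :=
  ⟨fun z => Measure.isProbabilityMeasure_map (measurable_jobServerM_outcome z t).aemeasurable⟩

theorem transition_apply (t : ℝ) (z : ℝ≥0 × ℕ) {A : Set (ℝ≥0 × ℕ)} (hA : MeasurableSet A) :
    q.transition t z A = q.law {ω | jobServerM z t ω ∈ A} :=
  Measure.map_apply (measurable_jobServerM_outcome z t) hA

theorem lintegral_transition (t : ℝ) (z : ℝ≥0 × ℕ) {f : ℝ≥0 × ℕ → ℝ≥0∞} (hf : Measurable f) :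
    ∫⁻ y, f y ∂q.transition t z = ∫⁻ ω, f (jobServerM z t ω) ∂q.law :=
  lintegral_map hf (measurable_jobServerM_outcome z t)

theorem measurable_law_jobServerM_seq (τ : ℕ → ℝ) {B : Set (ℕ → ℝ≥0 × ℕ)} (hB : MeasurableSet B) :
    Measurable fun y => q.law {ω | (fun k => jobServerM y (τ k) ω) ∈ B} :=
  measurable_measure_prodMk_left (measurable_jobServerM_seq τ hB)

/-- The Markov property at a deterministic time, for events that depend on countably many times. -/
theorem law_jobServerM_add (z : ℝ≥0 × ℕ) {t : ℝ} (ht : 0 ≤ t) {τ : ℕ → ℝ} (hτ : ∀ k, 0 ≤ τ k)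
    {B : Set (ℕ → ℝ≥0 × ℕ)} (hB : MeasurableSet B) :
    q.law {ω | (fun k => jobServerM z (t + τ k) ω) ∈ B} =
      ∫⁻ y, q.law {ω | (fun k => jobServerM y (τ k) ω) ∈ B} ∂q.transition t z := by
  have hm := measurable_jobServerM_seq τ
  have hm1 : Measurable fun ω => fun k => jobServerM z (t + τ k) ω :=
    (measurable_jobServerM_seq fun k => t + τ k).comp measurable_prodMk_left
  have hm2 : Measurable fun p : Outcome × Outcome => fun k =>
      jobServerM (jobServerM z t p.1) (τ k) p.2 :=
    hm.comp (((measurable_jobServerM_outcome z t).comp measurable_fst).prodMk measurable_snd)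
  rw [q.lintegral_transition t z (q.measurable_law_jobServerM_seq τ hB)]
  have h1 := Measure.prod_apply (μ := q.law) (ν := q.law) (hm2 hB)
  -- Both sides become probabilities on the same space of pairs (past, future): the left one through
  -- splicing, the right one through restarting. There the two events agree almost surely.
  have h2 := (q.measurePreserving_restartOutcome z.2 t).measure_preimage (hm2 hB).nullMeasurableSet
  have h3 := (q.measurePreserving_spliceOutcome ht).measure_preimage (hm1 hB).nullMeasurableSet
  refine h3.symm.trans (Eq.trans ?_ (h2.trans h1))
  refine measure_congr (Filter.eventuallyEq_set.2 ?_)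
  have g1 := (q.measurePreserving_spliceOutcome ht).quasiMeasurePreserving.ae q.ae_good
  have g2 := (q.measurePreserving_restartOutcome z.2 t).quasiMeasurePreserving.ae
    (measurePreserving_fst.quasiMeasurePreserving.ae q.ae_good)
  have g3 := (q.measurePreserving_restartOutcome z.2 t).quasiMeasurePreserving.ae
    (measurePreserving_snd.quasiMeasurePreserving.ae q.ae_good)
  have g4 : ∀ᵐ p ∂(q.law.prod q.futureLaw), _ :=
    measurePreserving_snd.quasiMeasurePreserving.ae q.ae_pool_pos
  filter_upwards [g1, g2, g3, g4] with p hsp hω hω' hp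
  have key : (fun k => jobServerM z (t + τ k) (spliceOutcome t p)) = fun k =>
      jobServerM (jobServerM z t (restartOutcome z.2 t p).1) (τ k) (restartOutcome z.2 t p).2 := by
    funext k
    rw [← hsp.jobServer_eq z (add_nonneg ht (hτ k)), ← hω.jobServer_eq z ht,
      ← hω'.jobServer_eq _ (hτ k)]
    exact jobServer_splice_add hω z hω' hp hsp ht (hτ k)
  simp only [Set.mem_preimage, key]

/-- The Chapman–Kolmogorov equation. -/
theorem transition_add (z : ℝ≥0 × ℕ) {t s : ℝ} (ht : 0 ≤ t) (hs : 0 ≤ s) {A : Set (ℝ≥0 × ℕ)}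
    (hA : MeasurableSet A) :
    q.transition (t + s) z A = ∫⁻ y, q.transition s y A ∂q.transition t z := by
  simp_rw [q.transition_apply _ _ hA]
  exact q.law_jobServerM_add z ht (τ := fun _ => s) (fun _ => hs)
    (B := (fun f => f 0) ⁻¹' A) (measurable_pi_apply 0 hA)

end MGMM

/-! ### Mean values -/

namespace MGMM

variable (q : MGMM)

theorem lintegral_fst_law {f : (ℕ → ℝ × ℝ) → ℝ≥0∞} (hf : Measurable f) :
    ∫⁻ ω, f ω.1 ∂q.law = ∫⁻ e, f e ∂markedPoisson q.lamC q.workload := by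
  have := q.workload_prob
  have := isProbabilityMeasure_expMeasure q.lamC_pos
  have := isProbabilityMeasure_expMeasure q.lamS_pos
  have := isProbabilityMeasure_expMeasure q.muS_pos
  have h : MeasurePreserving Prod.fst q.law (markedPoisson q.lamC q.workload) :=
    measurePreserving_fst
  exact h.lintegral_comp hf

theorem lintegral_server_law {f : (ℕ → ℝ × ℝ) → ℝ≥0∞} (hf : Measurable f) :
    ∫⁻ ω, f ω.2.1 ∂q.law = ∫⁻ e, f e ∂markedPoisson q.lamS (expMeasure q.muS) := by
  have := q.workload_prob
  have := isProbabilityMeasure_expMeasure q.lamC_pos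
  have := isProbabilityMeasure_expMeasure q.lamS_pos
  have := isProbabilityMeasure_expMeasure q.muS_pos
  have h : MeasurePreserving (fun ω : Outcome => ω.2.1) q.law
      (markedPoisson q.lamS (expMeasure q.muS)) :=
    measurePreserving_fst.comp measurePreserving_snd
  exact h.lintegral_comp hf

theorem lintegral_init_law {f : (ℕ → ℝ) → ℝ≥0∞} (hf : Measurable f) :
    ∫⁻ ω, f ω.2.2 ∂q.law = ∫⁻ r, f r ∂(Measure.infinitePi fun _ : ℕ => expMeasure q.muS) := by
  have := q.workload_prob
  have := isProbabilityMeasure_expMeasure q.lamC_pos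
  have := isProbabilityMeasure_expMeasure q.lamS_pos
  have := isProbabilityMeasure_expMeasure q.muS_pos
  have h : MeasurePreserving (fun ω : Outcome => ω.2.2) q.law
      (Measure.infinitePi fun _ : ℕ => expMeasure q.muS) :=
    measurePreserving_snd.comp measurePreserving_snd
  exact h.lintegral_comp hf

theorem lintegral_arrivedWorkE_le (t : ℝ) :
    ∫⁻ ω, arrivedWorkE t ω.1 ∂q.law ≤ ENNReal.ofReal (q.rhoC * t) := by
  have := q.workload_prob
  rw [q.lintegral_fst_law (f := arrivedWorkE t)
    (measurable_arrivedWorkE.comp measurable_prodMk_left)]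
  have hg : Measurable fun p : ℝ × ℝ => if p.1 ≤ t then ENNReal.ofReal p.2 else 0 :=
    Measurable.ite (measurableSet_le (by fun_prop) (by fun_prop)) (by fun_prop) (by fun_prop)
  refine (lintegral_tsum_marks_le (κ := q.workload) q.lamC_pos hg).trans (le_of_eq ?_)
  have hmean : ∫⁻ w, ENNReal.ofReal w ∂q.workload = ENNReal.ofReal (1 / q.muC) := by
    rw [← q.workload_mean, ofReal_integral_eq_lintegral_ofReal q.workload_integrable
      q.workload_nonneg]
  have h1 : ∀ v : ℝ, ∫⁻ w, (if v ≤ t then ENNReal.ofReal w else 0) ∂q.workload =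
      (Set.Iic t).indicator (fun _ => ENNReal.ofReal (1 / q.muC)) v := by
    intro v
    by_cases hv : v ≤ t
    · simp only [hv, if_true]
      rw [hmean, Set.indicator_of_mem (by exact hv)]
    · simp only [hv, if_false]
      rw [lintegral_zero, Set.indicator_of_notMem (by exact hv)]
  simp_rw [h1]
  have hmu := q.muC_pos
  rw [lintegral_indicator measurableSet_Iic, setLIntegral_const,
    Measure.restrict_apply measurableSet_Iic, Set.Iic_inter_Ici, Real.volume_Icc, sub_zero,
    ← ENNReal.ofReal_mul (by positivity), ← ENNReal.ofReal_mul q.lamC_pos.le, rhoC]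
  congr 1
  ring

theorem measurable_natCast_newServers :
    Measurable fun p : ℝ × (ℕ → ℝ × ℝ) => (newServers p.1 p.2 : ℝ≥0∞) :=
  (Measurable.of_discrete (f := fun n : ℕ => (n : ℝ≥0∞))).comp measurable_newServers

theorem measurable_natCast_newServers_right (t : ℝ) :
    Measurable fun e : ℕ → ℝ × ℝ => (newServers t e : ℝ≥0∞) :=
  measurable_natCast_newServers.comp (f := fun e : ℕ → ℝ × ℝ => (t, e)) (by fun_prop)

theorem newServers_eq_tsum {t : ℝ} {e : ℕ → ℝ × ℝ} (he : ∀ k, 0 < (e k).1)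
    (hu : ∃ k, t < arrivalTime e k) :
    (newServers t e : ℝ≥0∞) =
      ∑' j, if arrivalTime e j ≤ t ∧ t < arrivalTime e j + (e j).2 then 1 else 0 := by
  have hm := arrivedBy_numArrivals hu
  rw [newServers_eq he hm le_rfl, Finset.card_filter, tsum_eq_sum (s := Finset.range _)]
  · push_cast
    rfl
  · intro j hj
    refine if_neg fun h => ?_
    have := (strictMono_arrivalTime he).monotone (by simpa using hj)
    linarith [hm.2, h.1]

/-- Campbell's formula: a server that arrives at `v ≤ t` is still present with probability `e^{-μ_s
(t - v)}`, and integrating this against `λ_s dv` gives the value. -/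
theorem lintegral_newServers {t : ℝ} (ht : 0 ≤ t) :
    ∫⁻ ω, (newServers t ω.2.1 : ℝ≥0∞) ∂q.law =
      ENNReal.ofReal (q.rhoS * (1 - Real.exp (-(q.muS * t)))) := by
  have hmu := q.muS_pos
  have := isProbabilityMeasure_expMeasure q.muS_pos
  rw [q.lintegral_server_law (measurable_natCast_newServers_right t)]
  have hg : Measurable fun p : ℝ × ℝ => if p.1 ≤ t ∧ t < p.1 + p.2 then (1 : ℝ≥0∞) else 0 := by
    have h1 : MeasurableSet {p : ℝ × ℝ | p.1 ≤ t} :=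
      measurableSet_le (by fun_prop) (by fun_prop)
    have h2 : MeasurableSet {p : ℝ × ℝ | t < p.1 + p.2} :=
      measurableSet_lt (by fun_prop) (by fun_prop)
    exact Measurable.ite (h1.inter h2) (by fun_prop) (by fun_prop)
  have h1 : ∀ v ∈ Set.Ici (0 : ℝ), ∫⁻ w, (if v ≤ t ∧ t < v + w then (1 : ℝ≥0∞) else 0)
      ∂expMeasure q.muS =
      (Set.Iic t).indicator (fun v => ENNReal.ofReal (Real.exp (-(q.muS * (t - v))))) v := by
    intro v _
    by_cases hv : v ≤ t
    · rw [Set.indicator_of_mem (by exact hv), ← expMeasure_Ioi hmu (sub_nonneg.2 hv),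
        ← lintegral_indicator_one measurableSet_Ioi]
      refine lintegral_congr fun w => ?_
      by_cases hw : t - v < w
      · rw [Set.indicator_of_mem (by exact hw), if_pos ⟨hv, by linarith⟩]; rfl
      · rw [Set.indicator_of_notMem (by exact hw), if_neg fun h => hw (by linarith [h.2])]
    · simp only [hv, false_and, if_false]
      rw [lintegral_zero, Set.indicator_of_notMem (by exact hv)]
  have h2 : ∫⁻ v in Set.Ici 0, ∫⁻ w, (if v ≤ t ∧ t < v + w then (1 : ℝ≥0∞) else 0)
      ∂expMeasure q.muS = ENNReal.ofReal ((1 - Real.exp (-(q.muS * t))) / q.muS) := by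
    rw [setLIntegral_congr_fun measurableSet_Ici h1, lintegral_indicator measurableSet_Iic,
      Measure.restrict_restrict measurableSet_Iic, Set.Iic_inter_Ici,
      ← ofReal_integral_eq_lintegral_ofReal]
    · congr 1
      rw [integral_Icc_eq_integral_Ioc, ← intervalIntegral.integral_of_le ht]
      have h3 : ∀ v ∈ Set.uIcc 0 t, HasDerivAt
          (fun v => Real.exp (-(q.muS * (t - v))) / q.muS)
          (Real.exp (-(q.muS * (t - v)))) v := by
        intro v _
        have h4 : HasDerivAt (fun v : ℝ => -(q.muS * (t - v))) q.muS v := by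
          simpa using ((hasDerivAt_id v).const_sub t).const_mul (-q.muS)
        have := (h4.exp).div_const q.muS
        rwa [mul_div_assoc, div_self hmu.ne', mul_one] at this
      rw [intervalIntegral.integral_eq_sub_of_hasDerivAt h3
        (by apply Continuous.intervalIntegrable; fun_prop)]
      simp
      ring
    · exact (by fun_prop : Continuous fun v : ℝ =>
        Real.exp (-(q.muS * (t - v)))).integrableOn_Icc
    · exact Filter.Eventually.of_forall fun v => (Real.exp_pos _).le
  have h3 : ∫⁻ e, (newServers t e : ℝ≥0∞) ∂markedPoisson q.lamS (expMeasure q.muS) =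
      ∫⁻ e, ∑' j, (if arrivalTime e j ≤ t ∧ t < arrivalTime e j + (e j).2 then 1 else 0)
        ∂markedPoisson q.lamS (expMeasure q.muS) := by
    refine lintegral_congr_ae ?_
    filter_upwards [ae_forall_interarrival_pos q.lamS_pos,
      ae_forall_exists_lt_arrivalTime q.lamS_pos] with e he hu
    exact newServers_eq_tsum he (hu t)
  rw [h3, lintegral_tsum_marks (κ := expMeasure q.muS) q.lamS_pos hg (c := t)
    (fun v w hv => if_neg fun h => absurd h.1 (not_le.2 hv)) (by rw [h2]; simp), h2,
    ← ENNReal.ofReal_mul q.lamS_pos.le, rhoS]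
  congr 1
  ring

theorem lintegral_oldServers (n : ℕ) {t : ℝ} (ht : 0 ≤ t) :
    ∫⁻ ω, (oldServers n t ω.2.2 : ℝ≥0∞) ∂q.law =
      n * ENNReal.ofReal (Real.exp (-(q.muS * t))) := by
  have := isProbabilityMeasure_expMeasure q.muS_pos
  have h0 : Measurable fun r : ℕ → ℝ => (oldServers n t r : ℝ≥0∞) :=
    (Measurable.of_discrete (f := fun n : ℕ => (n : ℝ≥0∞))).comp
      ((measurable_oldServers n).comp measurable_prodMk_left)
  rw [q.lintegral_init_law h0]
  have h1 : ∀ r : ℕ → ℝ, (oldServers n t r : ℝ≥0∞) =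
      ∑ i ∈ Finset.range n, (Set.Ioi t).indicator 1 (r i) := by
    intro r
    rw [oldServers_eq, Finset.card_filter]
    push_cast
    exact Finset.sum_congr rfl fun i _ => rfl
  simp_rw [h1]
  have h2 : Measurable ((Set.Ioi t).indicator (1 : ℝ → ℝ≥0∞)) :=
    measurable_one.indicator measurableSet_Ioi
  have h2' : ∀ i ∈ Finset.range n, Measurable fun r : ℕ → ℝ => (Set.Ioi t).indicator
      (1 : ℝ → ℝ≥0∞) (r i) := fun i _ => h2.comp (measurable_pi_apply i)
  rw [lintegral_finsetSum _ h2']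
  have h3 : ∀ i : ℕ, ∫⁻ r : ℕ → ℝ, (Set.Ioi t).indicator 1 (r i)
      ∂(Measure.infinitePi fun _ : ℕ => expMeasure q.muS) =
      ENNReal.ofReal (Real.exp (-(q.muS * t))) := by
    intro i
    rw [(measurePreserving_eval_infinitePi (fun _ : ℕ => expMeasure q.muS) i).lintegral_comp h2,
      lintegral_indicator_one measurableSet_Ioi, expMeasure_Ioi q.muS_pos ht]
  simp_rw [h3]
  simp

/-- The work that the servers arrived in `[0, t]` can do in `[0, t]`. -/
noncomputable def capacity (t : ℝ) (e : ℕ → ℝ × ℝ) : ℝ≥0∞ :=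
  ∫⁻ u in Set.Ioc 0 t, (newServers u e : ℝ≥0∞)

theorem measurable_capacity (t : ℝ) : Measurable (capacity t) := by
  have : Measurable fun p : (ℕ → ℝ × ℝ) × ℝ => (newServers p.2 p.1 : ℝ≥0∞) :=
    measurable_natCast_newServers.comp (f := fun p : (ℕ → ℝ × ℝ) × ℝ => (p.2, p.1)) (by fun_prop)
  unfold capacity
  exact this.lintegral_prod_right' (ν := volume.restrict (Set.Ioc 0 t))

theorem Good.ofReal_integral_newServers {ω : Outcome} (hω : Good ω) {t : ℝ} (ht : 0 ≤ t) :
    ENNReal.ofReal (∫ u in (0 : ℝ)..t, (newServers u ω.2.1 : ℝ)) = capacity t ω.2.1 := by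
  rw [intervalIntegral.integral_of_le ht, ofReal_integral_eq_lintegral_ofReal
    ((intervalIntegrable_iff_integrableOn_Ioc_of_le ht).1 (hω.intervalIntegrable_newServers ht))
    (Filter.Eventually.of_forall fun u => Nat.cast_nonneg _)]
  simp [capacity]

/-- By Tonelli this integrates `ρ_s (1 - e^{-μ_s u})` over `(0, t]`; only a positive exponential
term is discarded, so the loss from starting without servers stays bounded in `t`. -/
theorem lintegral_capacity_ge {t : ℝ} (ht : 0 ≤ t) :
    ENNReal.ofReal (q.rhoS * t - q.rhoS / q.muS) ≤ ∫⁻ ω, capacity t ω.2.1 ∂q.law := by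
  have hmu := q.muS_pos
  have hla := q.lamS_pos
  have hrho : 0 < q.rhoS := div_pos hla hmu
  have h1 : Measurable fun p : Outcome × ℝ => (newServers p.2 p.1.2.1 : ℝ≥0∞) :=
    measurable_natCast_newServers.comp (f := fun p : Outcome × ℝ => (p.2, p.1.2.1)) (by fun_prop)
  simp only [capacity]
  rw [lintegral_lintegral_swap h1.aemeasurable, setLIntegral_congr_fun measurableSet_Ioc
    (fun u hu => q.lintegral_newServers (Set.mem_Ioc.1 hu).1.le),
    ← ofReal_integral_eq_lintegral_ofReal]
  · refine ENNReal.ofReal_le_ofReal ?_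
    rw [← intervalIntegral.integral_of_le ht]
    have h3 : ∀ v ∈ Set.uIcc 0 t, HasDerivAt
        (fun v => q.rhoS * (v + Real.exp (-(q.muS * v)) / q.muS))
        (q.rhoS * (1 - Real.exp (-(q.muS * v)))) v := by
      intro v _
      have h4 : HasDerivAt (fun v : ℝ => -(q.muS * v)) (-q.muS) v := by
        simpa using (hasDerivAt_id v).const_mul (-q.muS)
      have h5 := (h4.exp).div_const q.muS
      rw [mul_div_assoc, neg_div, div_self hmu.ne', mul_neg, mul_one] at h5
      exact ((hasDerivAt_id v).add h5).const_mul q.rhoS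
    rw [intervalIntegral.integral_eq_sub_of_hasDerivAt h3
      (by apply Continuous.intervalIntegrable; fun_prop)]
    have h6 : 0 ≤ q.rhoS * (Real.exp (-(q.muS * t)) / q.muS) := by positivity
    simp only [mul_zero, neg_zero, Real.exp_zero, zero_add]
    have h7 : q.rhoS * (1 / q.muS) = q.rhoS / q.muS := by ring
    rw [h7, mul_add]
    linarith
  · exact ((by fun_prop : Continuous fun v : ℝ =>
        q.rhoS * (1 - Real.exp (-(q.muS * v)))).integrableOn_Icc).mono_set Set.Ioc_subset_Icc_self
  · filter_upwards [ae_restrict_mem measurableSet_Ioc] with u hu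
    refine mul_nonneg hrho.le (sub_nonneg.2 ?_)
    rw [Real.exp_le_one_iff]
    have := hu.1
    simp only [Left.neg_nonpos_iff]
    positivity

/-- The pathwise bound `Good.work_le` combined with `(x - B)⁺ + min B x = x`; moving the cleared
work to the left avoids truncated subtraction. -/
theorem lintegral_work_add_le (z : ℝ≥0 × ℕ) {t : ℝ} (ht : 0 ≤ t) :
    ∫⁻ y, (y.1 : ℝ≥0∞) ∂q.transition t z + ∫⁻ ω, min (capacity t ω.2.1) z.1 ∂q.law ≤
      ENNReal.ofReal (q.rhoC * t) + z.1 := by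
  have hcap : Measurable fun ω : Outcome => min (capacity t ω.2.1) (z.1 : ℝ≥0∞) :=
    ((measurable_capacity t).comp (by fun_prop : Measurable fun ω : Outcome => ω.2.1)).min
      measurable_const
  rw [q.lintegral_transition t z (by fun_prop), ← lintegral_add_right _ hcap]
  have h1 : ∫⁻ ω, ((jobServerM z t ω).1 + min (capacity t ω.2.1) (z.1 : ℝ≥0∞)) ∂q.law ≤
      ∫⁻ ω, (arrivedWorkE t ω.1 + z.1) ∂q.law := by
    refine lintegral_mono_ae ?_
    filter_upwards [q.ae_good] with ω hω
    rw [← hω.jobServer_eq z ht, ← hω.ofReal_integral_newServers ht]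
    have h2 := hω.work_le z.1 z.2 ht
    set B := ∫ u in (0 : ℝ)..t, (newServers u ω.2.1 : ℝ)
    have hB : 0 ≤ B := intervalIntegral.integral_nonneg ht fun u _ => Nat.cast_nonneg _
    rw [hω.arrivedWork_eq_toReal] at h2
    change ((work z.1 z.2 t ω : ℝ≥0) : ℝ≥0∞) + _ ≤ _
    rw [← ENNReal.ofReal_coe_nnreal, ← ENNReal.ofReal_coe_nnreal (p := z.1),
      ← ENNReal.ofReal_min, ← ENNReal.ofReal_add (NNReal.coe_nonneg _)
      (le_min hB (NNReal.coe_nonneg _))]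
    refine le_trans (ENNReal.ofReal_le_ofReal (q := (arrivedWorkE t ω.1).toReal + z.1) ?_) ?_
    · rcases le_total B z.1 with h | h
      · rw [min_eq_left h]; rw [max_eq_right (by linarith)] at h2; linarith
      · rw [min_eq_right h]; rw [max_eq_left (by linarith)] at h2; linarith
    · refine ENNReal.ofReal_add_le.trans ?_
      gcongr
      exact ENNReal.ofReal_toReal_le
  refine h1.trans ?_
  rw [lintegral_add_right _ measurable_const, lintegral_const, measure_univ, mul_one]
  gcongr
  exact q.lintegral_arrivedWorkE_le t

theorem lintegral_numServers_le (z : ℝ≥0 × ℕ) {t : ℝ} (ht : 0 ≤ t) :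
    ∫⁻ y, (y.2 : ℝ≥0∞) ∂q.transition t z ≤
      z.2 * ENNReal.ofReal (Real.exp (-(q.muS * t))) + ENNReal.ofReal q.rhoS := by
  have hrho : 0 < q.rhoS := div_pos q.lamS_pos q.muS_pos
  have h0 : Measurable fun y : ℝ≥0 × ℕ => (y.2 : ℝ≥0∞) :=
    (Measurable.of_discrete (f := fun n : ℕ => (n : ℝ≥0∞))).comp measurable_snd
  rw [q.lintegral_transition t z h0,
    ← q.lintegral_oldServers z.2 ht]
  have h1 : ∀ ω : Outcome, ((jobServerM z t ω).2 : ℝ≥0∞) =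
      oldServers z.2 t ω.2.2 + newServers t ω.2.1 := fun ω => by
    change ((numServers z.2 t ω : ℕ) : ℝ≥0∞) = _
    rw [numServers_eq]; push_cast; rfl
  simp_rw [h1]
  have h2 : Measurable fun ω : Outcome => (newServers t ω.2.1 : ℝ≥0∞) :=
    (measurable_natCast_newServers_right t).comp (by fun_prop)
  rw [lintegral_add_right _ h2, q.lintegral_newServers ht]
  gcongr
  have := Real.exp_pos (-(q.muS * t))
  nlinarith

end MGMM

/-! ### Drift and accessibility -/

namespace MGMM

variable (q : MGMM)

/-- The Lyapunov function. -/
noncomputable def potential (c : ℝ) (z : ℝ≥0 × ℕ) : ℝ≥0∞ := z.1 + ENNReal.ofReal c * z.2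

theorem measurable_potential (c : ℝ) : Measurable (potential c) := by
  have h0 : Measurable fun y : ℝ≥0 × ℕ => (y.2 : ℝ≥0∞) :=
    (Measurable.of_discrete (f := fun n : ℕ => (n : ℝ≥0∞))).comp measurable_snd
  unfold potential
  fun_prop

theorem potential_ne_top (c : ℝ) (z : ℝ≥0 × ℕ) : potential c z ≠ ∞ := by
  unfold potential
  finiteness

/-- Only the capacity up to `x` can be spent on the initial work. Its mean increases to the full
mean capacity, so a surplus over the demand survives for all large `x`. -/
theorem exists_mean_capacity_gt (h : q.rhoC < q.rhoS) :
    ∃ t : ℝ, 0 < t ∧ ∃ K : ℝ≥0, ∀ x : ℝ≥0, K ≤ x →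
      ENNReal.ofReal (q.rhoC * t) + 1 ≤ ∫⁻ ω, min (capacity t ω.2.1) x ∂q.law := by
  have hrho : 0 < q.rhoS := div_pos q.lamS_pos q.muS_pos
  have hrc : 0 < q.rhoC := div_pos q.lamC_pos q.muC_pos
  have hd : 0 < q.rhoS - q.rhoC := sub_pos.2 h
  have hmu := q.muS_pos
  -- Chosen so that `(ρ_s - ρ_c) t` covers the start-up loss `ρ_s / μ_s` with `2` to spare: `1` for
  -- the drift, the rest for strictness.
  set t := (q.rhoS / q.muS + 2) / (q.rhoS - q.rhoC) with ht
  have ht0 : 0 < t := by positivity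
  have h1 : q.rhoC * t + 1 < q.rhoS * t - q.rhoS / q.muS := by
    have : (q.rhoS - q.rhoC) * t = q.rhoS / q.muS + 2 := by rw [ht]; field_simp
    linarith
  have h2 : ENNReal.ofReal (q.rhoC * t) + 1 < ∫⁻ ω, capacity t ω.2.1 ∂q.law := by
    refine lt_of_lt_of_le ?_ (q.lintegral_capacity_ge ht0.le)
    rw [← ENNReal.ofReal_one, ← ENNReal.ofReal_add (by positivity) zero_le_one]
    exact (ENNReal.ofReal_lt_ofReal_iff (by nlinarith)).2 h1
  have hcap : Measurable fun ω : Outcome => capacity t ω.2.1 :=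
    (measurable_capacity t).comp (by fun_prop : Measurable fun ω : Outcome => ω.2.1)
  have h3 : ∫⁻ ω, capacity t ω.2.1 ∂q.law =
      ⨆ k : ℕ, ∫⁻ ω, min (capacity t ω.2.1) (k : ℝ≥0∞) ∂q.law := by
    rw [← lintegral_iSup (fun k => hcap.min measurable_const)]
    · refine lintegral_congr fun ω => ?_
      rw [← inf_iSup_eq (capacity t ω.2.1), ENNReal.iSup_natCast, inf_top_eq]
    · intro k l hkl ω
      exact min_le_min le_rfl (by exact_mod_cast hkl)
  rw [h3] at h2
  obtain ⟨k, hk⟩ := lt_iSup_iff.1 h2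
  refine ⟨t, ht0, k, fun x hx => hk.le.trans (lintegral_mono fun ω => min_le_min le_rfl ?_)⟩
  have := ENNReal.coe_le_coe.2 hx
  rwa [ENNReal.coe_natCast] at this

/-- The Foster–Lyapunov drift condition for the process observed at multiples of `t`. -/
theorem exists_drift (h : q.rhoC < q.rhoS) :
    ∃ t : ℝ, 0 < t ∧ ∃ c b : ℝ, ∃ K : ℝ≥0, ∃ N : ℕ, ∀ z : ℝ≥0 × ℕ,
      ∫⁻ y, potential c y ∂q.transition t z + 1 / 2 ≤
        potential c z + if z.1 ≤ K ∧ z.2 ≤ N then ENNReal.ofReal b else 0 := by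
  obtain ⟨t, ht, K, hK⟩ := q.exists_mean_capacity_gt h
  have hrho : 0 < q.rhoS := div_pos q.lamS_pos q.muS_pos
  have hrc : 0 < q.rhoC := div_pos q.lamC_pos q.muC_pos
  have hmu := q.muS_pos
  set ε := 1 - Real.exp (-(q.muS * t)) with hε
  have hε0 : 0 < ε := by
    rw [hε, sub_pos, Real.exp_lt_one_iff]
    have := mul_pos hmu ht
    linarith
  have hexp : Real.exp (-(q.muS * t)) = 1 - ε := by rw [hε]; ring
  -- With this weight new servers raise the potential by at most `c ρ_s = 1/2`, half of the unit
  -- decrease available when the work is large.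
  set c := 1 / (2 * q.rhoS) with hc
  have hc0 : 0 < c := by positivity
  have hcr : c * q.rhoS = 1 / 2 := by rw [hc]; field_simp
  -- When the work is small it may grow by `ρ_c t` on average; beyond `N` servers the mean loss `c ε
  -- n` from departures pays for this and for the required decrease.
  obtain ⟨N, hN⟩ := exists_nat_gt ((q.rhoC * t + 1) / (c * ε))
  rw [div_lt_iff₀ (by positivity)] at hN
  refine ⟨t, ht, c, q.rhoC * t + 1, K, N, fun z => ?_⟩
  obtain ⟨x, n⟩ := z
  have hw := q.lintegral_work_add_le (x, n) ht.le
  have hn := q.lintegral_numServers_le (x, n) ht.le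
  have hV : ∫⁻ y, potential c y ∂q.transition t (x, n) =
      ∫⁻ y, (y.1 : ℝ≥0∞) ∂q.transition t (x, n) +
        ENNReal.ofReal c * ∫⁻ y, (y.2 : ℝ≥0∞) ∂q.transition t (x, n) := by
    have h0 : Measurable fun y : ℝ≥0 × ℕ => (y.2 : ℝ≥0∞) :=
      (Measurable.of_discrete (f := fun n : ℕ => (n : ℝ≥0∞))).comp measurable_snd
    simp only [potential]
    rw [lintegral_add_left (by fun_prop), lintegral_const_mul _ h0]
  have hhalf : (1 / 2 : ℝ≥0∞) = ENNReal.ofReal (1 / 2) := by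
    rw [ENNReal.ofReal_div_of_pos two_pos]; simp
  have hn0 : (0 : ℝ) ≤ n := Nat.cast_nonneg n
  have hexp0 := Real.exp_pos (-(q.muS * t))
  have hcn : ENNReal.ofReal c * ∫⁻ y, (y.2 : ℝ≥0∞) ∂q.transition t (x, n) ≤
      ENNReal.ofReal (c * n * (1 - ε) + 1 / 2) := by
    refine (mul_le_mul_right hn _).trans (le_of_eq ?_)
    rw [← ENNReal.ofReal_natCast, ← ENNReal.ofReal_mul (by positivity),
      ← ENNReal.ofReal_add (by positivity) hrho.le, ← ENNReal.ofReal_mul hc0.le, hexp, ← hcr]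
    congr 1
    ring
  have hpot : potential c (x, n) = ENNReal.ofReal (x + c * n) := by
    simp only [potential]
    rw [ENNReal.ofReal_add (NNReal.coe_nonneg _) (by positivity), ENNReal.ofReal_mul hc0.le,
      ENNReal.ofReal_natCast, ENNReal.ofReal_coe_nnreal]
  have hx0 : (0 : ℝ) ≤ x := NNReal.coe_nonneg x
  have h1ε : 0 < 1 - ε := by rw [← hexp]; exact hexp0
  by_cases hxK : x ≤ K
  · have hw' : ∫⁻ y, (y.1 : ℝ≥0∞) ∂q.transition t (x, n) ≤ ENNReal.ofReal (q.rhoC * t + x) := by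
      rw [ENNReal.ofReal_add (by positivity) hx0, ENNReal.ofReal_coe_nnreal]
      exact le_self_add.trans hw
    have hsum : ∫⁻ y, potential c y ∂q.transition t (x, n) + 1 / 2 ≤
        ENNReal.ofReal (q.rhoC * t + x + (c * n * (1 - ε) + 1 / 2) + 1 / 2) := by
      rw [hV, hhalf, ENNReal.ofReal_add (by positivity) (by norm_num),
        ENNReal.ofReal_add (by positivity) (by positivity)]
      gcongr
    refine hsum.trans ?_
    by_cases hnN : n ≤ N
    · rw [if_pos ⟨hxK, hnN⟩, hpot, ← ENNReal.ofReal_add (by positivity) (by positivity)]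
      refine ENNReal.ofReal_le_ofReal ?_
      have : 0 ≤ c * n * ε := by positivity
      nlinarith
    · rw [if_neg fun h => hnN h.2, hpot, add_zero]
      refine ENNReal.ofReal_le_ofReal ?_
      have h3 : (N : ℝ) ≤ n := by exact_mod_cast (not_le.1 hnN).le
      have h4 : (N : ℝ) * (c * ε) ≤ n * (c * ε) := by gcongr
      nlinarith
  · have h5 := hK x (not_le.1 hxK).le
    have h6 : ∫⁻ y, (y.1 : ℝ≥0∞) ∂q.transition t (x, n) + 1 ≤ x := by
      have h7 := (add_le_add_right h5 _).trans hw
      rw [add_left_comm] at h7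
      exact (ENNReal.add_le_add_iff_left ENNReal.ofReal_ne_top).1 h7
    rw [if_neg fun h => hxK h.1, add_zero, hV]
    simp only [potential]
    have h8 : ENNReal.ofReal (c * n * (1 - ε) + 1 / 2) ≤ ENNReal.ofReal c * n + 1 / 2 := by
      rw [hhalf, ← ENNReal.ofReal_natCast, ← ENNReal.ofReal_mul hc0.le,
        ← ENNReal.ofReal_add (by positivity) (by norm_num)]
      refine ENNReal.ofReal_le_ofReal ?_
      have : 0 ≤ c * n * ε := by positivity
      nlinarith
    calc _ ≤ ∫⁻ y, (y.1 : ℝ≥0∞) ∂q.transition t (x, n) + (ENNReal.ofReal c * n + 1 / 2) + 1 / 2 := by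
          gcongr; exact hcn.trans h8
      _ = (∫⁻ y, (y.1 : ℝ≥0∞) ∂q.transition t (x, n) + (1 / 2 + 1 / 2)) + ENNReal.ofReal c * n := by
          ring
      _ ≤ _ := by
          rw [ENNReal.add_halves]
          gcongr

/-- On this event all the work is cleared at time `t` and exactly `j` servers are left. -/
def clearEvent (t : ℝ) (M j N : ℕ) : Set Outcome :=
  ((({0} : Finset ℕ) : Set ℕ).pi fun _ => Set.Ioo t (2 * t) ×ˢ Set.univ) ×ˢ
    (((Finset.range (M + j + 1) : Set ℕ).pi fun k =>
      -- The first `M + j` servers all arrive by `t / 4`. The first `M` work throughout `[t / 4, t /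
      -- 2]`, clearing `M t / 4`, and leave before `t`; the next `j` are still present at `t`, and
      -- the one after them arrives later than `t`.
      if k < M then Set.Ioo 0 (t / (4 * (M + j + 1))) ×ˢ Set.Ioo (t / 2) (3 / 4 * t)
      else if k < M + j then Set.Ioo 0 (t / (4 * (M + j + 1))) ×ˢ Set.Ioo t (2 * t)
      else Set.Ioo t (2 * t) ×ˢ Set.univ) ×ˢ
    ((Finset.range N : Set ℕ).pi fun _ => Set.Ioo 0 t))

theorem law_clearEvent_pos {t : ℝ} (ht : 0 < t) (M j N : ℕ) : 0 < q.law (clearEvent t M j N) := by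
  have := q.workload_prob
  have := isProbabilityMeasure_expMeasure q.lamC_pos
  have := isProbabilityMeasure_expMeasure q.lamS_pos
  have := isProbabilityMeasure_expMeasure q.muS_pos
  have hδ : 0 < t / (4 * ((M : ℝ) + j + 1)) := by positivity
  unfold clearEvent law
  rw [Measure.prod_prod, Measure.prod_prod]
  have hpos : ∀ {X : Type} [MeasurableSpace X] (μ : Measure X) [IsProbabilityMeasure μ]
      (s : Finset ℕ) (A : ℕ → Set X), (∀ k ∈ s, MeasurableSet (A k)) → (∀ k ∈ s, 0 < μ (A k)) →
      0 < Measure.infinitePi (fun _ : ℕ => μ) ((s : Set ℕ).pi A) := by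
    intro X _ μ _ s A hA hs
    rw [Measure.infinitePi_pi _ hA, pos_iff_ne_zero, Finset.prod_ne_zero_iff]
    exact fun k hk => (hs k hk).ne'
  refine ENNReal.mul_pos (hpos _ _ _ ?_ ?_).ne'
    (ENNReal.mul_pos (hpos _ _ _ ?_ ?_).ne' (hpos _ _ _ ?_ ?_).ne').ne'
  · exact fun k _ => measurableSet_Ioo.prod MeasurableSet.univ
  · intro k _
    rw [Measure.prod_prod, measure_univ, mul_one]
    exact expMeasure_Ioo_pos q.lamC_pos ht.le (by linarith)
  · intro k _
    split_ifs
    · exact measurableSet_Ioo.prod measurableSet_Ioo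
    · exact measurableSet_Ioo.prod measurableSet_Ioo
    · exact measurableSet_Ioo.prod MeasurableSet.univ
  · intro k _
    split_ifs
    · rw [Measure.prod_prod]
      exact ENNReal.mul_pos (expMeasure_Ioo_pos q.lamS_pos le_rfl hδ).ne'
        (expMeasure_Ioo_pos q.muS_pos (by linarith) (by linarith)).ne'
    · rw [Measure.prod_prod]
      exact ENNReal.mul_pos (expMeasure_Ioo_pos q.lamS_pos le_rfl hδ).ne'
        (expMeasure_Ioo_pos q.muS_pos ht.le (by linarith)).ne'
    · rw [Measure.prod_prod, measure_univ, mul_one]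
      exact expMeasure_Ioo_pos q.lamS_pos ht.le (by linarith)
  · exact fun k _ => measurableSet_Ioo
  · exact fun k _ => expMeasure_Ioo_pos q.muS_pos le_rfl ht

theorem Good.jobServer_clearEvent {ω : Outcome} (hω : Good ω) {t : ℝ} (ht : 0 < t) {M j N : ℕ}
    (hE : ω ∈ clearEvent t M j N) {z : ℝ≥0 × ℕ} (hx : (z.1 : ℝ) ≤ M * (t / 4)) (hn : z.2 ≤ N) :
    jobServer z t ω = (0, j) := by
  obtain ⟨hjob, hserv, hinit⟩ := hE
  have hden : (0 : ℝ) < 4 * ((M : ℝ) + j + 1) := by positivity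
  have hjob0 : t < (ω.1 0).1 := (hjob 0 (by simp)).1.1
  have harr0 : ArrivedBy 0 t ω.1 := ⟨by simp, by simpa using hjob0⟩
  have hbd : ∀ k < M + j, (ω.2.1 k).1 ≤ t / (4 * (M + j + 1)) := by
    intro k hk
    have := hserv k (by simp; omega)
    simp only [hk, if_true] at this
    split_ifs at this
    · exact this.1.2.le
    · exact this.1.2.le
  have hT : ∀ k < M + j, arrivalTime ω.2.1 k ≤ t / 4 := by
    intro k hk
    have h1 : arrivalTime ω.2.1 k ≤ ∑ _i ∈ Finset.range (k + 1), t / (4 * ((M : ℝ) + j + 1)) :=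
      Finset.sum_le_sum fun i hi => hbd i (by simp at hi; omega)
    rw [Finset.sum_const, Finset.card_range, nsmul_eq_mul] at h1
    refine h1.trans ?_
    have h2 : ((k + 1 : ℕ) : ℝ) ≤ M + j + 1 := by exact_mod_cast (by omega : k + 1 ≤ M + j + 1)
    rw [← mul_div_assoc, div_le_iff₀ hden]
    nlinarith
  have hlast : t < arrivalTime ω.2.1 (M + j) := by
    have h1 := hserv (M + j) (by simp)
    have h2 : ¬ M + j < M := by omega
    simp only [lt_irrefl, if_false, h2] at h1
    refine h1.1.1.trans_le ?_
    exact Finset.single_le_sum (f := fun i => (ω.2.1 i).1) (fun i _ => (hω.server_pos i).le)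
      (by simp)
  have harr : ArrivedBy (M + j) t ω.2.1 := ⟨fun k hk => (hT k hk).trans (by linarith), hlast⟩
  have hL1 : ∀ k < M, t / 2 < (ω.2.1 k).2 ∧ (ω.2.1 k).2 < 3 / 4 * t := by
    intro k hk
    have := hserv k (by simp; omega)
    simp only [hk, if_true] at this
    exact this.2
  have hL2 : ∀ k, M ≤ k → k < M + j → t < (ω.2.1 k).2 := by
    intro k hk hk'
    have := hserv k (by simp; omega)
    simp only [hk', if_true, not_lt.2 hk, if_false] at this
    exact this.2.1
  have hcap : M * (t / 4) ≤ ∫ u in (0 : ℝ)..t, (newServers u ω.2.1 : ℝ) := by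
    have h1 : ∀ u ∈ Set.Icc (t / 4) (t / 2), (M : ℝ) ≤ newServers u ω.2.1 := by
      intro u hu
      rw [newServers_eq hω.server_pos harr (by linarith [hu.2])]
      have : Finset.range M ⊆ (Finset.range (M + j)).filter fun j =>
          arrivalTime ω.2.1 j ≤ u ∧ u < arrivalTime ω.2.1 j + (ω.2.1 j).2 := by
        intro k hk
        have hk' := Finset.mem_range.1 hk
        simp only [Finset.mem_filter, Finset.mem_range]
        refine ⟨by omega, (hT k (by omega)).trans hu.1, ?_⟩
        have := arrivalTime_pos hω.server_pos k
        linarith [(hL1 k hk').1, hu.2]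
      have := Finset.card_le_card this
      rw [Finset.card_range] at this
      exact_mod_cast this
    calc (M : ℝ) * (t / 4) = ∫ _u in (t / 4)..(t / 2), (M : ℝ) := by
          rw [intervalIntegral.integral_const, smul_eq_mul]; ring
      _ ≤ ∫ u in (t / 4)..(t / 2), (newServers u ω.2.1 : ℝ) :=
          intervalIntegral.integral_mono_on (by linarith) (by simp)
            (hω.intervalIntegrable_newServers (by linarith)) h1
      _ ≤ _ := intervalIntegral.integral_mono_interval (by linarith) (by linarith) (by linarith)
          (Filter.Eventually.of_forall fun u => Nat.cast_nonneg _)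
          (hω.intervalIntegrable_newServers ht.le)
  refine Prod.ext (NNReal.coe_injective ?_) ?_
  · change (work z.1 z.2 t ω : ℝ) = ((0 : ℝ≥0) : ℝ)
    have h1 := hω.work_le z.1 z.2 ht.le
    rw [arrivedWork_eq hω.job_pos harr0, max_eq_left (by linarith)] at h1
    refine le_antisymm ?_ (NNReal.coe_nonneg _)
    simpa using h1
  · change numServers z.2 t ω = j
    rw [numServers_eq, oldServers_eq, newServers_eq hω.server_pos harr le_rfl]
    have h1 : ((Finset.range z.2).filter fun i => t < ω.2.2 i) = ∅ := by
      refine Finset.filter_eq_empty_iff.2 fun i hi => ?_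
      have := (hinit i (by simp at hi ⊢; omega)).2
      exact not_lt.2 this.le
    have h2 : ((Finset.range (M + j)).filter fun k => arrivalTime ω.2.1 k ≤ t ∧
        t < arrivalTime ω.2.1 k + (ω.2.1 k).2) = Finset.Ico M (M + j) := by
      ext k
      simp only [Finset.mem_filter, Finset.mem_range, Finset.mem_Ico]
      constructor
      · rintro ⟨hk, -, h3⟩
        refine ⟨?_, hk⟩
        by_contra hkM
        linarith [(hL1 k (not_le.1 hkM)).2, hT k hk]
      · rintro ⟨hkM, hk⟩
        refine ⟨hk, harr.1 k hk, ?_⟩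
        linarith [hL2 k hkM hk, arrivalTime_pos hω.server_pos k]
    rw [h1, h2]
    simp

/-- The event `clearEvent` depends on the initial state only through the bounds `K` and `N`, so its
probability is a uniform lower bound. -/
theorem exists_transition_singleton_ge {t : ℝ} (ht : 0 < t) (K : ℝ≥0) (N j : ℕ) :
    ∃ p : ℝ≥0∞, 0 < p ∧ ∀ z : ℝ≥0 × ℕ, z.1 ≤ K → z.2 ≤ N →
      p ≤ q.transition t z {((0, j) : ℝ≥0 × ℕ)} := by
  obtain ⟨M, hM⟩ := exists_nat_gt ((K : ℝ) / (t / 4))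
  rw [div_lt_iff₀ (by positivity)] at hM
  refine ⟨_, q.law_clearEvent_pos ht M j N, fun z hx hn => ?_⟩
  rw [q.transition_apply t z (measurableSet_singleton _)]
  refine measure_mono_ae ?_
  filter_upwards [q.ae_good] with ω hω hE
  change jobServerM z t ω ∈ {((0, j) : ℝ≥0 × ℕ)}
  rw [← hω.jobServer_eq z ht.le]
  refine hω.jobServer_clearEvent ht hE (le_trans ?_ hM.le) hn
  exact_mod_cast hx

end MGMM

/-! ### Markov chains with a positive recurrent atom -/

section Chain

variable {E : Type*} [MeasurableSpace E]

/-- The occupation measure of the states visited between two visits to `a`, decomposed by time. -/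
noncomputable def tabooMeasure (P : Kernel E E) (a : E) : ℕ → Measure E
  | 0 => Measure.dirac a
  | k + 1 => ((tabooMeasure P a k).bind P).restrict {a}ᶜ

variable [MeasurableSingletonClass E] {P : Kernel E E} {a : E}
  {W : E → ℝ≥0∞}

/-- The total mass is the mean length of an excursion from `a`. Each step lowers the integral of `W`
by at least the current mass, and the sum telescopes. -/
theorem sum_tabooMeasure_univ_le (hW : Measurable W)
    (hdrift : ∀ z, 1 + ∫⁻ y in {a}ᶜ, W y ∂P z ≤ W z) :
    ∑' k, tabooMeasure P a k Set.univ ≤ W a := by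
  refine ENNReal.tsum_le_of_sum_range_le fun n => ?_
  have key : ∫⁻ y, W y ∂tabooMeasure P a n +
      ∑ k ∈ Finset.range n, tabooMeasure P a k Set.univ ≤ W a := by
    induction n with
    | zero => simp [tabooMeasure, lintegral_dirac' a hW]
    | succ n ih =>
      refine le_trans ?_ ih
      rw [Finset.sum_range_succ, add_comm (∑ k ∈ _, _), ← add_assoc]
      gcongr
      have hm : Measurable fun y => ({a}ᶜ : Set E).indicator W y :=
        hW.indicator (measurableSet_singleton a).compl
      rw [tabooMeasure, ← lintegral_indicator (measurableSet_singleton a).compl,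
        Measure.lintegral_bind P.measurable.aemeasurable hm.aemeasurable, ← lintegral_one,
        ← lintegral_add_right _ measurable_const]
      refine lintegral_mono fun z => ?_
      rw [lintegral_indicator (measurableSet_singleton a).compl, add_comm]
      exact hdrift z
  exact le_add_self.trans key

/-- A Markov chain with a positive recurrent atom has a finite invariant measure. -/
theorem exists_invariant_measure [IsMarkovKernel P] (hW : Measurable W) (hWa : W a ≠ ∞)
    (hdrift : ∀ z, 1 + ∫⁻ y in {a}ᶜ, W y ∂P z ≤ W z) :
    ∃ ν : Measure E, IsFiniteMeasure ν ∧ ν ≠ 0 ∧ ν.bind P = ν := by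
  set ν := Measure.sum (tabooMeasure P a) with hν
  have hmass : ν Set.univ ≤ W a := by
    rw [hν, Measure.sum_apply _ MeasurableSet.univ]
    exact sum_tabooMeasure_univ_le hW hdrift
  have hfin : IsFiniteMeasure ν := ⟨hmass.trans_lt (lt_top_iff_ne_top.2 hWa)⟩
  have hνA : ∀ A, MeasurableSet A → ν A = A.indicator 1 a + ∑' k, tabooMeasure P a (k + 1) A := by
    intro A hA
    rw [hν, Measure.sum_apply _ hA, tsum_eq_zero_add' ENNReal.summable, tabooMeasure,
      Measure.dirac_apply' _ hA]
  -- One step from each taboo measure either returns to `a` or yields the next taboo measure.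
  have hνP : ∀ A, MeasurableSet A → ν.bind P A = A.indicator 1 a *
      ∑' k, (tabooMeasure P a k).bind P {a} + ∑' k, tabooMeasure P a (k + 1) A := by
    intro A hA
    rw [Measure.bind_apply hA P.measurable.aemeasurable, hν, lintegral_sum_measure,
      ← ENNReal.tsum_mul_left, ← ENNReal.tsum_add]
    refine tsum_congr fun k => ?_
    rw [← Measure.bind_apply hA P.measurable.aemeasurable, tabooMeasure,
      Measure.restrict_apply hA, ← measure_inter_add_sdiff A (measurableSet_singleton a)]
    congr 1
    by_cases ha : a ∈ A
    · rw [Set.indicator_of_mem ha, Set.inter_eq_right.2 (Set.singleton_subset_iff.2 ha)]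
      simp
    · rw [Set.indicator_of_notMem ha, Set.inter_singleton_eq_empty.2 ha]
      simp
  -- The total return probability is found by mass balance: a Markov kernel preserves the finite
  -- mass of `ν`, so the returning mass replaces exactly the unit mass initially placed at `a`.
  have hβ : ∑' k, (tabooMeasure P a k).bind P {a} = 1 := by
    have h1 := hνP _ MeasurableSet.univ
    rw [Measure.bind_apply MeasurableSet.univ P.measurable.aemeasurable] at h1
    simp only [measure_univ, lintegral_one] at h1
    rw [hνA _ MeasurableSet.univ] at h1
    simp only [Set.indicator_univ, Pi.one_apply, one_mul] at h1
    refine ((ENNReal.add_left_inj ?_).1 h1).symm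
    refine ne_top_of_le_ne_top (measure_ne_top ν Set.univ) ?_
    rw [hνA _ MeasurableSet.univ]
    exact le_add_self
  refine ⟨ν, hfin, ?_, ?_⟩
  · intro h0
    have := hνA _ MeasurableSet.univ
    rw [h0] at this
    simp only [Measure.coe_zero, Pi.zero_apply, Set.indicator_univ, Pi.one_apply] at this
    exact one_ne_zero (add_eq_zero.1 this.symm).1
  · ext A hA
    rw [hνP A hA, hνA A hA, hβ, mul_one]

end Chain

/-! ### The skeleton chain -/

/-- Up to time `m`, the sequence does not visit `a` after having been elsewhere. -/
def NoReturn {E : Type*} (a : E) (m : ℕ) : Set (ℕ → E) :=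
  {f | ∀ i j, i < j → j ≤ m → f i ≠ a → f j ≠ a}

theorem measurableSet_noReturn {E : Type*} [MeasurableSpace E] [MeasurableSingletonClass E]
    (a : E) (m : ℕ) : MeasurableSet (NoReturn a m) := by
  have h : NoReturn a m = ⋂ i, ⋂ j, ⋂ (_ : i < j), ⋂ (_ : j ≤ m),
      ((fun f : ℕ → E => f i) ⁻¹' {a} ∪ (fun f : ℕ → E => f j) ⁻¹' {a}ᶜ) := by
    ext f
    simp only [NoReturn, Set.mem_ofPred_eq, Set.mem_iInter, Set.mem_union, Set.mem_preimage,
      Set.mem_singleton_iff, Set.mem_compl_iff]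
    exact forall_congr' fun i => forall_congr' fun j => forall_congr' fun _ =>
      forall_congr' fun _ => by tauto
  rw [h]
  refine .iInter fun i => .iInter fun j => .iInter fun _ => .iInter fun _ => .union ?_ ?_
  · exact measurable_pi_apply i (measurableSet_singleton a)
  · exact measurable_pi_apply j (measurableSet_singleton a).compl

/-- The sum counts the grid indices before the first return seen on the grid, and the true return is
no later than that one. If none is ever seen, the sum is infinite. -/
theorem returnTime_le_mul_tsum {E : Type*} (f : ℝ → E) (a : E) {T : ℝ} (hT : 0 < T) :
    returnTime f a ≤ ENNReal.ofReal T *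
      ∑' m, (NoReturn a m).indicator 1 (fun k : ℕ => f (k * T)) := by
  classical
  by_cases h : ∃ m, (fun k : ℕ => f (k * T)) ∉ NoReturn a m
  · set m := Nat.find h with hm
    have h1 : (fun k : ℕ => f (k * T)) ∉ NoReturn a m := Nat.find_spec h
    have h2 : ∀ l < m, (fun k : ℕ => f (k * T)) ∈ NoReturn a l := fun l hl =>
      not_not.1 (Nat.find_min h hl)
    simp only [NoReturn, Set.mem_ofPred_eq] at h1
    push Not at h1
    obtain ⟨i, j, hij, hjm, hi, hj⟩ := h1
    have h3 : returnTime f a ≤ ENNReal.ofReal (j * T) := by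
      refine iInf₂_le (j * T) ⟨hj, i * T, by positivity, ?_, hi⟩
      have : (i : ℝ) < j := by exact_mod_cast hij
      gcongr
    refine h3.trans ?_
    have h4 : (m : ℝ≥0∞) ≤ ∑' m, (NoReturn a m).indicator 1 (fun k : ℕ => f (k * T)) := by
      refine le_trans (le_of_eq ?_) (ENNReal.sum_le_tsum (Finset.range m))
      rw [Finset.sum_congr rfl fun l hl => Set.indicator_of_mem (h2 l (Finset.mem_range.1 hl)) _]
      simp
    rw [mul_comm, ENNReal.ofReal_mul hT.le, ENNReal.ofReal_natCast]
    gcongr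
    exact le_trans (by exact_mod_cast hjm) h4
  · push Not at h
    have : ∑' m, (NoReturn a m).indicator (1 : (ℕ → E) → ℝ≥0∞) (fun k : ℕ => f (k * T)) = ∞ := by
      simp_rw [fun m => Set.indicator_of_mem (h m) (1 : (ℕ → E) → ℝ≥0∞)]
      simp
    rw [this, ENNReal.mul_top (by simpa using hT)]
    exact le_top

namespace MGMM

variable (q : MGMM)

/-- Doubling `V` turns the drift `1/2` into `1`. The added constant `D = 2b / p` loses `D P(z, {a})`
when the atom is removed, which is at least `2b` on the box and compensates the excess there. The
step `T` is common to all `j`. -/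
theorem exists_lyapunov (h : q.rhoC < q.rhoS) :
    ∃ T : ℝ, 0 < T ∧ ∀ j : ℕ, ∃ W : ℝ≥0 × ℕ → ℝ≥0∞, Measurable W ∧ (∀ z, W z ≠ ∞) ∧
      ∀ z, 1 + ∫⁻ y in {((0, j) : ℝ≥0 × ℕ)}ᶜ, W y ∂q.transition T z ≤ W z := by
  obtain ⟨T, hT, c, b, K, N, hdrift⟩ := q.exists_drift h
  refine ⟨T, hT, fun j => ?_⟩
  obtain ⟨p, hp, hacc⟩ := q.exists_transition_singleton_ge hT K N j
  set a : ℝ≥0 × ℕ := (0, j)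
  set D : ℝ≥0∞ := 2 * ENNReal.ofReal b / p with hD
  have hDtop : D ≠ ∞ := ENNReal.div_ne_top (by finiteness) hp.ne'
  have hptop : p ≠ ∞ := ne_top_of_le_ne_top (measure_ne_top _ _) (hacc (0, 0) (by simp) (by simp))
  have hDp : D * p = 2 * ENNReal.ofReal b := ENNReal.div_mul_cancel hp.ne' hptop
  have hV := measurable_potential c
  refine ⟨fun z => 2 * potential c z + D, by fun_prop, fun z => ?_, fun z => ?_⟩
  · exact ENNReal.add_ne_top.2 ⟨ENNReal.mul_ne_top (by simp) (potential_ne_top c z), hDtop⟩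
  · have h1 : ∫⁻ y in {a}ᶜ, (2 * potential c y + D) ∂q.transition T z ≤
        2 * ∫⁻ y, potential c y ∂q.transition T z + D * q.transition T z {a}ᶜ := by
      rw [lintegral_add_right _ measurable_const, setLIntegral_const, lintegral_const_mul _ hV]
      gcongr
      exact Measure.restrict_le_self
    have h2 : D * q.transition T z {a}ᶜ + D * q.transition T z {a} = D := by
      rw [← mul_add, add_comm, measure_add_measure_compl (measurableSet_singleton a),
        measure_univ, mul_one]
    have h3 : 2 * (if z.1 ≤ K ∧ z.2 ≤ N then ENNReal.ofReal b else 0) ≤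
        D * q.transition T z {a} := by
      split_ifs with hz
      · rw [← hDp]
        gcongr
        exact hacc z hz.1 hz.2
      · simp
    have h4 := mul_le_mul_right (hdrift z) 2
    rw [mul_add, mul_add, one_div, ENNReal.mul_inv_cancel two_ne_zero ENNReal.ofNat_ne_top] at h4
    calc 1 + ∫⁻ y in {a}ᶜ, (2 * potential c y + D) ∂q.transition T z
        ≤ 1 + (2 * ∫⁻ y, potential c y ∂q.transition T z + D * q.transition T z {a}ᶜ) := by
          gcongr
      _ = (2 * ∫⁻ y, potential c y ∂q.transition T z + 1) + D * q.transition T z {a}ᶜ := by ring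
      _ ≤ (2 * potential c z + D * q.transition T z {a}) + D * q.transition T z {a}ᶜ := by
          exact add_le_add (h4.trans (add_le_add le_rfl h3)) le_rfl
      _ = 2 * potential c z + (D * q.transition T z {a}ᶜ + D * q.transition T z {a}) := by ring
      _ = 2 * potential c z + D := by rw [h2]

theorem ae_jobServerM_zero (z : ℝ≥0 × ℕ) : ∀ᵐ ω ∂q.law, jobServerM z 0 ω = z := by
  filter_upwards [q.ae_good] with ω hω
  rw [← hω.jobServer_eq z le_rfl, jobServer_zero hω]

/-- The law of the skeleton sequence of the process started in `z`. -/
noncomputable def skeletonProb (T : ℝ) (B : Set (ℕ → ℝ≥0 × ℕ)) (z : ℝ≥0 × ℕ) : ℝ≥0∞ :=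
  q.law {ω | (fun k : ℕ => jobServerM z (k * T) ω) ∈ B}

theorem measurable_skeletonProb (T : ℝ) {B : Set (ℕ → ℝ≥0 × ℕ)} (hB : MeasurableSet B) :
    Measurable (q.skeletonProb T B) :=
  q.measurable_law_jobServerM_seq _ hB

theorem law_skeleton_add (z : ℝ≥0 × ℕ) {t T : ℝ} (ht : 0 ≤ t) (hT : 0 ≤ T)
    {B : Set (ℕ → ℝ≥0 × ℕ)} (hB : MeasurableSet B) :
    q.law {ω | (fun k : ℕ => jobServerM z (t + k * T) ω) ∈ B} =
      ∫⁻ y, q.skeletonProb T B y ∂q.transition t z :=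
  q.law_jobServerM_add z ht (fun k => by positivity) hB

/-! ### Finite mean return times through the skeleton. -/

section Return

variable {T : ℝ} {a : ℝ≥0 × ℕ} {W : ℝ≥0 × ℕ → ℝ≥0∞}

theorem skeletonProb_noReturn_succ_self (hT : 0 ≤ T) (m : ℕ) :
    q.skeletonProb T (NoReturn a (m + 1)) a ≤
      ∫⁻ y, q.skeletonProb T (NoReturn a m) y ∂q.transition T a := by
  rw [← q.law_skeleton_add a hT hT (measurableSet_noReturn a m)]
  refine measure_mono fun ω hω i j hij hj => ?_
  have := hω (i + 1) (j + 1) (by omega) (by omega)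
  push_cast at this
  rwa [show ((i : ℝ) + 1) * T = T + i * T by ring, show ((j : ℝ) + 1) * T = T + j * T by ring]
    at this

/-- From a state other than `a`, a visit at the very next grid time is already a return; hence the
next state is confined to the complement of `a`. -/
theorem skeletonProb_noReturn_succ_of_ne (hT : 0 ≤ T) (m : ℕ) {z : ℝ≥0 × ℕ} (hz : z ≠ a) :
    q.skeletonProb T (NoReturn a (m + 1)) z ≤
      ∫⁻ y in {a}ᶜ, q.skeletonProb T (NoReturn a m) y ∂q.transition T z := by
  have hB : MeasurableSet ({f : ℕ → ℝ≥0 × ℕ | f 0 ≠ a} ∩ NoReturn a m) :=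
    MeasurableSet.inter (measurable_pi_apply (X := fun _ : ℕ => ℝ≥0 × ℕ) 0
      (measurableSet_singleton a).compl) (measurableSet_noReturn a m)
  have h1 : q.skeletonProb T (NoReturn a (m + 1)) z ≤ q.law {ω |
      (fun k : ℕ => jobServerM z (T + k * T) ω) ∈ {f | f 0 ≠ a} ∩ NoReturn a m} := by
    refine measure_mono_ae ?_
    filter_upwards [q.ae_jobServerM_zero z] with ω h0 hω
    refine ⟨?_, fun i j hij hj => ?_⟩
    · have := hω 0 1 (by omega) (by omega)
      simp only [Nat.cast_zero, zero_mul, Nat.cast_one, one_mul, h0] at this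
      simpa using this hz
    · have := hω (i + 1) (j + 1) (by omega) (by omega)
      push_cast at this
      rwa [show ((i : ℝ) + 1) * T = T + i * T by ring,
        show ((j : ℝ) + 1) * T = T + j * T by ring] at this
  refine h1.trans ?_
  rw [q.law_skeleton_add z hT hT hB, ← lintegral_indicator (measurableSet_singleton a).compl]
  refine lintegral_mono fun y => ?_
  by_cases hy : y = a
  · have : q.skeletonProb T ({f : ℕ → ℝ≥0 × ℕ | f 0 ≠ a} ∩ NoReturn a m) y = 0 := by
      refine measure_mono_null (t := {ω | jobServerM y 0 ω ≠ y}) ?_ (q.ae_jobServerM_zero y)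
      rintro ω ⟨h0, -⟩ h1
      exact h0 (by simpa using h1.trans hy)
    rw [this]
    exact zero_le
  · rw [Set.indicator_of_mem (by simpa using hy)]
    exact measure_mono fun ω hω => hω.2

/-- The partial sums are bounded inductively by `W` away from `a`. At `a` the chain may first stay
put, which costs a geometric factor and is harmless because the holding probability is not `1`. -/
theorem tsum_skeletonProb_noReturn_lt_top (hT : 0 ≤ T) (hW : Measurable W) (hWfin : ∀ z, W z ≠ ∞)
    (hdrift : ∀ z, 1 + ∫⁻ y in {a}ᶜ, W y ∂q.transition T z ≤ W z)
    (ha : q.transition T a {a} ≠ 1) (z : ℝ≥0 × ℕ) :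
    ∑' m, q.skeletonProb T (NoReturn a m) z < ∞ := by
  classical
  set p := q.transition T a {a} with hp
  have hp1 : p ≤ 1 := prob_le_one
  -- The solution of `c = W a + p c`, the equation of one step from `a`.
  set c := W a / (1 - p) with hc
  have hsub : 1 - p ≠ 0 := (tsub_pos_of_lt (lt_of_le_of_ne hp1 ha)).ne'
  have hcfin : c ≠ ∞ := ENNReal.div_ne_top (hWfin a) hsub
  have hcp : W a + p * c = c := by
    have h1 : W a = (1 - p) * c := by
      rw [hc, ENNReal.mul_div_cancel hsub (ne_top_of_le_ne_top ENNReal.one_ne_top tsub_le_self)]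
    rw [h1, ← add_mul, tsub_add_cancel_of_le hp1, one_mul]
  have key : ∀ n z, ∑ m ∈ Finset.range n, q.skeletonProb T (NoReturn a m) z ≤
      if z = a then c else W z := by
    intro n
    induction n with
    | zero => intro z; simp
    | succ n ih =>
      intro z
      have hprob : q.skeletonProb T (NoReturn a 0) z ≤ 1 := prob_le_one
      have hmeas := fun m => q.measurable_skeletonProb T (measurableSet_noReturn a m)
      have htaboo : ∀ z, ∫⁻ y in {a}ᶜ, ∑ m ∈ Finset.range n, q.skeletonProb T (NoReturn a m) y
          ∂q.transition T z ≤ ∫⁻ y in {a}ᶜ, W y ∂q.transition T z := by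
        intro z
        refine setLIntegral_mono hW fun y hy => (ih y).trans (le_of_eq (if_neg hy))
      rw [Finset.sum_range_succ', add_comm]
      by_cases hz : z = a
      · rw [if_pos hz, hz]
        rw [hz] at hprob
        calc _ ≤ 1 + ∑ m ∈ Finset.range n, ∫⁻ y, q.skeletonProb T (NoReturn a m) y
                ∂q.transition T a := by
              gcongr with m
              exact q.skeletonProb_noReturn_succ_self hT m
          _ = 1 + ∫⁻ y, ∑ m ∈ Finset.range n, q.skeletonProb T (NoReturn a m) y
                ∂q.transition T a := by
              rw [lintegral_finsetSum _ fun m _ => hmeas m]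
          _ = 1 + (∫⁻ y in {a}, ∑ m ∈ Finset.range n, q.skeletonProb T (NoReturn a m) y
                ∂q.transition T a + ∫⁻ y in {a}ᶜ, ∑ m ∈ Finset.range n,
                  q.skeletonProb T (NoReturn a m) y ∂q.transition T a) := by
              rw [lintegral_add_compl _ (measurableSet_singleton a)]
          _ ≤ 1 + (c * p + ∫⁻ y in {a}ᶜ, W y ∂q.transition T a) := by
              refine add_le_add le_rfl (add_le_add ?_ (htaboo a))
              rw [lintegral_singleton]
              gcongr
              exact (ih a).trans (le_of_eq (if_pos rfl))
          _ = (1 + ∫⁻ y in {a}ᶜ, W y ∂q.transition T a) + p * c := by ring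
          _ ≤ W a + p * c := by gcongr; exact hdrift a
          _ = c := hcp
      · rw [if_neg hz]
        calc _ ≤ 1 + ∑ m ∈ Finset.range n, ∫⁻ y in {a}ᶜ, q.skeletonProb T (NoReturn a m) y
                ∂q.transition T z := by
              gcongr with m
              exact q.skeletonProb_noReturn_succ_of_ne hT m hz
          _ = 1 + ∫⁻ y in {a}ᶜ, ∑ m ∈ Finset.range n, q.skeletonProb T (NoReturn a m) y
                ∂q.transition T z := by
              rw [lintegral_finsetSum _ fun m _ => hmeas m]
          _ ≤ 1 + ∫⁻ y in {a}ᶜ, W y ∂q.transition T z := add_le_add le_rfl (htaboo z)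
          _ ≤ W z := hdrift z
  refine (ENNReal.tsum_le_of_sum_range_le fun n => key n z).trans_lt ?_
  split_ifs
  exacts [lt_top_iff_ne_top.2 hcfin, lt_top_iff_ne_top.2 (hWfin z)]

theorem lintegral_returnTime_lt_top (hT : 0 < T) (z : ℝ≥0 × ℕ)
    (hsum : ∑' m, q.skeletonProb T (NoReturn a m) z < ∞) :
    ∫⁻ ω, returnTime (fun t => jobServer z t ω) a ∂q.law < ∞ := by
  have hm : ∀ m, Measurable fun ω => (NoReturn a m).indicator (1 : (ℕ → ℝ≥0 × ℕ) → ℝ≥0∞)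
      (fun k : ℕ => jobServerM z (k * T) ω) := fun m =>
    (measurable_one.indicator (measurableSet_noReturn a m)).comp
      ((measurable_jobServerM_seq fun k : ℕ => k * T).comp measurable_prodMk_left)
  have h1 : ∫⁻ ω, returnTime (fun t => jobServer z t ω) a ∂q.law ≤
      ∫⁻ ω, ENNReal.ofReal T * ∑' m, (NoReturn a m).indicator 1
        (fun k : ℕ => jobServerM z (k * T) ω) ∂q.law := by
    refine lintegral_mono_ae ?_
    filter_upwards [q.ae_good] with ω hω
    refine (returnTime_le_mul_tsum _ a hT).trans (le_of_eq ?_)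
    congr 3
    funext m
    congr 1
    funext k
    exact hω.jobServer_eq z (by positivity)
  refine h1.trans_lt ?_
  rw [lintegral_const_mul _ (Measurable.tsum hm), lintegral_tsum fun m => (hm m).aemeasurable]
  refine ENNReal.mul_lt_top ENNReal.ofReal_lt_top (lt_of_eq_of_lt (tsum_congr fun m => ?_) hsum)
  have hset : MeasurableSet {ω | (fun k : ℕ => jobServerM z (k * T) ω) ∈ NoReturn a m} :=
    ((measurable_jobServerM_seq fun k : ℕ => k * T).comp measurable_prodMk_left)
      (measurableSet_noReturn a m)
  rw [skeletonProb, ← lintegral_indicator_one hset]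
  rfl

/-- A path that never visits `a` lies in every `NoReturn a m`, and the probabilities of these events
are summable, hence tend to `0`. -/
theorem skeletonProb_never_eq_zero (z : ℝ≥0 × ℕ)
    (hsum : ∑' m, q.skeletonProb T (NoReturn a m) z < ∞) :
    q.skeletonProb T {f | ∀ k, f k ≠ a} z = 0 := by
  have h1 := ENNReal.tendsto_atTop_zero_of_tsum_ne_top hsum.ne
  refine le_antisymm (ge_of_tendsto' h1 fun m => measure_mono fun ω hω => ?_) zero_le
  exact fun i j _ _ _ => hω j

end Return

end MGMM

/-! ### Occupation times and averages over a period -/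

theorem setLIntegral_Ioc_const_add (g : ℝ → ℝ≥0∞) (hg : Measurable g) (a b c : ℝ) :
    ∫⁻ u in Set.Ioc a b, g (c + u) = ∫⁻ v in Set.Ioc (c + a) (c + b), g v := by
  rw [← (measurePreserving_add_left volume c).setLIntegral_comp_preimage measurableSet_Ioc hg,
    Set.preimage_const_add_Ioc, add_sub_cancel_left, add_sub_cancel_left]

/-- A function that is periodic on the half-line has the same integral over all periods. -/
theorem setLIntegral_Ioc_period {g : ℝ → ℝ≥0∞} (hg : Measurable g) {C : ℝ≥0∞} (hC : C ≠ ∞)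
    (hgC : ∀ u, g u ≤ C) {T t : ℝ} (hT : 0 ≤ T) (ht : 0 ≤ t)
    (hper : ∀ u, 0 ≤ u → g (T + u) = g u) :
    ∫⁻ u in Set.Ioc 0 T, g (t + u) = ∫⁻ u in Set.Ioc 0 T, g u := by
  have hfin : ∫⁻ u in Set.Ioc 0 t, g u ≠ ∞ := by
    refine ne_top_of_le_ne_top ?_ (lintegral_mono hgC)
    rw [setLIntegral_const, Real.volume_Ioc]
    exact ENNReal.mul_ne_top hC ENNReal.ofReal_ne_top
  have hsplit : ∀ x y : ℝ, 0 ≤ x → 0 ≤ y → ∫⁻ u in Set.Ioc 0 (x + y), g u =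
      (∫⁻ u in Set.Ioc 0 x, g u) + ∫⁻ u in Set.Ioc 0 y, g (x + u) := by
    intro x y hx hy
    rw [setLIntegral_Ioc_const_add g hg, add_zero,
      ← Set.Ioc_union_Ioc_eq_Ioc hx (le_add_of_nonneg_right hy),
      lintegral_union measurableSet_Ioc (Set.Ioc_disjoint_Ioc_of_le le_rfl)]
  -- The interval from `0` to `t + T` is cut at `t` and at `T`; periodicity equates one piece of
  -- each, and finiteness allows it to be cancelled.
  have h1 := hsplit t T ht hT
  rw [add_comm t T, hsplit T t hT ht, setLIntegral_congr_fun measurableSet_Ioc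
    (fun u hu => hper u hu.1.le), add_comm] at h1
  exact ((ENNReal.add_right_inj hfin).1 h1).symm

/-- Fold the half-line onto one period. At almost every phase the folded indicators sum to infinity,
so their integral, which is at most the volume of `O ∩ (0, ∞)`, is infinite. -/
theorem volume_eq_top_of_frequently {O : Set ℝ} (hO : MeasurableSet O) {T : ℝ} (hT : 0 < T)
    (h : ∀ᵐ u ∂volume.restrict (Set.Ioc 0 T), ∀ m : ℕ, ∃ k : ℕ, u + (m + k : ℕ) * T ∈ O) :
    volume (O ∩ Set.Ioi 0) = ∞ := by
  have hmono : Monotone fun k : ℕ => (k : ℝ) * T := fun i j hij => by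
    have : (i : ℝ) ≤ j := by exact_mod_cast hij
    dsimp only
    gcongr
  have hone : Measurable (O.indicator (1 : ℝ → ℝ≥0∞)) := measurable_one.indicator hO
  have hsum : ∑' k : ℕ, ∫⁻ u in Set.Ioc 0 T, O.indicator 1 ((k : ℝ) * T + u) = ∞ := by
    have hm : ∀ k : ℕ, Measurable fun u => O.indicator (1 : ℝ → ℝ≥0∞) ((k : ℝ) * T + u) :=
      fun k => hone.comp (measurable_const_add _)
    rw [← lintegral_tsum fun k => (hm k).aemeasurable]
    have : ∀ᵐ u ∂volume.restrict (Set.Ioc 0 T),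
        ∑' k : ℕ, O.indicator (1 : ℝ → ℝ≥0∞) ((k : ℝ) * T + u) = ∞ := by
      filter_upwards [h] with u hu
      by_contra hne
      have h0 := ENNReal.tendsto_atTop_zero_of_tsum_ne_top hne
      obtain ⟨m, hm⟩ := Filter.eventually_atTop.1 (h0.eventually_lt_const one_pos)
      obtain ⟨k, hk⟩ := hu m
      have := hm (m + k) (by omega)
      rw [add_comm, Set.indicator_of_mem hk] at this
      exact lt_irrefl _ this
    rw [lintegral_congr_ae this]
    simp [hT]
  refine top_le_iff.1 (hsum.ge.trans ?_)
  have hk : ∀ k : ℕ, ∫⁻ u in Set.Ioc 0 T, O.indicator 1 ((k : ℝ) * T + u) =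
      volume (O ∩ Set.Ioc ((k : ℝ) * T) ((Order.succ k : ℕ) * T)) := by
    intro k
    rw [setLIntegral_Ioc_const_add _ hone, add_zero, lintegral_indicator_one hO,
      Measure.restrict_apply hO]
    congr 3
    rw [Nat.succ_eq_succ, Nat.succ_eq_add_one]
    push_cast
    ring
  simp_rw [hk]
  rw [← measure_iUnion (fun i j hij => (hmono.pairwise_disjoint_on_Ioc_succ hij).mono
    Set.inter_subset_right Set.inter_subset_right) fun k => hO.inter measurableSet_Ioc]
  refine measure_mono (Set.iUnion_subset fun k x hx => ⟨hx.1, ?_⟩)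
  exact lt_of_le_of_lt (by positivity) hx.2.1

namespace MGMM

variable (q : MGMM)

/-- From `(0, j)` the different state `(0, j + 1)` is reached with positive probability. -/
theorem transition_self_ne_one {T : ℝ} (hT : 0 < T) (j : ℕ) :
    q.transition T (0, j) {(0, j)} ≠ 1 := by
  intro h1
  obtain ⟨p, hp, hacc⟩ := q.exists_transition_singleton_ge hT 0 j (j + 1)
  have h2 := prob_compl_eq_zero_iff (measurableSet_singleton ((0, j) : ℝ≥0 × ℕ)) |>.2 h1
  refine (hp.trans_le (hacc (0, j) le_rfl le_rfl)).ne' (measure_mono_null ?_ h2)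
  simp

/-- The Markov property at time `u + m T` restarts the skeleton, which almost surely reaches `a`
from any state; a countable intersection over `m` makes the visits recur. -/
theorem ae_frequently_eq {T : ℝ} (hT : 0 < T) {a : ℝ≥0 × ℕ}
    (hsum : ∀ z, ∑' m, q.skeletonProb T (NoReturn a m) z < ∞) (z : ℝ≥0 × ℕ) {u : ℝ} (hu : 0 ≤ u) :
    ∀ᵐ ω ∂q.law, ∀ m : ℕ, ∃ k : ℕ, jobServerM z (u + (m + k : ℕ) * T) ω = a := by
  refine ae_all_iff.2 fun m => ?_
  have hB : MeasurableSet {f : ℕ → ℝ≥0 × ℕ | ∀ k, f k ≠ a} := by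
    rw [Set.ofPred_forall]
    exact .iInter fun k => measurable_pi_apply (X := fun _ : ℕ => ℝ≥0 × ℕ) k
      (measurableSet_singleton a).compl
  have h0 := q.law_skeleton_add z (t := u + m * T) (by positivity) hT.le hB
  simp_rw [q.skeletonProb_never_eq_zero _ (hsum _), lintegral_zero] at h0
  refine measure_mono_null (fun ω hω => ?_) h0
  refine fun k hk => hω ⟨k, ?_⟩
  rw [← hk]
  congr 1
  push_cast
  ring

/-- The Harris measure is the Dirac mass at `a`: charging `A` means that `a ∈ A`. Exchanging "for
almost every phase" with "almost surely" turns recurrence on each grid into infinite Lebesgue time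
at `a`. -/
theorem isHarrisRecurrent_of_tsum {T : ℝ} (hT : 0 < T) {a : ℝ≥0 × ℕ}
    (hsum : ∀ z, ∑' m, q.skeletonProb T (NoReturn a m) z < ∞) :
    IsHarrisRecurrent q.law jobServer := by
  refine ⟨Measure.dirac a, inferInstance, Measure.dirac_ne_zero, fun A hA hφ z => ?_⟩
  have haA : a ∈ A := by
    by_contra haA
    rw [Measure.dirac_apply' _ hA, Set.indicator_of_notMem haA] at hφ
    exact lt_irrefl _ hφ
  have hmeas : MeasurableSet {p : ℝ × Outcome |
      ∀ m : ℕ, ∃ k : ℕ, jobServerM z (p.1 + (m + k : ℕ) * T) p.2 = a} := by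
    simp only [Set.ofPred_forall, Set.ofPred_exists]
    refine .iInter fun m => .iUnion fun k => ?_
    exact measurable_jobServerM.comp
      (f := fun p : ℝ × Outcome => ((p.1 + (m + k : ℕ) * T, p.2), z)) (by fun_prop)
      (measurableSet_singleton a)
  have hae : ∀ᵐ u ∂volume.restrict (Set.Ioc 0 T), ∀ᵐ ω ∂q.law,
      ∀ m : ℕ, ∃ k : ℕ, jobServerM z (u + (m + k : ℕ) * T) ω = a :=
    (ae_restrict_iff' measurableSet_Ioc).2
      (ae_of_all _ fun u hu => q.ae_frequently_eq hT hsum z hu.1.le)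
  filter_upwards [(Measure.ae_ae_comm hmeas).1 hae, q.ae_good] with ω hω hgood
  have hO : MeasurableSet {t : ℝ | jobServerM z t ω = a} :=
    measurable_jobServerM.comp (f := fun t : ℝ => ((t, ω), z)) (by fun_prop)
      (measurableSet_singleton a)
  refine top_le_iff.1 ((volume_eq_top_of_frequently hO hT hω).ge.trans (measure_mono ?_))
  rintro t ⟨ht, ht0⟩
  have ht0 : 0 ≤ t := le_of_lt ht0
  refine ⟨ht0, ?_⟩
  dsimp only
  rw [hgood.jobServer_eq z ht0]
  exact (show jobServerM z t ω = a from ht) ▸ haA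

theorem measurable_transition_apply {A : Set (ℝ≥0 × ℕ)} (hA : MeasurableSet A) :
    Measurable fun p : ℝ × (ℝ≥0 × ℕ) => q.transition p.1 p.2 A := by
  simp_rw [q.transition_apply _ _ hA]
  exact measurable_measure_prodMk_left (measurable_jobServerM.comp
    (f := fun p : (ℝ × (ℝ≥0 × ℕ)) × Outcome => ((p.1.1, p.2), p.1.2)) (by fun_prop) hA)

theorem law_jobServer_mem {t : ℝ} (ht : 0 ≤ t) (z : ℝ≥0 × ℕ) {A : Set (ℝ≥0 × ℕ)}
    (hA : MeasurableSet A) : q.law {ω | jobServer z t ω ∈ A} = q.transition t z A := by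
  rw [q.transition_apply t z hA]
  refine measure_congr ?_
  filter_upwards [q.ae_good] with ω hω
  exact congrArg (· ∈ A) (hω.jobServer_eq z ht)

/-- Averaging an invariant measure of the skeleton over a period gives a stationary distribution. -/
theorem exists_isStationaryDistribution {T : ℝ} (hT : 0 < T) {ν : Measure (ℝ≥0 × ℕ)}
    [IsFiniteMeasure ν] (hν : ν ≠ 0) (hinv : ν.bind (q.transition T) = ν) :
    ∃ π, IsStationaryDistribution q.law jobServer π := by
  have hmeas : Measurable fun p : (ℝ × (ℝ≥0 × ℕ)) × Outcome => jobServerM p.1.2 p.1.1 p.2 :=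
    measurable_jobServerM.comp
      (f := fun p : (ℝ × (ℝ≥0 × ℕ)) × Outcome => ((p.1.1, p.2), p.1.2)) (by fun_prop)
  set π₀ := (((volume.restrict (Set.Ioc 0 T)).prod ν).prod q.law).map
    (fun p => jobServerM p.1.2 p.1.1 p.2) with hπ₀
  have hint : ∀ f : ℝ≥0 × ℕ → ℝ≥0∞, Measurable f → ∫⁻ y, f y ∂π₀ =
      ∫⁻ u in Set.Ioc 0 T, ∫⁻ z, ∫⁻ y, f y ∂q.transition u z ∂ν := by
    intro f hf
    have hfm : Measurable fun p : (ℝ × (ℝ≥0 × ℕ)) × Outcome => f (jobServerM p.1.2 p.1.1 p.2) :=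
      hf.comp hmeas
    rw [hπ₀, lintegral_map hf hmeas, lintegral_prod _ hfm.aemeasurable,
      lintegral_prod _ hfm.lintegral_prod_right'.aemeasurable]
    simp_rw [q.lintegral_transition _ _ hf]
  have hg : ∀ A, MeasurableSet A → Measurable fun u => ∫⁻ z, q.transition u z A ∂ν := fun A hA =>
    (q.measurable_transition_apply hA).lintegral_prod_right'
  have hπA : ∀ A, MeasurableSet A →
      π₀ A = ∫⁻ u in Set.Ioc 0 T, ∫⁻ z, q.transition u z A ∂ν := by
    intro A hA
    rw [← lintegral_indicator_one hA, hint _ (measurable_one.indicator hA)]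
    simp_rw [lintegral_indicator_one hA]
  have huniv : π₀ Set.univ = ν Set.univ * ENNReal.ofReal T := by
    rw [hπA _ .univ]
    simp
  have hν0 : ν Set.univ ≠ 0 := fun h => hν (Measure.measure_univ_eq_zero.1 h)
  have hne0 : π₀ Set.univ ≠ 0 := by
    rw [huniv]
    exact mul_ne_zero hν0 (by simpa using hT)
  have hnetop : π₀ Set.univ ≠ ∞ := by
    rw [huniv]
    exact ENNReal.mul_ne_top (measure_ne_top _ _) ENNReal.ofReal_ne_top
  refine ⟨(π₀ Set.univ)⁻¹ • π₀, ⟨?_⟩, fun t ht A hA => ?_⟩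
  · rw [Measure.smul_apply, smul_eq_mul, ENNReal.inv_mul_cancel hne0 hnetop]
  simp_rw [q.law_jobServer_mem ht _ hA]
  rw [lintegral_smul_measure, Measure.smul_apply]
  congr 1
  rw [hint _ ((q.transition t).measurable_coe hA), hπA A hA]
  have hstep : ∀ u ∈ Set.Ioc 0 T, ∫⁻ z, ∫⁻ y, q.transition t y A ∂q.transition u z ∂ν =
      ∫⁻ z, q.transition (t + u) z A ∂ν := fun u hu => by
    simp_rw [add_comm t u, q.transition_add _ hu.1.le ht hA]
  rw [setLIntegral_congr_fun measurableSet_Ioc hstep]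
  -- By invariance of `ν` under one grid step, the law at time `u` started from `ν` is `T`-periodic
  -- in `u`; its average over a period is therefore insensitive to the shift by `t`.
  refine setLIntegral_Ioc_period (g := fun u => ∫⁻ z, q.transition u z A ∂ν) (hg A hA)
    (measure_ne_top ν Set.univ) (fun u => ?_) hT.le ht fun u hu => ?_
  · exact (lintegral_mono fun z => prob_le_one).trans (by simp)
  · simp_rw [q.transition_add _ hT.le hu hA]
    rw [← Measure.lintegral_bind (q.transition T).measurable.aemeasurable
      ((q.transition u).measurable_coe hA).aemeasurable, hinv]

end MGMM

theorem mainTheorem1 (q : MGMM) (h : q.rhoC < q.rhoS) : q.IsStable := by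
  obtain ⟨T, hT, hlyap⟩ := q.exists_lyapunov h
  have hsum : ∀ (j : ℕ) (z : ℝ≥0 × ℕ),
      ∑' m, q.skeletonProb T (NoReturn ((0, j) : ℝ≥0 × ℕ) m) z < ∞ := by
    intro j z
    obtain ⟨W, hW, hWfin, hdrift⟩ := hlyap j
    exact q.tsum_skeletonProb_noReturn_lt_top hT.le hW hWfin hdrift
      (q.transition_self_ne_one hT j) z
  -- One atom suffices for Harris recurrence and for the stationary distribution.
  obtain ⟨W, hW, hWfin, hdrift⟩ := hlyap 0
  obtain ⟨ν, _, hν, hinv⟩ := exists_invariant_measure hW (hWfin _) hdrift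
  exact ⟨⟨q.isHarrisRecurrent_of_tsum hT (hsum 0), q.exists_isStationaryDistribution hT hν hinv⟩,
    fun j z => q.lintegral_returnTime_lt_top hT z (hsum j z)⟩
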